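/- Let $\mathsf Q=\overline U_{\mathrm i}\,s\ell(2)$ be the restricted quantum group at $\mathfrak q=\mathrm i$: the complex Hopf algebra generated by $E,F,K^{\pm1}$ with relations $$KE=-EK,\quad KF=-FK,\quad [E,F]=\frac{K-K^{-1}}{\mathrm i-\mathrm i^{-1}},\quad E^2=F^2=0,\quad K^4=1,$$ with $\Delta(E)=1\otimes E+E\otimes K$, $\Delta(F)=K^{-1}\otimes F+F\otimes 1$, $\Delta(K)=K\otimes K$, $\epsilon(E)=\epsilon(F)=0$, $\epsilon(K)=1$, $S(E)=-EK^{-1}$, $S(F)=-KF$, $S(K)=K^{-1}$. Let $\beta\in\mathbb C$ with $\beta^4=-1$, put $e_0=\tfrac12(1+K^2)$, $e_1=\tfrac12(1-K^2)$, and let $\Phi\in \mathsf Q^{\otimes 3}$ be $$\begin{aligned}\Phi={}&e_0\otimes e_0\otimes e_0+e_1\otimes e_0\otimes e_0+\Phi^{010}\,e_0\otimes e_1\otimes e_0+e_0\otimes e_0\otimes e_1\\&+e_1\otimes e_1\otimes e_0+\Phi^{101}\,e_1\otimes e_0\otimes e_1+e_0\otimes e_1\otimes e_1+\Phi^{111}\,e_1\otimes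 e_1\otimes e_1,\end{aligned}$$ where $$\Phi^{010}=1\otimes1\otimes1-(1+\mathrm i)E\otimes K\otimes F+(1-\mathrm i)FK\otimes K\otimes EK+2\,EFK\otimes1\otimes EFK,$$ $$\begin{aligned}\Phi^{101}={}&(\mathrm i-1)1\otimes F\otimes EK+1\otimes K\otimes1+2\cdot1\otimes EF\otimes EFK-(1+\mathrm i)1\otimes EK\otimes F\\&-(1+\mathrm i)E\otimes FK\otimes1+2\mathrm i\,E\otimes EFK\otimes F+(1-\mathrm i)FK\otimes E\otimes1\\&-2\mathrm i\,FK\otimes EFK\otimes EK-2\,EFK\otimes EF\otimes1,\end{aligned}$$ $$\begin{aligned}\Phi^{111}={}&\mathrm i\beta^2\{(1+\mathrm i)1\otimes F\otimes EK-1\otimes K\otimes1-2\cdot1\otimes EF\otimes1-2\mathrm i\,1\otimes EF\otimes EFK\\&+(1+\mathrm i)1\otimes EK\otimes F-(1+\mathrm i)E\otimes1\otimes F+(1+\mathrm i)E\otimes FK\otimes1+2\mathrm i\,E\otimes FK\otimes EFK\\&+2\,E\otimes EFK\otimes F-(1+\mathrm i)FK\otimes1\otimes EK+(1+\mathrm i)FK\otimes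 E\otimes1+2\mathrm i\,FK\otimes E\otimes EFK\\&+2\,FK\otimes EFK\otimes EK+2\mathrm i\,EFK\otimes F\otimes EK+2\mathrm i\,EFK\otimes K\otimes EFK-2\mathrm i\,EFK\otimes EF\otimes1\\&+2\mathrm i\,EFK\otimes EK\otimes F+4\,EFK\otimes EF\otimes EFK\}.\end{aligned}$$ A *coassociator* (3-cocycle) on a bialgebra $A$ is an invertible $\Psi\in A^{\otimes3}$ with $(\Delta\otimes\mathrm{id})\Delta(a)\,\Psi=\Psi\,(\mathrm{id}\otimes\Delta)\Delta(a)$ for all $a$, $(\mathrm{id}\otimes\epsilon\otimes\mathrm{id})\Psi=1\otimes1$ and $$(\Delta\otimes\mathrm{id}\otimes\mathrm{id})(\Psi)\,(\mathrm{id}\otimes\mathrm{id}\otimes\Delta)(\Psi)=(\Psi\otimes1)\,(\mathrm{id}\otimes\Delta\otimes\mathrm{id})(\Psi)\,(1\otimes\Psi).$$ Two of them are cohomologous if they differ by $\Psi\mapsto(F\otimes1)(\Delta\otimes\mathrm{id})(F)\,\Psi\,(\mathrm{id}\otimes\Delta)(F)^{-1}(1\otimes F)^{-1}$ for some invertible counital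 $F\in A\otimes A$ commuting with $\Delta(A)$; the set of classes, pointed by the class of $1\otimes1\otimes1$, is the third Hopf algebra cohomology of $A$. $\mathbf{Rep}(A,\Psi)$ is the monoidal category of finite-dimensional $A$-modules, with $A$ acting on tensor products through $\Delta$, on the unit $\mathbb C$ through $\epsilon$, with the unit isomorphisms of vector spaces and the associativity isomorphisms $U\otimes(V\otimes W)\to(U\otimes V)\otimes W$ given by the action of $\Psi$; $\mathbf{Rep}\,A=\mathbf{Rep}(A,1\otimes1\otimes1)$. The *Drinfeld twist* of a Hopf algebra $A$ by an invertible counital $F\in A\otimes A$ is the quasi-bialgebra with the same algebra and counit, coproduct $F\Delta F^{-1}$ and coassociator $(F\otimes1)(\Delta\otimes\mathrm{id})(F)(\mathrm{id}\otimes\Delta)(F)^{-1}(1\otimes F)^{-1}$. **Corollary.** $\Phi$ is a coassociator on $\mathsf Q$, and 1. the class of $\Phi$ in the third Hopf algebra cohomology of $\mathsf Q$ is non-trivial; 2. the quasi-bialgebra $(\mathsf Q,\Phi)$ is not isomorphic to (in particular, not equal to) any Drinfeld twist of the Hopf algebra $\mathsf Q$; 3. the identity functor cannot be endowed with the structure of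 a monoidal functor $\mathbf{Rep}(\mathsf Q,\Phi)\to\mathbf{Rep}\,\mathsf Q$; 4. $\mathbf{Rep}(\mathsf Q,\Phi)$ is not equivalent to $\mathbf{Rep}\,\mathsf Q$ as a monoidal category. -/

import Mathlib

set_option maxSynthPendingDepth 3

open scoped TensorProduct
open CategoryTheory

noncomputable section

namespace QHopf

/-! ### Leg maps on tensor powers of an algebra -/

section Legs

variable {A : Type} [Ring A] [Algebra ℂ A]

/-- `Δ ⊗ id : A ⊗ A → A ⊗ A ⊗ A`. -/
def comulFst (Δ : A →ₐ[ℂ] A ⊗[ℂ] A) : A ⊗[ℂ] A →ₐ[ℂ] A ⊗[ℂ] (A ⊗[ℂ] A) :=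
  (Algebra.TensorProduct.assoc ℂ ℂ ℂ A A A).toAlgHom.comp
    (Algebra.TensorProduct.map Δ (AlgHom.id ℂ A))

/-- `id ⊗ Δ : A ⊗ A → A ⊗ A ⊗ A`. -/
def comulSnd (Δ : A →ₐ[ℂ] A ⊗[ℂ] A) : A ⊗[ℂ] A →ₐ[ℂ] A ⊗[ℂ] (A ⊗[ℂ] A) :=
  Algebra.TensorProduct.map (AlgHom.id ℂ A) Δ

/-- `x ↦ x ⊗ 1` from `A ⊗ A` to `A ⊗ A ⊗ A`. -/
def leg12 : A ⊗[ℂ] A →ₐ[ℂ] A ⊗[ℂ] (A ⊗[ℂ] A) :=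
  Algebra.TensorProduct.map (AlgHom.id ℂ A) Algebra.TensorProduct.includeLeft

/-- `x ↦ 1 ⊗ x` from `A ⊗ A` to `A ⊗ A ⊗ A`. -/
def leg23 : A ⊗[ℂ] A →ₐ[ℂ] A ⊗[ℂ] (A ⊗[ℂ] A) :=
  Algebra.TensorProduct.includeRight

/-- `Δ ⊗ id ⊗ id`. -/
def comul1 (Δ : A →ₐ[ℂ] A ⊗[ℂ] A) :
    A ⊗[ℂ] (A ⊗[ℂ] A) →ₐ[ℂ] A ⊗[ℂ] (A ⊗[ℂ] (A ⊗[ℂ] A)) :=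
  (Algebra.TensorProduct.assoc ℂ ℂ ℂ A A (A ⊗[ℂ] A)).toAlgHom.comp
    (Algebra.TensorProduct.map Δ (AlgHom.id ℂ (A ⊗[ℂ] A)))

/-- `id ⊗ Δ ⊗ id`. -/
def comul2 (Δ : A →ₐ[ℂ] A ⊗[ℂ] A) :
    A ⊗[ℂ] (A ⊗[ℂ] A) →ₐ[ℂ] A ⊗[ℂ] (A ⊗[ℂ] (A ⊗[ℂ] A)) :=
  Algebra.TensorProduct.map (AlgHom.id ℂ A) (comulFst Δ)

/-- `id ⊗ id ⊗ Δ`. -/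
def comul3 (Δ : A →ₐ[ℂ] A ⊗[ℂ] A) :
    A ⊗[ℂ] (A ⊗[ℂ] A) →ₐ[ℂ] A ⊗[ℂ] (A ⊗[ℂ] (A ⊗[ℂ] A)) :=
  Algebra.TensorProduct.map (AlgHom.id ℂ A) (comulSnd Δ)

/-- `x ↦ x ⊗ 1` from `A ⊗ A ⊗ A` to `A ⊗ A ⊗ A ⊗ A`. -/
def leg123 : A ⊗[ℂ] (A ⊗[ℂ] A) →ₐ[ℂ] A ⊗[ℂ] (A ⊗[ℂ] (A ⊗[ℂ] A)) :=
  Algebra.TensorProduct.map (AlgHom.id ℂ A) leg12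

/-- `x ↦ 1 ⊗ x` from `A ⊗ A ⊗ A` to `A ⊗ A ⊗ A ⊗ A`. -/
def leg234 : A ⊗[ℂ] (A ⊗[ℂ] A) →ₐ[ℂ] A ⊗[ℂ] (A ⊗[ℂ] (A ⊗[ℂ] A)) :=
  Algebra.TensorProduct.includeRight

/-- `ε ⊗ id : A ⊗ A → A`. -/
def counitFst (ε : A →ₐ[ℂ] ℂ) : A ⊗[ℂ] A →ₐ[ℂ] A :=
  (Algebra.TensorProduct.lid ℂ A).toAlgHom.comp
    (Algebra.TensorProduct.map ε (AlgHom.id ℂ A))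

/-- `id ⊗ ε : A ⊗ A → A`. -/
def counitSnd (ε : A →ₐ[ℂ] ℂ) : A ⊗[ℂ] A →ₐ[ℂ] A :=
  (Algebra.TensorProduct.rid ℂ ℂ A).toAlgHom.comp
    (Algebra.TensorProduct.map (AlgHom.id ℂ A) ε)

/-- `id ⊗ ε ⊗ id : A ⊗ A ⊗ A → A ⊗ A`. -/
def counitMid (ε : A →ₐ[ℂ] ℂ) : A ⊗[ℂ] (A ⊗[ℂ] A) →ₐ[ℂ] A ⊗[ℂ] A :=
  Algebra.TensorProduct.map (AlgHom.id ℂ A) (counitFst ε)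

end Legs

/-! ### Quasi-bialgebras -/

/-- A quasi-bialgebra structure on a complex algebra `A`
(with trivial unit constraints): counit, comultiplication and coassociator `Φ`. -/
structure QuasiBialgebra (A : Type) [Ring A] [Algebra ℂ A] where
  counit : A →ₐ[ℂ] ℂ
  comul : A →ₐ[ℂ] A ⊗[ℂ] A
  Φ : (A ⊗[ℂ] (A ⊗[ℂ] A))ˣ
  counit_fst : ∀ a, counitFst counit (comul a) = a
  counit_snd : ∀ a, counitSnd counit (comul a) = a
  quasi_coassoc : ∀ a, comulFst comul (comul a) = Φ * comulSnd comul (comul a) * (Φ⁻¹).val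
  counital : counitMid counit Φ.val = 1
  cocycle : comul1 comul Φ.val * comul3 comul Φ.val
    = leg123 Φ.val * comul2 comul Φ.val * leg234 Φ.val

namespace QuasiBialgebra

/-- `K` is the Drinfeld twist of `H` by the invertible element `F`:
`ε_K = ε`, `Δ_K = F Δ F⁻¹` and
`Φ_K = (F ⊗ 1) (Δ ⊗ id)(F) Φ (id ⊗ Δ)(F)⁻¹ (1 ⊗ F)⁻¹`, with `F` counital. -/
structure IsTwist {A : Type} [Ring A] [Algebra ℂ A] (H K : QuasiBialgebra A)
    (F : (A ⊗[ℂ] A)ˣ) : Prop where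
  counit_fst : counitFst H.counit F.val = 1
  counit_snd : counitSnd H.counit F.val = 1
  counit_eq : K.counit = H.counit
  comul_eq : ∀ a, K.comul a = F * H.comul a * (F⁻¹).val
  coassociator_eq : K.Φ.val = leg12 F.val * comulFst H.comul F.val * H.Φ.val
    * comulSnd H.comul (F⁻¹).val * leg23 (F⁻¹).val

/-- An isomorphism of quasi-bialgebras. -/
structure Iso {A B : Type} [Ring A] [Algebra ℂ A] [Ring B] [Algebra ℂ B]
    (H : QuasiBialgebra A) (K : QuasiBialgebra B) where
  toAlgEquiv : A ≃ₐ[ℂ] B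
  counit_eq : ∀ a, K.counit (toAlgEquiv a) = H.counit a
  comul_eq : ∀ a, K.comul (toAlgEquiv a) =
    Algebra.TensorProduct.map toAlgEquiv.toAlgHom toAlgEquiv.toAlgHom (H.comul a)
  coassociator_eq : K.Φ.val = Algebra.TensorProduct.map toAlgEquiv.toAlgHom
    (Algebra.TensorProduct.map toAlgEquiv.toAlgHom toAlgEquiv.toAlgHom) H.Φ.val

/-- Up to isomorphism, `K` can be obtained from `H` by a Drinfeld twist. -/
def IsTwistEquivalent {A B : Type} [Ring A] [Algebra ℂ A] [Ring B] [Algebra ℂ B]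
    (H : QuasiBialgebra A) (K : QuasiBialgebra B) : Prop :=
  ∃ (H' : QuasiBialgebra A) (F : (A ⊗[ℂ] A)ˣ), H.IsTwist H' F ∧ Nonempty (Iso H' K)

end QuasiBialgebra

/-! ### Coassociators on a bialgebra and cohomology in degree three -/

section Cohomology

open Bialgebra

variable {A : Type} [Ring A] [Bialgebra ℂ A]

/-- A coassociator on a bialgebra `A`, i.e. a `3`-cocycle: an invertible, counital element
`Φ` of `A ⊗ A ⊗ A` which commutes with the iterated coproduct (that is, it intertwines
`(id ⊗ Δ)Δ` and `(Δ ⊗ id)Δ`) and satisfies the `3`-cocycle condition. -/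
structure IsCoassociator (Φ : A ⊗[ℂ] (A ⊗[ℂ] A)) : Prop where
  isUnit : IsUnit Φ
  intertwines : ∀ a : A, comulFst (comulAlgHom ℂ A) (comulAlgHom ℂ A a) * Φ
    = Φ * comulSnd (comulAlgHom ℂ A) (comulAlgHom ℂ A a)
  counital : counitMid (counitAlgHom ℂ A) Φ = 1
  cocycle : comul1 (comulAlgHom ℂ A) Φ * comul3 (comulAlgHom ℂ A) Φ
    = leg123 Φ * comul2 (comulAlgHom ℂ A) Φ * leg234 Φ

lemma comulFst_comul (a : A) : comulFst (comulAlgHom ℂ A) (comulAlgHom ℂ A a)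
    = comulSnd (comulAlgHom ℂ A) (comulAlgHom ℂ A a) :=
  Coalgebra.coassoc_apply (R := ℂ) a

lemma isCoassociator_one : IsCoassociator (1 : A ⊗[ℂ] (A ⊗[ℂ] A)) where
  isUnit := isUnit_one
  intertwines a := by rw [mul_one, one_mul, comulFst_comul]
  counital := map_one _
  cocycle := by simp only [map_one, mul_one]

lemma counitFst_comul (a : A) : counitFst (counitAlgHom ℂ A) (comulAlgHom ℂ A a) = a := by
  have h : (Algebra.TensorProduct.map (counitAlgHom ℂ A) (AlgHom.id ℂ A)) (comulAlgHom ℂ A a)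
      = 1 ⊗ₜ a := Coalgebra.rTensor_counit_comul (R := ℂ) a
  rw [counitFst, AlgHom.comp_apply, h]
  simp

lemma counitSnd_comul (a : A) : counitSnd (counitAlgHom ℂ A) (comulAlgHom ℂ A a) = a := by
  have h : (Algebra.TensorProduct.map (AlgHom.id ℂ A) (counitAlgHom ℂ A)) (comulAlgHom ℂ A a)
      = a ⊗ₜ 1 := Coalgebra.lTensor_counit_comul (R := ℂ) a
  rw [counitSnd, AlgHom.comp_apply, h]
  simp

variable (A) in
/-- The quasi-bialgebra `(A, Φ)` obtained from a bialgebra `A` and a coassociator on it. -/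
def QuasiBialgebra.ofCoassociator (Φ : A ⊗[ℂ] (A ⊗[ℂ] A)) (h : IsCoassociator Φ) :
    QuasiBialgebra A where
  counit := counitAlgHom ℂ A
  comul := comulAlgHom ℂ A
  Φ := h.isUnit.unit
  counit_fst := counitFst_comul
  counit_snd := counitSnd_comul
  quasi_coassoc a := by
    rw [Units.eq_mul_inv_iff_mul_eq]
    exact h.intertwines a
  counital := h.counital
  cocycle := h.cocycle

variable (A) in
/-- A bialgebra regarded as a quasi-bialgebra with coassociator `1 ⊗ 1 ⊗ 1`. -/
def QuasiBialgebra.ofBialgebra : QuasiBialgebra A :=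
  QuasiBialgebra.ofCoassociator A 1 isCoassociator_one

/-- An invariant counital `2`-cochain: an invertible element `F` of `A ⊗ A` that commutes with
all coproducts and is normalised by the counit. -/
structure IsInvariantCochain (F : (A ⊗[ℂ] A)ˣ) : Prop where
  invariant : ∀ a : A, F.val * comulAlgHom ℂ A a = comulAlgHom ℂ A a * F.val
  counit_fst : counitFst (counitAlgHom ℂ A) F.val = 1
  counit_snd : counitSnd (counitAlgHom ℂ A) F.val = 1

/-- Two elements of `A ⊗ A ⊗ A` are cohomologous if they differ by the action
`Φ ↦ (F ⊗ 1) (Δ ⊗ id)(F) Φ (id ⊗ Δ)(F)⁻¹ (1 ⊗ F)⁻¹` of an invariant `2`-cochain `F`. In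
particular `Φ` is cohomologous to `1` iff it is the coboundary of such an `F`. -/
def Cohomologous (Φ Ψ : A ⊗[ℂ] (A ⊗[ℂ] A)) : Prop :=
  ∃ F : (A ⊗[ℂ] A)ˣ, IsInvariantCochain F ∧
    Ψ = leg12 F.val * comulFst (comulAlgHom ℂ A) F.val * Φ
      * comulSnd (comulAlgHom ℂ A) (F⁻¹).val * leg23 (F⁻¹).val

namespace IsInvariantCochain

lemma one : IsInvariantCochain (1 : (A ⊗[ℂ] A)ˣ) :=
  ⟨fun a => by simp, by simp, by simp⟩

lemma inv {F : (A ⊗[ℂ] A)ˣ} (h : IsInvariantCochain F) : IsInvariantCochain F⁻¹ := by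
  refine ⟨fun a => ?_, ?_, ?_⟩
  · rw [Units.inv_mul_eq_iff_eq_mul, ← mul_assoc, h.invariant, Units.mul_inv_cancel_right]
  · have := congrArg (counitFst (counitAlgHom ℂ A)) F.mul_inv
    rwa [map_mul, h.counit_fst, one_mul, map_one] at this
  · have := congrArg (counitSnd (counitAlgHom ℂ A)) F.mul_inv
    rwa [map_mul, h.counit_snd, one_mul, map_one] at this

lemma mul {F G : (A ⊗[ℂ] A)ˣ} (hF : IsInvariantCochain F) (hG : IsInvariantCochain G) :
    IsInvariantCochain (F * G) := by
  refine ⟨fun a => ?_, ?_, ?_⟩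
  · rw [Units.val_mul, mul_assoc, hG.invariant, ← mul_assoc, hF.invariant, mul_assoc]
  · rw [Units.val_mul, map_mul, hF.counit_fst, hG.counit_fst, one_mul]
  · rw [Units.val_mul, map_mul, hF.counit_snd, hG.counit_snd, one_mul]

lemma leg12_comm {F : (A ⊗[ℂ] A)ˣ} (hF : IsInvariantCochain F) (x : A ⊗[ℂ] A) :
    leg12 F.val * comulFst (comulAlgHom ℂ A) x = comulFst (comulAlgHom ℂ A) x * leg12 F.val := by
  have key : ∀ y : A ⊗[ℂ] A, leg12 y =
      (Algebra.TensorProduct.assoc ℂ ℂ ℂ A A A).toAlgHom (y ⊗ₜ 1) := by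
    intro y
    induction y with
    | zero => simp
    | tmul p q => simp [leg12]
    | add p q hp hq => simp only [map_add, hp, hq, TensorProduct.add_tmul]
  induction x with
  | zero => simp
  | tmul a b =>
    rw [key, comulFst, AlgHom.comp_apply, ← map_mul, ← map_mul]
    simp [hF.invariant a, -comulAlgHom_apply]
  | add p q hp hq => simp only [map_add, mul_add, add_mul, hp, hq]

lemma leg23_comm {F : (A ⊗[ℂ] A)ˣ} (hF : IsInvariantCochain F) (x : A ⊗[ℂ] A) :
    leg23 F.val * comulSnd (comulAlgHom ℂ A) x = comulSnd (comulAlgHom ℂ A) x * leg23 F.val := by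
  induction x with
  | zero => simp
  | tmul a b => simp [leg23, comulSnd, hF.invariant b, -comulAlgHom_apply]
  | add p q hp hq => simp only [map_add, mul_add, add_mul, hp, hq]

end IsInvariantCochain

lemma cohomologous_equivalence :
    Equivalence (Cohomologous : A ⊗[ℂ] (A ⊗[ℂ] A) → A ⊗[ℂ] (A ⊗[ℂ] A) → Prop) where
  refl Φ := ⟨1, IsInvariantCochain.one, by simp⟩
  symm := by
    rintro Φ Ψ ⟨F, hF, rfl⟩
    refine ⟨F⁻¹, hF.inv, ?_⟩
    rw [hF.inv.leg12_comm, inv_inv]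
    have e1 : comulFst (comulAlgHom ℂ A) (F⁻¹).val * leg12 (F⁻¹).val * (leg12 F.val *
        comulFst (comulAlgHom ℂ A) F.val) = 1 := by
      rw [mul_assoc, ← mul_assoc (leg12 (F⁻¹).val), ← map_mul leg12, F.inv_mul, map_one, one_mul,
        ← map_mul, F.inv_mul, map_one]
    have e2 : comulSnd (comulAlgHom ℂ A) (F⁻¹).val * leg23 (F⁻¹).val *
        (comulSnd (comulAlgHom ℂ A) F.val * leg23 F.val) = 1 := by
      rw [← hF.leg23_comm, mul_assoc, ← mul_assoc (leg23 (F⁻¹).val), ← map_mul leg23, F.inv_mul,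
        map_one, one_mul, ← map_mul, F.inv_mul, map_one]
    calc Φ = (comulFst (comulAlgHom ℂ A) (F⁻¹).val * leg12 (F⁻¹).val * (leg12 F.val *
        comulFst (comulAlgHom ℂ A) F.val)) * Φ * (comulSnd (comulAlgHom ℂ A) (F⁻¹).val *
        leg23 (F⁻¹).val * (comulSnd (comulAlgHom ℂ A) F.val * leg23 F.val)) := by
          rw [e1, e2, one_mul, mul_one]
      _ = _ := by simp only [mul_assoc]
  trans := by
    rintro Φ Ψ Θ ⟨F, hF, rfl⟩ ⟨G, hG, rfl⟩
    refine ⟨G * F, hG.mul hF, ?_⟩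
    have e1 : leg12 (G * F).val * comulFst (comulAlgHom ℂ A) (G * F).val =
        leg12 G.val * comulFst (comulAlgHom ℂ A) G.val *
          (leg12 F.val * comulFst (comulAlgHom ℂ A) F.val) := by
      rw [Units.val_mul, map_mul, map_mul, mul_assoc, ← mul_assoc (leg12 F.val), hF.leg12_comm]
      simp only [mul_assoc]
    have e2 : comulSnd (comulAlgHom ℂ A) ((G * F)⁻¹).val * leg23 ((G * F)⁻¹).val =
        comulSnd (comulAlgHom ℂ A) (F⁻¹).val * leg23 (F⁻¹).val *
          (comulSnd (comulAlgHom ℂ A) (G⁻¹).val * leg23 (G⁻¹).val) := by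
      rw [mul_inv_rev, Units.val_mul, map_mul, map_mul, mul_assoc (comulSnd _ (F⁻¹).val),
        ← mul_assoc (comulSnd _ (G⁻¹).val), ← hF.inv.leg23_comm]
      simp only [mul_assoc]
    rw [mul_assoc _ (comulSnd _ ((G * F)⁻¹).val), e1, e2]
    simp only [mul_assoc]

variable (A) in
/-- The third (non-abelian) cohomology of a bialgebra, as a pointed set: `3`-cocycles modulo the
action of invariant `2`-cochains. (For a non-commutative bialgebra only the invariant `2`-cochains
leave the comultiplication unchanged, hence act on the `3`-cocycles of the given bialgebra.) -/
def H3 : Type :=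
  Quotient (⟨fun x y => Cohomologous x.1 y.1, fun x => cohomologous_equivalence.refl x.1,
    fun h => cohomologous_equivalence.symm h, fun h => cohomologous_equivalence.trans h⟩ :
    Setoid {Φ : A ⊗[ℂ] (A ⊗[ℂ] A) // IsCoassociator Φ})

/-- The class of a `3`-cocycle. -/
def H3.mk (Φ : A ⊗[ℂ] (A ⊗[ℂ] A)) (h : IsCoassociator Φ) : H3 A := Quotient.mk _ ⟨Φ, h⟩

/-- The trivial class. -/
def H3.trivial : H3 A := H3.mk 1 isCoassociator_one

end Cohomology

/-! ### The monoidal category of finite-dimensional representations -/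

section Actions

variable {A B C D : Type} [Ring A] [Algebra ℂ A] [Ring B] [Algebra ℂ B] [Ring C] [Algebra ℂ C]
  [Ring D] [Algebra ℂ D]
variable {U V W X : Type} [AddCommGroup U] [Module ℂ U] [AddCommGroup V] [Module ℂ V]
  [AddCommGroup W] [Module ℂ W] [AddCommGroup X] [Module ℂ X]

/-- The action of `A ⊗ B` on `U ⊗ V` given by actions of `A` on `U` and of `B` on `V`. -/
def tensorAction (ρ : A →ₐ[ℂ] Module.End ℂ U) (σ : B →ₐ[ℂ] Module.End ℂ V) :
    A ⊗[ℂ] B →ₐ[ℂ] Module.End ℂ (U ⊗[ℂ] V) :=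
  Module.endTensorEndAlgHom.comp (Algebra.TensorProduct.map ρ σ)

@[simp] lemma tensorAction_tmul (ρ : A →ₐ[ℂ] Module.End ℂ U) (σ : B →ₐ[ℂ] Module.End ℂ V)
    (a : A) (b : B) (u : U) (v : V) :
    tensorAction ρ σ (a ⊗ₜ b) (u ⊗ₜ v) = ρ a u ⊗ₜ σ b v := rfl

lemma tensorAction_comp_right (ρ : A →ₐ[ℂ] Module.End ℂ U) (σ : C →ₐ[ℂ] Module.End ℂ V)
    (f : B →ₐ[ℂ] C) (x : A ⊗[ℂ] B) :
    tensorAction ρ (σ.comp f) x =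
      tensorAction ρ σ (Algebra.TensorProduct.map (AlgHom.id ℂ A) f x) := by
  induction x with
  | zero => simp
  | tmul a b => ext; simp
  | add p q hp hq => simp only [map_add, hp, hq]

lemma tensorAction_comp_left (ρ : C →ₐ[ℂ] Module.End ℂ U) (σ : B →ₐ[ℂ] Module.End ℂ V)
    (f : A →ₐ[ℂ] C) (x : A ⊗[ℂ] B) :
    tensorAction (ρ.comp f) σ x =
      tensorAction ρ σ (Algebra.TensorProduct.map f (AlgHom.id ℂ B) x) := by
  induction x with
  | zero => simp
  | tmul a b => ext; simp
  | add p q hp hq => simp only [map_add, hp, hq]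

lemma assoc_tensorAction (ρ : A →ₐ[ℂ] Module.End ℂ U) (σ : B →ₐ[ℂ] Module.End ℂ V)
    (τ : C →ₐ[ℂ] Module.End ℂ W) (x : (A ⊗[ℂ] B) ⊗[ℂ] C) (w : (U ⊗[ℂ] V) ⊗[ℂ] W) :
    TensorProduct.assoc ℂ U V W (tensorAction (tensorAction ρ σ) τ x w) =
      tensorAction ρ (tensorAction σ τ) ((Algebra.TensorProduct.assoc ℂ ℂ ℂ A B C).toAlgHom x)
        (TensorProduct.assoc ℂ U V W w) := by
  induction x with
  | zero => simp
  | add p q hp hq => simp only [map_add, LinearMap.add_apply, hp, hq]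
  | tmul ab c =>
    induction ab with
    | zero => simp
    | add p q hp hq => simp only [TensorProduct.add_tmul, map_add, LinearMap.add_apply, hp, hq]
    | tmul a b =>
      induction w with
      | zero => simp
      | add p q hp hq => simp only [map_add, hp, hq]
      | tmul uv w =>
        induction uv with
        | zero => simp
        | add p q hp hq => simp only [TensorProduct.add_tmul, map_add, hp, hq]
        | tmul u v => simp

/-- Tensor products of intertwiners intertwine the tensor product actions. -/
lemma map_tensorAction {U' V' : Type} [AddCommGroup U'] [Module ℂ U'] [AddCommGroup V']
    [Module ℂ V'] (ρ : A →ₐ[ℂ] Module.End ℂ U) (σ : B →ₐ[ℂ] Module.End ℂ V)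
    (ρ' : A →ₐ[ℂ] Module.End ℂ U') (σ' : B →ₐ[ℂ] Module.End ℂ V') (f : U →ₗ[ℂ] U')
    (g : V →ₗ[ℂ] V') (hf : ∀ a u, f (ρ a u) = ρ' a (f u)) (hg : ∀ b v, g (σ b v) = σ' b (g v))
    (x : A ⊗[ℂ] B) (w : U ⊗[ℂ] V) :
    TensorProduct.map f g (tensorAction ρ σ x w) =
      tensorAction ρ' σ' x (TensorProduct.map f g w) := by
  induction x with
  | zero => simp
  | add p q hp hq => simp only [map_add, LinearMap.add_apply, hp, hq]
  | tmul a b =>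
    induction w with
    | zero => simp
    | add p q hp hq => simp only [map_add, hp, hq]
    | tmul u v => simp [hf, hg]

lemma tensorAction_includeRight (ρ : A →ₐ[ℂ] Module.End ℂ U) (σ : B →ₐ[ℂ] Module.End ℂ V)
    (x : B) : tensorAction ρ σ (Algebra.TensorProduct.includeRight x)
      = TensorProduct.map LinearMap.id (σ x) := by
  ext; simp

lemma tensorAction_tmul_one (ρ : A →ₐ[ℂ] Module.End ℂ U) (σ : B →ₐ[ℂ] Module.End ℂ V)
    (x : A) : tensorAction ρ σ (x ⊗ₜ 1)
      = TensorProduct.map (ρ x) LinearMap.id := by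
  ext; simp

lemma leg123_assoc (x : A ⊗[ℂ] (A ⊗[ℂ] A)) : leg123 x =
    (Algebra.TensorProduct.map (AlgHom.id ℂ A)
      (Algebra.TensorProduct.assoc ℂ ℂ ℂ A A A).toAlgHom)
      ((Algebra.TensorProduct.assoc ℂ ℂ ℂ A (A ⊗[ℂ] A) A).toAlgHom (x ⊗ₜ 1)) := by
  induction x with
  | zero => simp
  | add p q hp hq => simp only [map_add, hp, hq, TensorProduct.add_tmul]
  | tmul a y =>
    induction y with
    | zero => simp
    | add p q hp hq =>
      simp only [map_add, hp, hq, TensorProduct.add_tmul, TensorProduct.tmul_add]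
    | tmul b c => simp [leg123, leg12]

/-- The action of `A` on `U ⊗ V` through a comultiplication. -/
abbrev comulAction (Δ : A →ₐ[ℂ] A ⊗[ℂ] A) (ρ : A →ₐ[ℂ] Module.End ℂ U)
    (σ : A →ₐ[ℂ] Module.End ℂ V) : A →ₐ[ℂ] Module.End ℂ (U ⊗[ℂ] V) :=
  (tensorAction ρ σ).comp Δ

/-- The action of `A` on `ℂ` through a counit. -/
abbrev counitAction (ε : A →ₐ[ℂ] ℂ) : A →ₐ[ℂ] Module.End ℂ ℂ :=
  (Algebra.ofId ℂ (Module.End ℂ ℂ)).comp ε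

lemma lid_counitAction (ε : A →ₐ[ℂ] ℂ) (ρ : A →ₐ[ℂ] Module.End ℂ U) (x : A ⊗[ℂ] A)
    (w : ℂ ⊗[ℂ] U) : TensorProduct.lid ℂ U (tensorAction (counitAction ε) ρ x w) =
      ρ (counitFst ε x) (TensorProduct.lid ℂ U w) := by
  induction x with
  | zero => simp
  | add p q hp hq => simp only [map_add, LinearMap.add_apply, hp, hq]
  | tmul p q =>
    induction w with
    | zero => simp
    | add p q hp hq => simp only [map_add, hp, hq]
    | tmul c m => simp [counitFst, Algebra.ofId_apply, mul_smul, smul_comm c]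

lemma rid_counitAction (ε : A →ₐ[ℂ] ℂ) (ρ : A →ₐ[ℂ] Module.End ℂ U) (x : A ⊗[ℂ] A)
    (w : U ⊗[ℂ] ℂ) : TensorProduct.rid ℂ U (tensorAction ρ (counitAction ε) x w) =
      ρ (counitSnd ε x) (TensorProduct.rid ℂ U w) := by
  induction x with
  | zero => simp
  | add p q hp hq => simp only [map_add, LinearMap.add_apply, hp, hq]
  | tmul p q =>
    induction w with
    | zero => simp
    | add p q hp hq => simp only [map_add, hp, hq]
    | tmul m c => simp [counitSnd, Algebra.ofId_apply, mul_smul, smul_comm c]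

/-- The canonical map `(U ⊗ V) ⊗ W → U ⊗ (V ⊗ W)` followed by the action of `x ∈ A ⊗ A ⊗ A`. -/
def assocBy (ρ : A →ₐ[ℂ] Module.End ℂ U) (σ : A →ₐ[ℂ] Module.End ℂ V)
    (τ : A →ₐ[ℂ] Module.End ℂ W) (x : A ⊗[ℂ] (A ⊗[ℂ] A)) :
    (U ⊗[ℂ] V) ⊗[ℂ] W →ₗ[ℂ] U ⊗[ℂ] (V ⊗[ℂ] W) :=
  tensorAction ρ (tensorAction σ τ) x ∘ₗ (TensorProduct.assoc ℂ U V W).toLinearMap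

/-- The equivalence `(U ⊗ V) ⊗ W ≃ U ⊗ (V ⊗ W)` given by `u ⊗ v ⊗ w ↦ x . (u ⊗ v ⊗ w)`. -/
def assocByEquiv (ρ : A →ₐ[ℂ] Module.End ℂ U) (σ : A →ₐ[ℂ] Module.End ℂ V)
    (τ : A →ₐ[ℂ] Module.End ℂ W) (x : (A ⊗[ℂ] (A ⊗[ℂ] A))ˣ) :
    (U ⊗[ℂ] V) ⊗[ℂ] W ≃ₗ[ℂ] U ⊗[ℂ] (V ⊗[ℂ] W) :=
  let e : (U ⊗[ℂ] (V ⊗[ℂ] W)) ≃ₗ[ℂ] (U ⊗[ℂ] (V ⊗[ℂ] W)) := LinearEquiv.ofLinearMap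
    (tensorAction ρ (tensorAction σ τ) x.val) (tensorAction ρ (tensorAction σ τ) (x⁻¹).val)
    (by rw [← Module.End.mul_eq_comp, ← map_mul, Units.mul_inv, map_one]; rfl)
    (by rw [← Module.End.mul_eq_comp, ← map_mul, Units.inv_mul, map_one]; rfl)
  (TensorProduct.assoc ℂ U V W).trans e

lemma assocByEquiv_toLinearMap (ρ : A →ₐ[ℂ] Module.End ℂ U) (σ : A →ₐ[ℂ] Module.End ℂ V)
    (τ : A →ₐ[ℂ] Module.End ℂ W) (x : (A ⊗[ℂ] (A ⊗[ℂ] A))ˣ) :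
    (assocByEquiv ρ σ τ x).toLinearMap = assocBy ρ σ τ x.val := rfl

lemma assoc_comulAction (Δ : A →ₐ[ℂ] A ⊗[ℂ] A) (ρ : A →ₐ[ℂ] Module.End ℂ U)
    (σ : A →ₐ[ℂ] Module.End ℂ V) (τ : C →ₐ[ℂ] Module.End ℂ W) (x : A ⊗[ℂ] C)
    (w : (U ⊗[ℂ] V) ⊗[ℂ] W) :
    TensorProduct.assoc ℂ U V W (tensorAction (comulAction Δ ρ σ) τ x w) =
      tensorAction ρ (tensorAction σ τ) ((Algebra.TensorProduct.assoc ℂ ℂ ℂ A A C).toAlgHom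
        (Algebra.TensorProduct.map Δ (AlgHom.id ℂ C) x)) (TensorProduct.assoc ℂ U V W w) := by
  rw [comulAction, tensorAction_comp_left, assoc_tensorAction]

lemma assocBy_comm (Δ : A →ₐ[ℂ] A ⊗[ℂ] A) (ρ : A →ₐ[ℂ] Module.End ℂ U)
    (σ : A →ₐ[ℂ] Module.End ℂ V) (τ : A →ₐ[ℂ] Module.End ℂ W) (x : A ⊗[ℂ] (A ⊗[ℂ] A)) (a : A)
    (h : x * comulFst Δ (Δ a) = comulSnd Δ (Δ a) * x) (w : (U ⊗[ℂ] V) ⊗[ℂ] W) :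
    assocBy ρ σ τ x (comulAction Δ (comulAction Δ ρ σ) τ a w) =
      comulAction Δ ρ (comulAction Δ σ τ) a (assocBy ρ σ τ x w) := by
  have h2 : comulAction Δ ρ (comulAction Δ σ τ) a =
      tensorAction ρ (tensorAction σ τ) (comulSnd Δ (Δ a)) :=
    tensorAction_comp_right ρ (tensorAction σ τ) Δ (Δ a)
  have h1 : TensorProduct.assoc ℂ U V W (comulAction Δ (comulAction Δ ρ σ) τ a w) =
      tensorAction ρ (tensorAction σ τ) (comulFst Δ (Δ a)) (TensorProduct.assoc ℂ U V W w) :=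
    assoc_comulAction Δ ρ σ τ (Δ a) w
  simp only [assocBy, LinearMap.comp_apply, LinearEquiv.coe_coe]
  rw [h1, h2, ← Module.End.mul_apply, ← Module.End.mul_apply, ← map_mul, ← map_mul, h]

lemma assocBy_triangle (ε : A →ₐ[ℂ] ℂ) (ρ : A →ₐ[ℂ] Module.End ℂ U)
    (σ : A →ₐ[ℂ] Module.End ℂ V) (x : A ⊗[ℂ] (A ⊗[ℂ] A)) (h : counitMid ε x = 1)
    (w : (U ⊗[ℂ] ℂ) ⊗[ℂ] V) :
    TensorProduct.map LinearMap.id (TensorProduct.lid ℂ V).toLinearMap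
      (assocBy ρ (counitAction ε) σ x w) =
    TensorProduct.map (TensorProduct.rid ℂ U).toLinearMap LinearMap.id w := by
  have key : ∀ z, TensorProduct.map LinearMap.id (TensorProduct.lid ℂ V).toLinearMap
      (tensorAction ρ (tensorAction (counitAction ε) σ) x z) =
      tensorAction ρ σ (counitMid ε x)
        (TensorProduct.map LinearMap.id (TensorProduct.lid ℂ V).toLinearMap z) := by
    intro z
    rw [counitMid, ← tensorAction_comp_right]
    exact map_tensorAction _ _ _ _ _ _ (fun _ _ => rfl)
      (fun b v => lid_counitAction ε σ b v) x z
  simp only [assocBy, LinearMap.comp_apply, LinearEquiv.coe_coe]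
  rw [key, h, map_one, Module.End.one_apply]
  induction w with
  | zero => simp
  | add p q hp hq => simp only [map_add, hp, hq]
  | tmul y v =>
    induction y with
    | zero => simp
    | add p q hp hq => simp only [map_add, hp, hq, TensorProduct.add_tmul]
    | tmul u c => simp [TensorProduct.smul_tmul]

lemma map_assoc_tensorAction (ρ : D →ₐ[ℂ] Module.End ℂ X) (σ : A →ₐ[ℂ] Module.End ℂ U)
    (τ : B →ₐ[ℂ] Module.End ℂ V) (υ : C →ₐ[ℂ] Module.End ℂ W) (x : D ⊗[ℂ] ((A ⊗[ℂ] B) ⊗[ℂ] C))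
    (w : X ⊗[ℂ] ((U ⊗[ℂ] V) ⊗[ℂ] W)) :
    TensorProduct.map LinearMap.id (TensorProduct.assoc ℂ U V W).toLinearMap
      (tensorAction ρ (tensorAction (tensorAction σ τ) υ) x w) =
    tensorAction ρ (tensorAction σ (tensorAction τ υ))
      (Algebra.TensorProduct.map (AlgHom.id ℂ D)
        (Algebra.TensorProduct.assoc ℂ ℂ ℂ A B C).toAlgHom x)
      (TensorProduct.map LinearMap.id (TensorProduct.assoc ℂ U V W).toLinearMap w) := by
  rw [← tensorAction_comp_right]
  exact map_tensorAction _ _ _ _ _ _ (fun _ _ => rfl)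
    (fun b v => assoc_tensorAction σ τ υ b v) x w

lemma assocBy_pentagon (Δ : A →ₐ[ℂ] A ⊗[ℂ] A) (ρ : A →ₐ[ℂ] Module.End ℂ U)
    (σ : A →ₐ[ℂ] Module.End ℂ V) (τ : A →ₐ[ℂ] Module.End ℂ W) (υ : A →ₐ[ℂ] Module.End ℂ X)
    (x : A ⊗[ℂ] (A ⊗[ℂ] A)) (h : leg234 x * comul2 Δ x * leg123 x = comul3 Δ x * comul1 Δ x)
    (w : ((U ⊗[ℂ] V) ⊗[ℂ] W) ⊗[ℂ] X) :
    TensorProduct.map LinearMap.id (assocBy σ τ υ x)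
      (assocBy ρ (comulAction Δ σ τ) υ x
        (TensorProduct.map (assocBy ρ σ τ x) LinearMap.id w)) =
    assocBy ρ σ (comulAction Δ τ υ) x (assocBy (comulAction Δ ρ σ) τ υ x w) := by
  set T := tensorAction ρ (tensorAction σ (tensorAction τ υ)) with hT
  set a := TensorProduct.map (LinearMap.id : U →ₗ[ℂ] U) (TensorProduct.assoc ℂ V W X).toLinearMap
    with ha
  set b := (TensorProduct.assoc ℂ U (V ⊗[ℂ] W) X).toLinearMap with hb
  -- each of the five associators acts by one leg of `x`
  have h1 : ∀ z, TensorProduct.map LinearMap.id (assocBy σ τ υ x) z = T (leg234 x) (a z) := by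
    intro z
    rw [hT, leg234, tensorAction_includeRight, ha, ← LinearMap.comp_apply,
      ← TensorProduct.map_comp]
    rfl
  have h2 : ∀ z, a (assocBy ρ (comulAction Δ σ τ) υ x z) = T (comul2 Δ x) (a (b z)) := by
    intro z
    have e : tensorAction ρ (tensorAction (comulAction Δ σ τ) υ) x =
        tensorAction ρ (tensorAction (tensorAction σ τ) υ) (Algebra.TensorProduct.map
          (AlgHom.id ℂ A) (Algebra.TensorProduct.map Δ (AlgHom.id ℂ A)) x) := by
      rw [← tensorAction_comp_right]
      congr 2
      exact AlgHom.ext fun y => tensorAction_comp_left (tensorAction σ τ) υ Δ y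
    have e2 : comul2 Δ x = Algebra.TensorProduct.map (AlgHom.id ℂ A)
        (Algebra.TensorProduct.assoc ℂ ℂ ℂ A A A).toAlgHom
        (Algebra.TensorProduct.map (AlgHom.id ℂ A)
          (Algebra.TensorProduct.map Δ (AlgHom.id ℂ A)) x) := by
      rw [← AlgHom.comp_apply, ← Algebra.TensorProduct.map_comp]
      rfl
    rw [e2, assocBy, LinearMap.comp_apply, e, ha, map_assoc_tensorAction]
  have h3 : ∀ z, a (b (TensorProduct.map (assocBy ρ σ τ x) LinearMap.id z)) =
      T (leg123 x) (a (b (TensorProduct.map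
        (TensorProduct.assoc ℂ U V W).toLinearMap LinearMap.id z))) := by
    intro z
    have e : TensorProduct.map (assocBy ρ σ τ x) (LinearMap.id : X →ₗ[ℂ] X) z =
        tensorAction (tensorAction ρ (tensorAction σ τ)) υ (x ⊗ₜ 1) (TensorProduct.map
        (TensorProduct.assoc ℂ U V W).toLinearMap LinearMap.id z) := by
      rw [tensorAction_tmul_one, ← LinearMap.comp_apply, ← TensorProduct.map_comp]
      rfl
    rw [e, leg123_assoc, ha, hb, LinearEquiv.coe_coe, assoc_tensorAction, map_assoc_tensorAction]
  have h4 : ∀ z, assocBy ρ σ (comulAction Δ τ υ) x z =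
      T (comul3 Δ x) (TensorProduct.assoc ℂ U V (W ⊗[ℂ] X) z) := by
    intro z
    have e : tensorAction ρ (tensorAction σ (comulAction Δ τ υ)) x = T (comul3 Δ x) := by
      rw [hT, comul3, ← tensorAction_comp_right]
      congr 2
      exact AlgHom.ext fun y => tensorAction_comp_right σ (tensorAction τ υ) Δ y
    rw [assocBy, LinearMap.comp_apply, e, LinearEquiv.coe_coe]
  have h5 : ∀ z, TensorProduct.assoc ℂ U V (W ⊗[ℂ] X) (assocBy (comulAction Δ ρ σ) τ υ x z) =
      T (comul1 Δ x) (TensorProduct.assoc ℂ U V (W ⊗[ℂ] X)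
        (TensorProduct.assoc ℂ (U ⊗[ℂ] V) W X z)) := by
    intro z
    rw [assocBy, LinearMap.comp_apply, assoc_comulAction, hT, LinearEquiv.coe_coe]
    rfl
  rw [h1, h2, h3, h4, h5, ← Module.End.mul_apply, ← Module.End.mul_apply,
    ← Module.End.mul_apply, ← map_mul, ← map_mul, ← map_mul, h]
  congr 1
  refine LinearMap.congr_fun (f := a ∘ₗ b ∘ₗ TensorProduct.map
    (TensorProduct.assoc ℂ U V W).toLinearMap LinearMap.id)
    (g := (TensorProduct.assoc ℂ U V (W ⊗[ℂ] X)).toLinearMap ∘ₗ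
      (TensorProduct.assoc ℂ (U ⊗[ℂ] V) W X).toLinearMap) ?_ w
  ext
  rfl

lemma assocBy_naturality {U' V' W' : Type} [AddCommGroup U'] [Module ℂ U'] [AddCommGroup V']
    [Module ℂ V'] [AddCommGroup W'] [Module ℂ W'] (ρ : A →ₐ[ℂ] Module.End ℂ U)
    (σ : A →ₐ[ℂ] Module.End ℂ V) (τ : A →ₐ[ℂ] Module.End ℂ W) (ρ' : A →ₐ[ℂ] Module.End ℂ U')
    (σ' : A →ₐ[ℂ] Module.End ℂ V') (τ' : A →ₐ[ℂ] Module.End ℂ W') (f : U →ₗ[ℂ] U')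
    (g : V →ₗ[ℂ] V') (k : W →ₗ[ℂ] W') (hf : ∀ a u, f (ρ a u) = ρ' a (f u))
    (hg : ∀ a v, g (σ a v) = σ' a (g v)) (hk : ∀ a w, k (τ a w) = τ' a (k w))
    (x : A ⊗[ℂ] (A ⊗[ℂ] A)) (w : (U ⊗[ℂ] V) ⊗[ℂ] W) :
    assocBy ρ' σ' τ' x (TensorProduct.map (TensorProduct.map f g) k w) =
      TensorProduct.map f (TensorProduct.map g k) (assocBy ρ σ τ x w) := by
  have e : TensorProduct.assoc ℂ U' V' W' (TensorProduct.map (TensorProduct.map f g) k w) =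
      TensorProduct.map f (TensorProduct.map g k) (TensorProduct.assoc ℂ U V W w) := by
    refine LinearMap.congr_fun (f := (TensorProduct.assoc ℂ U' V' W').toLinearMap ∘ₗ
      TensorProduct.map (TensorProduct.map f g) k) (g := TensorProduct.map f
      (TensorProduct.map g k) ∘ₗ (TensorProduct.assoc ℂ U V W).toLinearMap) ?_ w
    ext
    rfl
  simp only [assocBy, LinearMap.comp_apply, LinearEquiv.coe_coe]
  rw [e, map_tensorAction ρ (tensorAction σ τ) ρ' (tensorAction σ' τ') f (TensorProduct.map g k)
    hf (map_tensorAction σ τ σ' τ' g k hg hk)]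

end Actions

namespace QuasiBialgebra

variable {A : Type} [Ring A] [Algebra ℂ A]

/-- A finite-dimensional representation of (the underlying algebra of) the quasi-bialgebra `H`. -/
structure Rep (H : QuasiBialgebra A) where
  V : Type
  [addCommGroup : AddCommGroup V]
  [module : Module ℂ V]
  [finiteDimensional : FiniteDimensional ℂ V]
  ρ : A →ₐ[ℂ] Module.End ℂ V

namespace Rep

attribute [instance] addCommGroup module finiteDimensional

variable {H : QuasiBialgebra A}

/-- Morphisms of representations: linear maps commuting with the action. -/
@[ext]
structure Hom (M N : H.Rep) where
  hom : M.V →ₗ[ℂ] N.V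
  comm : ∀ (a : A) (v : M.V), hom (M.ρ a v) = N.ρ a (hom v)

instance : Category H.Rep where
  Hom M N := Hom M N
  id M := ⟨LinearMap.id, fun _ _ => rfl⟩
  comp f g := ⟨g.hom ∘ₗ f.hom, fun a v => by simp [f.comm, g.comm]⟩

@[ext] lemma hom_ext {M N : H.Rep} {f g : M ⟶ N} (h : f.hom = g.hom) : f = g := Hom.ext h

@[simp] lemma id_hom (M : H.Rep) : Hom.hom (𝟙 M) = LinearMap.id := rfl

@[simp] lemma comp_hom {M N P : H.Rep} (f : M ⟶ N) (g : N ⟶ P) :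
    Hom.hom (f ≫ g) = g.hom ∘ₗ f.hom := rfl

/-- An invertible intertwiner is an isomorphism. -/
def mkIso {M N : H.Rep} (e : M.V ≃ₗ[ℂ] N.V) (he : ∀ a v, e (M.ρ a v) = N.ρ a (e v)) : M ≅ N where
  hom := ⟨e.toLinearMap, he⟩
  inv := ⟨e.symm.toLinearMap, fun a v => by
    simp only [LinearEquiv.coe_coe]
    rw [LinearEquiv.symm_apply_eq, he, LinearEquiv.apply_symm_apply]⟩
  hom_inv_id := by ext; simp
  inv_hom_id := by ext; simp

@[simp] lemma mkIso_hom_hom {M N : H.Rep} (e : M.V ≃ₗ[ℂ] N.V)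
    (he : ∀ a v, e (M.ρ a v) = N.ρ a (e v)) : Hom.hom (mkIso e he).hom = e.toLinearMap := rfl

/-- The tensor product of representations; `A` acts through the comultiplication. -/
abbrev tensor (M N : H.Rep) : H.Rep where
  V := M.V ⊗[ℂ] N.V
  ρ := comulAction H.comul M.ρ N.ρ

variable (H) in
/-- The unit object `ℂ`, on which `A` acts through the counit. -/
abbrev unit : H.Rep where
  V := ℂ
  ρ := counitAction H.counit

/-- The tensor product of morphisms. -/
def tensorMap {M N M' N' : H.Rep} (f : M ⟶ N) (g : M' ⟶ N') : tensor M M' ⟶ tensor N N' :=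
  ⟨TensorProduct.map f.hom g.hom, fun a v =>
    map_tensorAction M.ρ M'.ρ N.ρ N'.ρ f.hom g.hom f.comm g.comm (H.comul a) v⟩

lemma inv_intertwines (a : A) : (H.Φ⁻¹).val * comulFst H.comul (H.comul a) =
    comulSnd H.comul (H.comul a) * (H.Φ⁻¹).val := by
  rw [H.quasi_coassoc, mul_assoc, Units.inv_mul_cancel_left]

/-- The associator: its inverse `U ⊗ (V ⊗ W) → (U ⊗ V) ⊗ W` is
`u ⊗ (v ⊗ w) ↦ Φ . (u ⊗ v ⊗ w)`, so that `(U ⊗ V) ⊗ W → U ⊗ (V ⊗ W)` acts by `Φ⁻¹`. -/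
def associator (U V W : H.Rep) : tensor (tensor U V) W ≅ tensor U (tensor V W) :=
  mkIso (assocByEquiv U.ρ V.ρ W.ρ H.Φ⁻¹)
    (fun a w => assocBy_comm H.comul U.ρ V.ρ W.ρ (H.Φ⁻¹).val a (inv_intertwines a) w)

/-- The left unit isomorphism is that of vector spaces. -/
def leftUnitor (M : H.Rep) : tensor (unit H) M ≅ M :=
  mkIso (TensorProduct.lid ℂ M.V) (fun a w =>
    (lid_counitAction H.counit M.ρ (H.comul a) w).trans (by rw [H.counit_fst]))

/-- The right unit isomorphism is that of vector spaces. -/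
def rightUnitor (M : H.Rep) : tensor M (unit H) ≅ M :=
  mkIso (TensorProduct.rid ℂ M.V) (fun a w =>
    (rid_counitAction H.counit M.ρ (H.comul a) w).trans (by rw [H.counit_snd]))

instance : MonoidalCategoryStruct H.Rep where
  tensorObj := tensor
  tensorHom f g := tensorMap f g
  whiskerLeft M _ _ f := tensorMap (𝟙 M) f
  whiskerRight f M := tensorMap f (𝟙 M)
  tensorUnit := unit H
  associator := associator
  leftUnitor := leftUnitor
  rightUnitor := rightUnitor

lemma inv_counital : counitMid H.counit (H.Φ⁻¹).val = 1 := by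
  have h := congrArg (counitMid H.counit) H.Φ.mul_inv
  rwa [map_mul, H.counital, one_mul, map_one] at h

lemma inv_cocycle : leg234 (H.Φ⁻¹).val * comul2 H.comul (H.Φ⁻¹).val * leg123 (H.Φ⁻¹).val =
    comul3 H.comul (H.Φ⁻¹).val * comul1 H.comul (H.Φ⁻¹).val := by
  have h : Units.map (comul1 H.comul : _ →* _) H.Φ * Units.map (comul3 H.comul : _ →* _) H.Φ =
      Units.map (leg123 : _ →ₐ[ℂ] _).toMonoidHom H.Φ * Units.map (comul2 H.comul : _ →* _) H.Φ *
        Units.map (leg234 : _ →ₐ[ℂ] _).toMonoidHom H.Φ := Units.ext H.cocycle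
  have h2 := congrArg (fun u => (u⁻¹).val) h
  simp only [mul_inv_rev, Units.val_mul, ← map_inv, Units.coe_map, ← mul_assoc] at h2
  exact h2.symm

instance : MonoidalCategory H.Rep := MonoidalCategory.ofTensorHom
  (id_tensorHom_id := fun M N => hom_ext TensorProduct.map_id)
  (id_tensorHom := fun _ _ _ _ => rfl)
  (tensorHom_id := fun _ _ => rfl)
  (tensorHom_comp_tensorHom := fun f g f' g' =>
    hom_ext (TensorProduct.map_comp f'.hom g'.hom f.hom g.hom).symm)
  (associator_naturality := fun {U V W U' V' W'} f g h => hom_ext <| LinearMap.ext fun w => by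
    change assocBy U'.ρ V'.ρ W'.ρ (H.Φ⁻¹).val
        (TensorProduct.map (TensorProduct.map f.hom g.hom) h.hom w) =
      TensorProduct.map f.hom (TensorProduct.map g.hom h.hom) (assocBy U.ρ V.ρ W.ρ (H.Φ⁻¹).val w)
    exact assocBy_naturality _ _ _ _ _ _ f.hom g.hom h.hom f.comm g.comm h.comm _ w)
  (leftUnitor_naturality := fun f => hom_ext <| by
    apply TensorProduct.ext'
    intro c m
    change TensorProduct.lid ℂ _ (c ⊗ₜ f.hom m) = f.hom (TensorProduct.lid ℂ _ (c ⊗ₜ m))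
    simp)
  (rightUnitor_naturality := fun f => hom_ext <| by
    apply TensorProduct.ext'
    intro m c
    change TensorProduct.rid ℂ _ (f.hom m ⊗ₜ c) = f.hom (TensorProduct.rid ℂ _ (m ⊗ₜ c))
    simp)
  (pentagon := fun U V W X => hom_ext <| LinearMap.ext fun w =>
    assocBy_pentagon H.comul U.ρ V.ρ W.ρ X.ρ (H.Φ⁻¹).val inv_cocycle w)
  (triangle := fun U V => hom_ext <| LinearMap.ext fun w =>
    assocBy_triangle H.counit U.ρ V.ρ (H.Φ⁻¹).val inv_counital w)

end Rep

/-- The functor `Rep(A, Φ) ⥤ Rep(A, Φ')` which is the identity on underlying representations and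
morphisms, for two quasi-bialgebra structures on the same algebra. -/
def idFunctor (H K : QuasiBialgebra A) : H.Rep ⥤ K.Rep where
  obj M := ⟨M.V, M.ρ⟩
  map f := ⟨f.hom, f.comm⟩

/-- `Rep H` and `Rep K` are equivalent as monoidal categories. -/
def MonoidallyEquivalent {B : Type} [Ring B] [Algebra ℂ B] (H : QuasiBialgebra A)
    (K : QuasiBialgebra B) : Prop :=
  ∃ F : H.Rep ⥤ K.Rep, F.IsEquivalence ∧ Nonempty F.Monoidal

end QuasiBialgebra

/-! ### The restricted quantum group of `sl(2)` at `q = i` -/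

/-- The generators `E`, `F`, `K`. -/
inductive Gen : Type
  | E
  | F
  | K

open FreeAlgebra in
/-- The defining relations, with `K⁻¹ = K³`:
`K E = - E K`, `K F = - F K`, `[E, F] = (K - K⁻¹) / (i - i⁻¹)`, `E² = F² = 0`, `K⁴ = 1`. -/
inductive Rel : FreeAlgebra ℂ Gen → FreeAlgebra ℂ Gen → Prop
  | KE : Rel (ι ℂ Gen.K * ι ℂ Gen.E) (-(ι ℂ Gen.E * ι ℂ Gen.K))
  | KF : Rel (ι ℂ Gen.K * ι ℂ Gen.F) (-(ι ℂ Gen.F * ι ℂ Gen.K))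
  | EF : Rel (ι ℂ Gen.E * ι ℂ Gen.F - ι ℂ Gen.F * ι ℂ Gen.E)
      ((Complex.I - Complex.I⁻¹)⁻¹ • (ι ℂ Gen.K - ι ℂ Gen.K ^ 3))
  | EE : Rel (ι ℂ Gen.E ^ 2) 0
  | FF : Rel (ι ℂ Gen.F ^ 2) 0
  | KK : Rel (ι ℂ Gen.K ^ 4) 1

/-- The restricted quantum group `Q` of `sl(2)` at `q = i`, as an algebra. -/
def Q : Type := RingQuot Rel

namespace Q

instance : Ring Q := inferInstanceAs (Ring (RingQuot Rel))

instance : Algebra ℂ Q := inferInstanceAs (Algebra ℂ (RingQuot Rel))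

/-- The quotient map from the free algebra. -/
def proj : FreeAlgebra ℂ Gen →ₐ[ℂ] Q := RingQuot.mkAlgHom ℂ Rel

/-- The generator `E`. -/
def E : Q := proj (FreeAlgebra.ι ℂ Gen.E)

/-- The generator `F`. -/
def F : Q := proj (FreeAlgebra.ι ℂ Gen.F)

/-- The generator `K`. -/
def K : Q := proj (FreeAlgebra.ι ℂ Gen.K)

lemma KE : K * E = -(E * K) := by
  simpa [K, E] using (show proj _ = proj _ from RingQuot.mkAlgHom_rel ℂ Rel.KE)

lemma KF : K * F = -(F * K) := by
  simpa [K, F] using (show proj _ = proj _ from RingQuot.mkAlgHom_rel ℂ Rel.KF)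

lemma EF : E * F - F * E = (Complex.I - Complex.I⁻¹)⁻¹ • (K - K ^ 3) := by
  have h : proj _ = proj _ := RingQuot.mkAlgHom_rel ℂ Rel.EF
  rw [map_sub, map_mul, map_mul, map_smul, map_sub, map_pow] at h
  exact h

lemma EE : E ^ 2 = 0 := by
  simpa [E] using (show proj _ = proj _ from RingQuot.mkAlgHom_rel ℂ Rel.EE)

lemma FF : F ^ 2 = 0 := by
  simpa [F] using (show proj _ = proj _ from RingQuot.mkAlgHom_rel ℂ Rel.FF)

lemma KK : K ^ 4 = 1 := by
  simpa [K] using (show proj _ = proj _ from RingQuot.mkAlgHom_rel ℂ Rel.KK)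

section Lift

variable {B : Type} [Ring B] [Algebra ℂ B]

/-- Algebra homomorphisms out of `Q` are given by the images of the generators. -/
def lift (e f k : B) (hKE : k * e = -(e * k)) (hKF : k * f = -(f * k))
    (hEF : e * f - f * e = (Complex.I - Complex.I⁻¹)⁻¹ • (k - k ^ 3))
    (hE : e ^ 2 = 0) (hF : f ^ 2 = 0) (hK : k ^ 4 = 1) : Q →ₐ[ℂ] B :=
  RingQuot.liftAlgHom ℂ ⟨FreeAlgebra.lift ℂ (fun g => match g with
    | Gen.E => e
    | Gen.F => f
    | Gen.K => k), by
      intro x y h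
      cases h <;> simp_all⟩

variable {e f k : B} {hKE : k * e = -(e * k)} {hKF : k * f = -(f * k)}
    {hEF : e * f - f * e = (Complex.I - Complex.I⁻¹)⁻¹ • (k - k ^ 3)}
    {hE : e ^ 2 = 0} {hF : f ^ 2 = 0} {hK : k ^ 4 = 1}

@[simp] lemma lift_E : lift e f k hKE hKF hEF hE hF hK E = e :=
  (RingQuot.liftAlgHom_mkAlgHom_apply ℂ _ _ _).trans (by simp)

@[simp] lemma lift_F : lift e f k hKE hKF hEF hE hF hK F = f :=
  (RingQuot.liftAlgHom_mkAlgHom_apply ℂ _ _ _).trans (by simp)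

@[simp] lemma lift_K : lift e f k hKE hKF hEF hE hF hK K = k :=
  (RingQuot.liftAlgHom_mkAlgHom_apply ℂ _ _ _).trans (by simp)

lemma algHom_ext {g h : Q →ₐ[ℂ] B} (hE : g E = h E) (hF : g F = h F) (hK : g K = h K) :
    g = h := by
  refine RingQuot.ringQuot_ext' ℂ g h (FreeAlgebra.hom_ext (funext fun x => ?_))
  cases x
  · exact hE
  · exact hF
  · exact hK

end Lift

/-- A property stable under the algebra operations holds everywhere once it holds for the
generators. -/
lemma induction {P : Q → Prop} (hE : P E) (hF : P F) (hK : P K)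
    (halg : ∀ c : ℂ, P (algebraMap ℂ Q c)) (hadd : ∀ a b, P a → P b → P (a + b))
    (hmul : ∀ a b, P a → P b → P (a * b)) (a : Q) : P a := by
  obtain ⟨x, rfl⟩ := RingQuot.mkAlgHom_surjective ℂ Rel a
  induction x using FreeAlgebra.induction with
  | grade0 c => exact (AlgHom.commutes proj c) ▸ halg c
  | grade1 g =>
    cases g
    · exact hE
    · exact hF
    · exact hK
  | mul a b ha hb => exact (map_mul proj a b) ▸ hmul _ _ ha hb
  | add a b ha hb => exact (map_add proj a b) ▸ hadd _ _ ha hb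

lemma K3E : K ^ 3 * E = -(E * K ^ 3) := by
  simp only [pow_succ, pow_zero, one_mul, mul_assoc, KE, mul_neg]
  simp only [← mul_assoc, KE, mul_neg, neg_mul, neg_neg]

lemma K3F : K ^ 3 * F = -(F * K ^ 3) := by
  simp only [pow_succ, pow_zero, one_mul, mul_assoc, KF, mul_neg]
  simp only [← mul_assoc, KF, mul_neg, neg_mul, neg_neg]

lemma K_mul_K3 : K * K ^ 3 = 1 := by rw [← pow_succ', KK]

lemma K3_mul_K : K ^ 3 * K = 1 := by rw [← pow_succ, KK]

open Algebra.TensorProduct in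
/-- The comultiplication: `Δ(E) = 1 ⊗ E + E ⊗ K`, `Δ(F) = K⁻¹ ⊗ F + F ⊗ 1`, `Δ(K) = K ⊗ K`. -/
def comul : Q →ₐ[ℂ] Q ⊗[ℂ] Q :=
  lift (1 ⊗ₜ E + E ⊗ₜ K) ((K ^ 3) ⊗ₜ F + F ⊗ₜ 1) (K ⊗ₜ K)
    (by simp only [mul_add, add_mul, tmul_mul_tmul, mul_one, one_mul, KE, neg_add,
          TensorProduct.tmul_neg, TensorProduct.neg_tmul])
    (by simp only [mul_add, add_mul, tmul_mul_tmul, mul_one, one_mul, KF, neg_add,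
          TensorProduct.tmul_neg, TensorProduct.neg_tmul, ← pow_succ, ← pow_succ'])
    (by
      have e1 : E * F = F * E + (Complex.I - Complex.I⁻¹)⁻¹ • (K - K ^ 3) := by
        rw [← EF]; abel
      simp only [mul_add, add_mul, tmul_mul_tmul, mul_one, one_mul, K3E, KF, e1,
        TensorProduct.tmul_neg, TensorProduct.neg_tmul, TensorProduct.tmul_add,
        TensorProduct.add_tmul, TensorProduct.tmul_smul, TensorProduct.smul_tmul',
        TensorProduct.tmul_sub, TensorProduct.sub_tmul, smul_sub, tmul_pow]
      abel)
    (by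
      simp only [pow_two, mul_add, add_mul, tmul_mul_tmul, mul_one, one_mul, KE,
        TensorProduct.tmul_neg]
      simp only [← pow_two, EE, TensorProduct.tmul_zero, TensorProduct.zero_tmul]
      abel)
    (by
      simp only [pow_two, mul_add, add_mul, tmul_mul_tmul, mul_one, one_mul, K3F,
        TensorProduct.neg_tmul]
      simp only [← pow_two, FF, TensorProduct.tmul_zero, TensorProduct.zero_tmul]
      abel)
    (by rw [tmul_pow, KK, one_def])

/-- The counit: `ε(E) = ε(F) = 0`, `ε(K) = 1`. -/
def counit : Q →ₐ[ℂ] ℂ :=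
  lift 0 0 1 (by simp) (by simp) (by simp) (by simp) (by simp) (by simp)

open MulOpposite in
/-- The antipode as an algebra homomorphism to the opposite algebra:
`S(E) = - E K⁻¹`, `S(F) = - K F`, `S(K) = K⁻¹`. -/
def antipodeHom : Q →ₐ[ℂ] Qᵐᵒᵖ :=
  lift (op (-(E * K ^ 3))) (op (-(K * F))) (op (K ^ 3))
    (by
      rw [← MulOpposite.op_mul, ← MulOpposite.op_mul, ← MulOpposite.op_neg]
      congr 1
      rw [mul_neg, ← mul_assoc, K3E, neg_mul, neg_neg])
    (by
      rw [← MulOpposite.op_mul, ← MulOpposite.op_mul, ← MulOpposite.op_neg]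
      congr 1
      rw [mul_neg, ← mul_assoc (K ^ 3), K3_mul_K, one_mul, neg_neg, neg_mul, mul_assoc,
        ← neg_eq_iff_eq_neg.2 K3F, mul_neg, ← mul_assoc, K_mul_K3, neg_neg, one_mul])
    (by
      rw [← MulOpposite.op_mul, ← MulOpposite.op_mul, ← MulOpposite.op_sub, ← MulOpposite.op_pow, ← MulOpposite.op_sub, ← MulOpposite.op_smul]
      congr 1
      have h1 : -(K * F) * -(E * K ^ 3) = F * E := by
        rw [neg_mul_neg, mul_assoc, ← mul_assoc F, mul_assoc, ← neg_eq_iff_eq_neg.2 K3E]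
        rw [mul_neg, mul_neg, ← mul_assoc F, ← neg_eq_iff_eq_neg.2 K3F, neg_mul, mul_neg, neg_neg,
          ← mul_assoc, ← mul_assoc, K_mul_K3, one_mul]
      have h2 : -(E * K ^ 3) * -(K * F) = E * F := by
        rw [neg_mul_neg, mul_assoc, ← mul_assoc (K ^ 3), K3_mul_K, one_mul]
      have h3 : (K ^ 3) ^ 3 = K := by
        rw [← pow_mul, show 3 * 3 = 4 + 4 + 1 from rfl, pow_add, pow_add, KK]
        simp
      rw [h1, h2, h3, ← neg_sub (E * F), EF, ← smul_neg, neg_sub])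
    (by
      rw [← MulOpposite.op_pow, neg_sq, pow_two, mul_assoc, ← mul_assoc (K ^ 3), K3E, neg_mul, mul_neg,
        ← mul_assoc, ← mul_assoc, ← pow_two, EE]
      simp)
    (by
      rw [← MulOpposite.op_pow, neg_sq, pow_two, KF, neg_mul_neg, mul_assoc, ← mul_assoc K, KF, neg_mul,
        mul_neg, ← mul_assoc, ← mul_assoc, ← pow_two, FF]
      simp)
    (by rw [← MulOpposite.op_pow, ← pow_mul, mul_comm 3 4, pow_mul, KK, one_pow, MulOpposite.op_one])

@[simp] lemma comul_E : comul E = 1 ⊗ₜ E + E ⊗ₜ K := lift_E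
@[simp] lemma comul_F : comul F = (K ^ 3) ⊗ₜ F + F ⊗ₜ 1 := lift_F
@[simp] lemma comul_K : comul K = K ⊗ₜ K := lift_K
@[simp] lemma counit_E : counit E = 0 := lift_E
@[simp] lemma counit_F : counit F = 0 := lift_F
@[simp] lemma counit_K : counit K = 1 := lift_K

instance : Bialgebra ℂ Q := Bialgebra.ofAlgHom comul counit
  (by
    apply algHom_ext
    · simp [TensorProduct.tmul_add, TensorProduct.add_tmul, Algebra.TensorProduct.one_def]
      try abel
    · simp [TensorProduct.tmul_add, TensorProduct.add_tmul, Algebra.TensorProduct.one_def]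
      try abel
    · simp)
  (by apply algHom_ext <;> simp)
  (by apply algHom_ext <;> simp)

/-- The antipode as a linear map. -/
def antipodeMap : Q →ₗ[ℂ] Q :=
  (MulOpposite.opLinearEquiv ℂ).symm.toLinearMap ∘ₗ antipodeHom.toLinearMap

lemma antipodeMap_mul (a b : Q) : antipodeMap (a * b) = antipodeMap b * antipodeMap a := by
  simp [antipodeMap]

@[simp] lemma antipodeMap_E : antipodeMap E = -(E * K ^ 3) := by simp [antipodeMap, antipodeHom]
@[simp] lemma antipodeMap_F : antipodeMap F = -(K * F) := by simp [antipodeMap, antipodeHom]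
@[simp] lemma antipodeMap_K : antipodeMap K = K ^ 3 := by simp [antipodeMap, antipodeHom]
@[simp] lemma antipodeMap_one : antipodeMap 1 = 1 := by simp [antipodeMap]
@[simp] lemma antipodeMap_K3 : antipodeMap (K ^ 3) = K := by
  have h : antipodeMap (K ^ 3) * K ^ 3 = 1 := by
    have := antipodeMap_mul K (K ^ 3)
    rw [K_mul_K3, antipodeMap_one, antipodeMap_K] at this
    exact this.symm
  calc antipodeMap (K ^ 3) = antipodeMap (K ^ 3) * (K ^ 3 * K) := by rw [K3_mul_K, mul_one]
    _ = K := by rw [← mul_assoc, h, one_mul]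

lemma antipode_left (a : Q) (t : Q ⊗[ℂ] Q) :
    LinearMap.mul' ℂ Q (antipodeMap.rTensor Q (comul a * t)) =
      counit a • LinearMap.mul' ℂ Q (antipodeMap.rTensor Q t) := by
  induction a using induction generalizing t with
  | hE =>
    induction t with
    | zero => simp
    | add p q hp hq => simp only [mul_add, map_add, smul_add, hp, hq]
    | tmul x y =>
      simp only [comul_E, add_mul, Algebra.TensorProduct.tmul_mul_tmul, map_add,
        LinearMap.rTensor_tmul, LinearMap.mul'_apply, one_mul, antipodeMap_mul, antipodeMap_E,
        counit_E, zero_smul]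
      have : -(E * K ^ 3) * (K * y) = -(E * y) := by
        rw [neg_mul, mul_assoc, ← mul_assoc (K ^ 3), K3_mul_K, one_mul]
      rw [mul_assoc, this, mul_neg, add_neg_cancel]
  | hF =>
    induction t with
    | zero => simp
    | add p q hp hq => simp only [mul_add, map_add, smul_add, hp, hq]
    | tmul x y =>
      simp only [comul_F, add_mul, Algebra.TensorProduct.tmul_mul_tmul, map_add,
        LinearMap.rTensor_tmul, LinearMap.mul'_apply, one_mul, antipodeMap_mul, antipodeMap_F,
        antipodeMap_K3, counit_F, zero_smul]
      simp only [mul_assoc, mul_neg, neg_mul, add_neg_cancel]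
  | hK =>
    induction t with
    | zero => simp
    | add p q hp hq => simp only [mul_add, map_add, smul_add, hp, hq]
    | tmul x y =>
      simp only [comul_K, Algebra.TensorProduct.tmul_mul_tmul,
        LinearMap.rTensor_tmul, LinearMap.mul'_apply, antipodeMap_mul, antipodeMap_K,
        counit_K, one_smul]
      rw [mul_assoc, ← mul_assoc (K ^ 3), K3_mul_K, one_mul]
  | halg c => simp [Algebra.algebraMap_eq_smul_one]
  | hadd a b ha hb => simp only [map_add, add_mul, ha, hb, add_smul]
  | hmul a b ha hb => rw [map_mul comul, mul_assoc, ha, hb, map_mul counit, mul_smul]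

lemma antipode_right (a : Q) (t : Q ⊗[ℂ] Q) :
    LinearMap.mul' ℂ Q (antipodeMap.lTensor Q (t * comul a)) =
      counit a • LinearMap.mul' ℂ Q (antipodeMap.lTensor Q t) := by
  induction a using induction generalizing t with
  | hE =>
    induction t with
    | zero => simp
    | add p q hp hq => simp only [add_mul, map_add, smul_add, hp, hq]
    | tmul x y =>
      simp only [comul_E, mul_add, Algebra.TensorProduct.tmul_mul_tmul, map_add,
        LinearMap.lTensor_tmul, LinearMap.mul'_apply, mul_one, antipodeMap_mul, antipodeMap_E,
        antipodeMap_K, counit_E, zero_smul]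
      simp only [mul_assoc, mul_neg, neg_mul, neg_add_cancel]
  | hF =>
    induction t with
    | zero => simp
    | add p q hp hq => simp only [add_mul, map_add, smul_add, hp, hq]
    | tmul x y =>
      simp only [comul_F, mul_add, Algebra.TensorProduct.tmul_mul_tmul, map_add,
        LinearMap.lTensor_tmul, LinearMap.mul'_apply, mul_one, antipodeMap_mul, antipodeMap_F,
        counit_F, zero_smul]
      have : K ^ 3 * (-(K * F) * antipodeMap y) = -(F * antipodeMap y) := by
        rw [neg_mul, mul_neg, mul_assoc, ← mul_assoc (K ^ 3), K3_mul_K, one_mul]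
      rw [mul_assoc, this, mul_neg, ← mul_assoc, neg_add_cancel]
  | hK =>
    induction t with
    | zero => simp
    | add p q hp hq => simp only [add_mul, map_add, smul_add, hp, hq]
    | tmul x y =>
      simp only [comul_K, Algebra.TensorProduct.tmul_mul_tmul,
        LinearMap.lTensor_tmul, LinearMap.mul'_apply, antipodeMap_mul, antipodeMap_K,
        counit_K, one_smul]
      rw [mul_assoc, ← mul_assoc K, K_mul_K3, one_mul]
  | halg c => simp [Algebra.algebraMap_eq_smul_one]
  | hadd a b ha hb => simp only [map_add, mul_add, ha, hb, add_smul]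
  | hmul a b ha hb => rw [map_mul comul, ← mul_assoc, hb, ha, map_mul counit, mul_comm, mul_smul]

/-- The Hopf algebra structure of `Q`. -/
instance : HopfAlgebra ℂ Q where
  antipode := antipodeMap
  mul_antipode_rTensor_comul := by
    ext a
    have h := antipode_left a 1
    rw [mul_one] at h
    refine h.trans ?_
    simp [Algebra.TensorProduct.one_def, Algebra.algebraMap_eq_smul_one]
    rfl
  mul_antipode_lTensor_comul := by
    ext a
    have h := antipode_right a 1
    rw [one_mul] at h
    refine h.trans ?_
    simp [Algebra.TensorProduct.one_def, Algebra.algebraMap_eq_smul_one]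
    rfl

/-- The central idempotent `e₀ = (1 + K²) / 2`. -/
def e0 : Q := (1 / 2 : ℂ) • (1 + K ^ 2)

/-- The central idempotent `e₁ = (1 - K²) / 2`. -/
def e1 : Q := (1 / 2 : ℂ) • (1 - K ^ 2)

section Coassociator

open Complex (I)

/-- The component `Φ⁰¹⁰`. -/
def Φ010 : Q ⊗[ℂ] (Q ⊗[ℂ] Q) :=
  1 ⊗ₜ (1 ⊗ₜ 1) - (1 + I) • E ⊗ₜ (K ⊗ₜ F) + (1 - I) • (F * K) ⊗ₜ (K ⊗ₜ (E * K))
    + (2 : ℂ) • (E * F * K) ⊗ₜ (1 ⊗ₜ (E * F * K))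

/-- The component `Φ¹⁰¹`. -/
def Φ101 : Q ⊗[ℂ] (Q ⊗[ℂ] Q) :=
  (I - 1) • 1 ⊗ₜ (F ⊗ₜ (E * K)) + 1 ⊗ₜ (K ⊗ₜ 1) + (2 : ℂ) • 1 ⊗ₜ ((E * F) ⊗ₜ (E * F * K))
    - (1 + I) • 1 ⊗ₜ ((E * K) ⊗ₜ F) - (1 + I) • E ⊗ₜ ((F * K) ⊗ₜ 1)
    + (2 * I) • E ⊗ₜ ((E * F * K) ⊗ₜ F) + (1 - I) • (F * K) ⊗ₜ (E ⊗ₜ 1)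
    - (2 * I) • (F * K) ⊗ₜ ((E * F * K) ⊗ₜ (E * K)) - (2 : ℂ) • (E * F * K) ⊗ₜ ((E * F) ⊗ₜ 1)

/-- The component `Φ¹¹¹`, which depends on `β`. -/
def Φ111 (β : ℂ) : Q ⊗[ℂ] (Q ⊗[ℂ] Q) :=
  (I * β ^ 2) • ((1 + I) • 1 ⊗ₜ (F ⊗ₜ (E * K)) - 1 ⊗ₜ (K ⊗ₜ 1)
    - (2 : ℂ) • 1 ⊗ₜ ((E * F) ⊗ₜ 1) - (2 * I) • 1 ⊗ₜ ((E * F) ⊗ₜ (E * F * K))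
    + (1 + I) • 1 ⊗ₜ ((E * K) ⊗ₜ F) - (1 + I) • E ⊗ₜ (1 ⊗ₜ F)
    + (1 + I) • E ⊗ₜ ((F * K) ⊗ₜ 1) + (2 * I) • E ⊗ₜ ((F * K) ⊗ₜ (E * F * K))
    + (2 : ℂ) • E ⊗ₜ ((E * F * K) ⊗ₜ F) - (1 + I) • (F * K) ⊗ₜ (1 ⊗ₜ (E * K))
    + (1 + I) • (F * K) ⊗ₜ (E ⊗ₜ 1) + (2 * I) • (F * K) ⊗ₜ (E ⊗ₜ (E * F * K))
    + (2 : ℂ) • (F * K) ⊗ₜ ((E * F * K) ⊗ₜ (E * K)) + (2 * I) • (E * F * K) ⊗ₜ (F ⊗ₜ (E * K))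
    + (2 * I) • (E * F * K) ⊗ₜ (K ⊗ₜ (E * F * K)) - (2 * I) • (E * F * K) ⊗ₜ ((E * F) ⊗ₜ 1)
    + (2 * I) • (E * F * K) ⊗ₜ ((E * K) ⊗ₜ F) + (4 : ℂ) • (E * F * K) ⊗ₜ ((E * F) ⊗ₜ (E * F * K)))

/-- The coassociator `Φ ∈ Q ⊗ Q ⊗ Q`, depending on a parameter `β` (with `β⁴ = -1`). -/
def Φ (β : ℂ) : Q ⊗[ℂ] (Q ⊗[ℂ] Q) :=
  e0 ⊗ₜ (e0 ⊗ₜ e0)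
    + e1 ⊗ₜ (e0 ⊗ₜ e0) + Φ010 * e0 ⊗ₜ (e1 ⊗ₜ e0) + e0 ⊗ₜ (e0 ⊗ₜ e1)
    + e1 ⊗ₜ (e1 ⊗ₜ e0) + Φ101 * e1 ⊗ₜ (e0 ⊗ₜ e1) + e0 ⊗ₜ (e1 ⊗ₜ e1)
    + Φ111 β * e1 ⊗ₜ (e1 ⊗ₜ e1)

end Coassociator

end Q

end QHopf

end

/-!
The symplectic fermions provide a simple coassociator on `Q`, which differs from `1` only where the
last two factors are cut down by `e1`, for a coproduct other than the given one. A twist relates the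
two coproducts and turns this simple coassociator into `Φ β`. The cocycle identity is inherited, so
all that has to be computed is that `Φ β` is the twisted coassociator, sector by sector.

A cohomology relation, a twist equivalence and a monoidal structure on the identity functor each
give a monoidal equivalence, so everything else follows from the last claim. There the two
categories are told apart by crossings: objects `M ⟶ 𝟙` and `T` for which `M ⊗ T ⟶ T` and
`T ⊗ M ⟶ T` have unique sections. One asks whether adding `M` on both sides of `T` depends on the
order, up to the associator, which is a question invariant under monoidal equivalence. In
`Rep(Q, Φ β)` the order never matters, while in `Rep Q` it does for one explicit crossing.
-/

noncomputable section

namespace QHopf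

/-! ### Twists of quasi-bialgebras -/

section Legs

variable {A : Type} [Ring A] [Algebra ℂ A]

lemma leg12_tmul (a b : A) : leg12 (a ⊗ₜ[ℂ] b) = a ⊗ₜ (b ⊗ₜ 1) := rfl

lemma leg23_apply (x : A ⊗[ℂ] A) : leg23 x = 1 ⊗ₜ x := rfl

lemma comulSnd_tmul (Δ : A →ₐ[ℂ] A ⊗[ℂ] A) (a b : A) :
    comulSnd Δ (a ⊗ₜ b) = a ⊗ₜ Δ b := rfl

lemma leg12_eq_assoc (x : A ⊗[ℂ] A) :
    leg12 x = Algebra.TensorProduct.assoc ℂ ℂ ℂ A A A (x ⊗ₜ 1) := by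
  induction x with
  | zero => simp
  | tmul a b => rfl
  | add x y hx hy => simp only [map_add, hx, hy, TensorProduct.add_tmul]

lemma comulFst_tmul_one (Δ : A →ₐ[ℂ] A ⊗[ℂ] A) (a : A) :
    comulFst Δ (a ⊗ₜ 1) = leg12 (Δ a) := (leg12_eq_assoc _).symm

lemma comulFst_one_tmul (Δ : A →ₐ[ℂ] A ⊗[ℂ] A) (a : A) :
    comulFst Δ (1 ⊗ₜ a) = 1 ⊗ₜ (1 ⊗ₜ a) := by
  simp [comulFst, Algebra.TensorProduct.one_def]

lemma comulFst_tmul (Δ : A →ₐ[ℂ] A ⊗[ℂ] A) (a b : A) :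
    comulFst Δ (a ⊗ₜ b) = leg12 (Δ a) * 1 ⊗ₜ (1 ⊗ₜ b) := by
  rw [← comulFst_tmul_one, ← comulFst_one_tmul Δ, ← map_mul, Algebra.TensorProduct.tmul_mul_tmul,
    mul_one, one_mul]

lemma commute_leg12 (x : A ⊗[ℂ] A) (b : A) : Commute (leg12 x) (1 ⊗ₜ (1 ⊗ₜ b)) := by
  induction x with
  | zero => simp
  | tmul a b => simp [Commute, SemiconjBy, leg12_tmul]
  | add x y hx hy => simpa only [map_add] using hx.add_left hy

lemma commute_leg123_leg234 (x y : A ⊗[ℂ] A) :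
    Commute (leg123 (leg12 x)) (leg234 (leg23 y)) := by
  induction x with
  | zero => simp
  | tmul a b => simp [Commute, SemiconjBy, leg12_tmul, leg123, leg234, leg23_apply,
      ← Algebra.TensorProduct.one_def]
  | add x y hx hy => simpa only [map_add] using hx.add_left hy

lemma leg123_tmul (a : A) (x : A ⊗[ℂ] A) : leg123 (a ⊗ₜ[ℂ] x) = a ⊗ₜ leg12 x := rfl

lemma commute_leg123 (x : A ⊗[ℂ] (A ⊗[ℂ] A)) (b : A) :
    Commute (leg123 x) (1 ⊗ₜ (1 ⊗ₜ (1 ⊗ₜ b))) := by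
  induction x with
  | zero => simp
  | tmul a x => simp [Commute, SemiconjBy, leg123_tmul, (commute_leg12 x b).eq]
  | add x y hx hy => simpa only [map_add] using hx.add_left hy

lemma leg234_apply (x : A ⊗[ℂ] (A ⊗[ℂ] A)) : leg234 x = 1 ⊗ₜ x := rfl

lemma leg123_leg23 (x : A ⊗[ℂ] A) : leg123 (leg23 x) = leg234 (leg12 x) := rfl

section Comul

variable (Δ : A →ₐ[ℂ] A ⊗[ℂ] A)

lemma comul2_tmul (a : A) (x : A ⊗[ℂ] A) : comul2 Δ (a ⊗ₜ x) = a ⊗ₜ comulFst Δ x := rfl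

lemma comul3_tmul (a : A) (x : A ⊗[ℂ] A) : comul3 Δ (a ⊗ₜ x) = a ⊗ₜ comulSnd Δ x := rfl

lemma comul3_leg23 (x : A ⊗[ℂ] A) : comul3 Δ (leg23 x) = leg234 (comulSnd Δ x) := rfl

lemma comul2_leg23 (x : A ⊗[ℂ] A) : comul2 Δ (leg23 x) = leg234 (comulFst Δ x) := rfl

lemma comul1_tmul_one (a : A) : comul1 Δ (a ⊗ₜ 1) = leg123 (leg12 (Δ a)) := by
  have h : ∀ x : A ⊗[ℂ] A, Algebra.TensorProduct.assoc ℂ ℂ ℂ A A (A ⊗[ℂ] A) (x ⊗ₜ 1) =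
      leg123 (leg12 x) := fun x => by
    induction x with
    | zero => simp
    | tmul a b => rfl
    | add x y hx hy => simp only [map_add, hx, hy, TensorProduct.add_tmul]
  exact h (Δ a)

lemma comul1_leg23 (x : A ⊗[ℂ] A) : comul1 Δ (leg23 x) = leg234 (leg23 x) := by
  simp [comul1, leg23_apply, leg234_apply, Algebra.TensorProduct.one_def]

lemma comul1_tmul (a : A) (x : A ⊗[ℂ] A) :
    comul1 Δ (a ⊗ₜ x) = leg123 (leg12 (Δ a)) * leg234 (leg23 x) := by
  rw [← comul1_tmul_one, ← comul1_leg23 Δ, ← map_mul, leg23_apply,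
    Algebra.TensorProduct.tmul_mul_tmul, mul_one, one_mul]

lemma comul1_leg12 (x : A ⊗[ℂ] A) : comul1 Δ (leg12 x) = leg123 (comulFst Δ x) := by
  induction x with
  | zero => simp
  | tmul a b => rw [leg12_tmul, comul1_tmul, comulFst_tmul, map_mul]; rfl
  | add x y hx hy => simp only [map_add, hx, hy]

lemma comul2_leg12 (x : A ⊗[ℂ] A) : comul2 Δ (leg12 x) = leg123 (comulSnd Δ x) := by
  induction x with
  | zero => simp
  | tmul a b => rw [leg12_tmul, comul2_tmul, comulSnd_tmul, leg123_tmul, comulFst_tmul_one]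
  | add x y hx hy => simp only [map_add, hx, hy]

lemma comul3_leg12 (x : A ⊗[ℂ] A) : comul3 Δ (leg12 x) = leg123 (leg12 x) := by
  induction x with
  | zero => simp
  | tmul a b => rw [leg12_tmul, comul3_tmul, comulSnd_tmul, map_one]; rfl
  | add x y hx hy => simp only [map_add, hx, hy]

lemma comul1_comulSnd (x : A ⊗[ℂ] A) :
    comul1 Δ (comulSnd Δ x) = comul3 Δ (comulFst Δ x) := by
  induction x with
  | zero => simp
  | tmul a b => rw [comulSnd_tmul, comul1_tmul, comulFst_tmul, map_mul, comul3_leg12]; rfl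
  | add x y hx hy => simp only [map_add, hx, hy]

end Comul

section Conjugation

variable {Δ Δ' : A →ₐ[ℂ] A ⊗[ℂ] A} {F : A ⊗[ℂ] A} (hΔ : ∀ a, Δ' a * F = F * Δ a)
include hΔ

lemma comulFst_mul_leg12 (x : A ⊗[ℂ] A) :
    comulFst Δ' x * leg12 F = leg12 F * comulFst Δ x := by
  induction x with
  | zero => simp
  | tmul a b =>
    rw [comulFst_tmul, comulFst_tmul, mul_assoc, ← (commute_leg12 F b).eq, ← mul_assoc, ← map_mul,
      hΔ, map_mul, mul_assoc]
  | add x y hx hy => simp only [map_add, add_mul, mul_add, hx, hy]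

lemma comulSnd_mul_leg23 (x : A ⊗[ℂ] A) :
    comulSnd Δ' x * leg23 F = leg23 F * comulSnd Δ x := by
  induction x with
  | zero => simp
  | tmul a b => simp [comulSnd_tmul, leg23_apply, hΔ]
  | add x y hx hy => simp only [map_add, add_mul, mul_add, hx, hy]

lemma comul1_mul_leg123 (x : A ⊗[ℂ] (A ⊗[ℂ] A)) :
    comul1 Δ' x * leg123 (leg12 F) = leg123 (leg12 F) * comul1 Δ x := by
  induction x with
  | zero => simp
  | tmul a b =>
    rw [comul1_tmul, comul1_tmul, mul_assoc, ← (commute_leg123_leg234 F b).eq, ← mul_assoc,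
      ← map_mul, ← map_mul, hΔ, map_mul, map_mul, mul_assoc]
  | add x y hx hy => simp only [map_add, add_mul, mul_add, hx, hy]

lemma comul2_mul_leg234 (x : A ⊗[ℂ] (A ⊗[ℂ] A)) :
    comul2 Δ' x * leg234 (leg12 F) = leg234 (leg12 F) * comul2 Δ x := by
  induction x with
  | zero => simp
  | tmul a b => simp [comul2_tmul, leg234_apply, comulFst_mul_leg12 hΔ]
  | add x y hx hy => simp only [map_add, add_mul, mul_add, hx, hy]

lemma comul3_mul_leg234 (x : A ⊗[ℂ] (A ⊗[ℂ] A)) :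
    comul3 Δ' x * leg234 (leg23 F) = leg234 (leg23 F) * comul3 Δ x := by
  induction x with
  | zero => simp
  | tmul a b => simp [comul3_tmul, leg234_apply, comulSnd_mul_leg23 hΔ]
  | add x y hx hy => simp only [map_add, add_mul, mul_add, hx, hy]

end Conjugation

section Coassociativity

variable {Δ : A →ₐ[ℂ] A ⊗[ℂ] A} {Φ : A ⊗[ℂ] (A ⊗[ℂ] A)}
  (hΦ : ∀ a, comulFst Δ (Δ a) * Φ = Φ * comulSnd Δ (Δ a))
include hΦ

lemma comul1_comulFst_mul_leg123 (x : A ⊗[ℂ] A) :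
    comul1 Δ (comulFst Δ x) * leg123 Φ = leg123 Φ * comul2 Δ (comulFst Δ x) := by
  induction x with
  | zero => simp
  | tmul a b =>
    rw [comulFst_tmul, map_mul, map_mul, comul1_leg12, comul2_leg12, ← mul_assoc (leg123 Φ),
      ← map_mul, ← hΦ, map_mul, mul_assoc, mul_assoc]
    congr 1
    simpa only [comul1_tmul, comul2_tmul, comulFst_one_tmul, leg234_apply, leg23_apply, map_one,
      one_mul] using (commute_leg123 Φ b).eq.symm
  | add x y hx hy => simp only [map_add, add_mul, mul_add, hx, hy]

lemma comul2_comulSnd_mul_leg234 (x : A ⊗[ℂ] A) :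
    comul2 Δ (comulSnd Δ x) * leg234 Φ = leg234 Φ * comul3 Δ (comulSnd Δ x) := by
  induction x with
  | zero => simp
  | tmul a b => simp [comulSnd_tmul, comul2_tmul, comul3_tmul, leg234_apply, hΦ]
  | add x y hx hy => simp only [map_add, add_mul, mul_add, hx, hy]

end Coassociativity

lemma counitMid_leg12 (ε : A →ₐ[ℂ] ℂ) (x : A ⊗[ℂ] A) :
    counitMid ε (leg12 x) = counitSnd ε x ⊗ₜ 1 := by
  induction x with
  | zero => simp
  | tmul a b => simp [leg12_tmul, counitMid, counitFst, counitSnd, TensorProduct.smul_tmul]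
  | add x y hx hy => simp only [map_add, hx, hy, TensorProduct.add_tmul]

lemma counitMid_leg23 (ε : A →ₐ[ℂ] ℂ) (x : A ⊗[ℂ] A) :
    counitMid ε (leg23 x) = 1 ⊗ₜ counitFst ε x := rfl

end Legs

namespace QuasiBialgebra

variable {A : Type} [Ring A] [Algebra ℂ A] (H : QuasiBialgebra A)

lemma counitMid_comulSnd (x : A ⊗[ℂ] A) : counitMid H.counit (comulSnd H.comul x) = x := by
  induction x with
  | zero => simp
  | tmul a b => simp [comulSnd_tmul, counitMid, H.counit_fst]
  | add x y hx hy => simp only [map_add, hx, hy]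

lemma counitMid_comulFst (x : A ⊗[ℂ] A) : counitMid H.counit (comulFst H.comul x) = x := by
  induction x with
  | zero => simp
  | tmul a b =>
    rw [comulFst_tmul, map_mul, counitMid_leg12, H.counit_snd]
    simp [counitMid, counitFst]
  | add x y hx hy => simp only [map_add, hx, hy]

lemma comulFst_comul_mul (a : A) :
    comulFst H.comul (H.comul a) * H.Φ = H.Φ * comulSnd H.comul (H.comul a) := by
  rw [H.quasi_coassoc, Units.inv_mul_cancel_right]

/-- `F` twists the quasi-bialgebra `H` into the comultiplication `Δ` and the coassociator `Φ`.
Contrary to `IsTwist`, this does not presuppose that `Δ` and `Φ` form a quasi-bialgebra, and it is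
stated without inverses. -/
structure Twists (F : A ⊗[ℂ] A) (Δ : A →ₐ[ℂ] A ⊗[ℂ] A) (Φ : A ⊗[ℂ] (A ⊗[ℂ] A)) : Prop where
  isUnit : IsUnit F
  counit_fst : counitFst H.counit F = 1
  counit_snd : counitSnd H.counit F = 1
  comul_mul : ∀ a, Δ a * F = F * H.comul a
  coassociator_mul :
    Φ * (leg23 F * comulSnd H.comul F) = leg12 F * comulFst H.comul F * H.Φ

namespace Twists

variable {H} {F : A ⊗[ℂ] A} {Δ : A →ₐ[ℂ] A ⊗[ℂ] A} {Φ : A ⊗[ℂ] (A ⊗[ℂ] A)} (h : H.Twists F Δ Φ)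
include h

lemma isUnit_coassociator : IsUnit Φ := by
  have hl : IsUnit (leg23 F * comulSnd H.comul F) := (h.isUnit.map _).mul (h.isUnit.map _)
  have hr : IsUnit (leg12 F * comulFst H.comul F * H.Φ) :=
    ((h.isUnit.map _).mul (h.isUnit.map _)).mul H.Φ.isUnit
  rw [← h.coassociator_mul] at hr
  exact (hl.mul_right_iff).1 hr

lemma comulFst_comul_mul (a : A) : comulFst Δ (Δ a) * Φ = Φ * comulSnd Δ (Δ a) := by
  have hfst : comulFst Δ (Δ a) * (leg12 F * comulFst H.comul F) =
      leg12 F * comulFst H.comul F * comulFst H.comul (H.comul a) := by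
    rw [← mul_assoc, comulFst_mul_leg12 h.comul_mul, mul_assoc, ← map_mul, h.comul_mul, map_mul,
      mul_assoc]
  have hsnd : comulSnd Δ (Δ a) * (leg23 F * comulSnd H.comul F) =
      leg23 F * comulSnd H.comul F * comulSnd H.comul (H.comul a) := by
    rw [← mul_assoc, comulSnd_mul_leg23 h.comul_mul, mul_assoc, ← map_mul, h.comul_mul, map_mul,
      mul_assoc]
  refine ((h.isUnit.map leg23).mul (h.isUnit.map (comulSnd H.comul))).mul_right_cancel ?_
  calc comulFst Δ (Δ a) * Φ * (leg23 F * comulSnd H.comul F)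
      = leg12 F * comulFst H.comul F * (comulFst H.comul (H.comul a) * H.Φ) := by
        rw [mul_assoc, h.coassociator_mul, ← mul_assoc, hfst, mul_assoc]
    _ = Φ * (leg23 F * comulSnd H.comul F) * comulSnd H.comul (H.comul a) := by
        rw [H.comulFst_comul_mul, ← mul_assoc, ← h.coassociator_mul]
    _ = Φ * comulSnd Δ (Δ a) * (leg23 F * comulSnd H.comul F) := by
        rw [mul_assoc, ← hsnd, mul_assoc]

lemma counitMid_eq_one : counitMid H.counit Φ = 1 := by
  have hmid := congrArg (counitMid H.counit) h.coassociator_mul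
  simp only [map_mul, counitMid_leg12, counitMid_leg23, H.counitMid_comulSnd,
    H.counitMid_comulFst, h.counit_fst, h.counit_snd, H.counital,
    ← Algebra.TensorProduct.one_def, one_mul, mul_one] at hmid
  exact h.isUnit.mul_eq_right.1 hmid

/-- The five bracketings of a fourfold tensor product have twisting elements of their own. This
carries the path of length two around the pentagon to the corresponding path for `H`. -/
lemma comul1_mul_comul3_mul : comul1 Δ Φ * comul3 Δ Φ *
      (leg234 (leg23 F) * comul3 H.comul (leg23 F * comulSnd H.comul F)) =
    leg123 (leg12 F) * comul1 H.comul (leg12 F * comulFst H.comul F) *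
      (comul1 H.comul H.Φ * comul3 H.comul H.Φ) := by
  have hΔ := h.comul_mul
  have hΦ := h.coassociator_mul
  set D := H.comul
  set G := leg23 F * comulSnd D F with hG
  set G' := leg12 F * comulFst D F with hG'
  have middle : leg123 (leg12 F) * comul1 D G = leg234 (leg23 F) * comul3 D G' := by
    rw [hG, hG', map_mul, map_mul, comul1_leg23, comul3_leg12, comul1_comulSnd, ← mul_assoc,
      ← mul_assoc, (commute_leg123_leg234 F F).eq]
  clear_value G G'
  calc comul1 Δ Φ * comul3 Δ Φ * (leg234 (leg23 F) * comul3 D G)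
      = comul1 Δ Φ * (leg234 (leg23 F) * (comul3 D G' * comul3 D H.Φ.val)) := by
        rw [← map_mul, ← hΦ, map_mul, ← mul_assoc (leg234 _), ← comul3_mul_leg234 hΔ Φ]
        simp only [mul_assoc]
    _ = leg123 (leg12 F) * (comul1 D Φ * comul1 D G) * comul3 D H.Φ.val := by
        rw [← mul_assoc (leg234 _), ← middle, ← mul_assoc, ← mul_assoc,
          comul1_mul_leg123 hΔ, mul_assoc (leg123 _)]
    _ = leg123 (leg12 F) * comul1 D G' * (comul1 D H.Φ.val * comul3 D H.Φ.val) := by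
        rw [← map_mul, hΦ, map_mul]
        simp only [mul_assoc]

lemma leg123_mul_comul2_mul_leg234_mul : leg123 Φ * comul2 Δ Φ * leg234 Φ *
      (leg234 (leg23 F) * comul3 H.comul (leg23 F * comulSnd H.comul F)) =
    leg123 (leg12 F) * comul1 H.comul (leg12 F * comulFst H.comul F) *
      (leg123 H.Φ.val * comul2 H.comul H.Φ * leg234 H.Φ.val) := by
  have hΔ := h.comul_mul
  have hΦ := h.coassociator_mul
  have coassoc := H.comulFst_comul_mul
  set D := H.comul
  set G := leg23 F * comulSnd D F with hG
  set G' := leg12 F * comulFst D F with hG'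
  have first : leg123 G' * comul1 D (comulFst D F) = leg123 (leg12 F) * comul1 D G' := by
    rw [hG', map_mul, map_mul, comul1_leg12, mul_assoc]
  have second : leg123 G * comul2 D (comulFst D F) = leg234 (leg12 F) * comul2 D G' := by
    rw [hG, hG', map_mul, map_mul, comul2_leg12, leg123_leg23, mul_assoc]
  have third : leg234 (leg12 F) * comul2 D G = leg234 G' * comul2 D (comulSnd D F) := by
    rw [hG, hG', map_mul, map_mul, comul2_leg23, mul_assoc]
  have fourth : leg234 (leg23 F) * comul3 D G = leg234 G * comul3 D (comulSnd D F) := by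
    rw [hG, map_mul, map_mul, comul3_leg23, mul_assoc]
  clear_value G G'
  calc leg123 Φ * comul2 Δ Φ * leg234 Φ * (leg234 (leg23 F) * comul3 D G)
      = leg123 Φ * comul2 Δ Φ * (leg234 G' * comul2 D (comulSnd D F)) * leg234 H.Φ.val := by
        rw [fourth, mul_assoc, ← mul_assoc (leg234 Φ), ← map_mul, hΦ, map_mul,
          mul_assoc (leg234 G'), ← comul2_comulSnd_mul_leg234 coassoc]
        simp only [mul_assoc]
    _ = leg123 Φ * (leg234 (leg12 F) * (comul2 D G' * comul2 D H.Φ.val)) * leg234 H.Φ.val := by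
        rw [← third, ← map_mul, ← hΦ, map_mul, ← mul_assoc (leg234 _) _ (comul2 D G),
          ← comul2_mul_leg234 hΔ Φ]
        simp only [mul_assoc]
    _ = leg123 (Φ * G) * comul2 D (comulFst D F) * comul2 D H.Φ.val * leg234 H.Φ.val := by
        rw [← mul_assoc (leg234 _), ← second, map_mul]
        simp only [mul_assoc]
    _ = leg123 G' * comul1 D (comulFst D F) *
          (leg123 H.Φ.val * comul2 D H.Φ.val * leg234 H.Φ.val) := by
        rw [hΦ, map_mul, mul_assoc (leg123 G'), ← comul1_comulFst_mul_leg123 coassoc]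
        simp only [mul_assoc]
    _ = leg123 (leg12 F) * comul1 D G' *
          (leg123 H.Φ.val * comul2 D H.Φ.val * leg234 H.Φ.val) := by rw [first]

lemma cocycle : comul1 Δ Φ * comul3 Δ Φ = leg123 Φ * comul2 Δ Φ * leg234 Φ := by
  have hunit : IsUnit (leg234 (leg23 F) * comul3 H.comul (leg23 F * comulSnd H.comul F)) :=
    ((h.isUnit.map _).map _).mul (((h.isUnit.map _).mul (h.isUnit.map _)).map _)
  refine hunit.mul_right_cancel ?_
  rw [h.comul1_mul_comul3_mul, h.leg123_mul_comul2_mul_leg234_mul, H.cocycle]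

end Twists

end QuasiBialgebra

lemma QuasiBialgebra.Twists.isCoassociator {A : Type} [Ring A] [Bialgebra ℂ A]
    {H : QuasiBialgebra A} {F : A ⊗[ℂ] A} {Φ : A ⊗[ℂ] (A ⊗[ℂ] A)}
    (hε : H.counit = Bialgebra.counitAlgHom ℂ A)
    (h : H.Twists F (Bialgebra.comulAlgHom ℂ A) Φ) : IsCoassociator Φ where
  isUnit := h.isUnit_coassociator
  intertwines := h.comulFst_comul_mul
  counital := hε ▸ h.counitMid_eq_one
  cocycle := h.cocycle

namespace Q

open Complex (I)
open Algebra.TensorProduct (tmul_mul_tmul one_def)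

/-! ### The symplectic fermion quasi-bialgebra on `Q` -/

/-- The odd generator `Y = F K`, the companion of `E`: both `x = E` and `x = Y` have coproduct
`1 ⊗ x + x ⊗ K`. -/
def Y : Q := F * K

lemma E_mul_E : E * E = 0 := by rw [← pow_two, EE]

lemma K_mul_Y : K * Y = -(Y * K) := by rw [Y, ← mul_assoc, KF, neg_mul]

lemma Y_mul_Y : Y * Y = 0 := by
  rw [Y, mul_assoc, ← mul_assoc K, KF, neg_mul, mul_neg, mul_assoc, ← mul_assoc F F, ← pow_two F,
    FF, zero_mul, neg_zero]

lemma K_mul_K : K * K = e0 - e1 := by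
  rw [e0, e1, ← pow_two]
  module

lemma e0_add_e1 : e0 + e1 = 1 := by
  rw [e0, e1]
  module

lemma e1_mul_e1 : e1 * e1 = e1 := by
  have h : K ^ 2 * K ^ 2 = 1 := by rw [← pow_add, KK]
  simp only [e1, mul_sub, sub_mul, smul_mul_smul_comm, mul_one, one_mul, h]
  module

lemma e0_eq : e0 = 1 - e1 := eq_sub_of_add_eq e0_add_e1

lemma e0_mul_e0 : e0 * e0 = e0 := by
  rw [e0_eq, mul_sub, sub_mul, sub_mul, e1_mul_e1]
  simp

lemma e0_mul_e1 : e0 * e1 = 0 := by rw [e0_eq, sub_mul, one_mul, e1_mul_e1, sub_self]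

lemma e1_mul_e0 : e1 * e0 = 0 := by rw [e0_eq, mul_sub, mul_one, e1_mul_e1, sub_self]

lemma inv_I_sub : (I - I⁻¹)⁻¹ = -(1 / 2) * I := by
  rw [Complex.inv_I, sub_neg_eq_add, ← two_mul, mul_inv, Complex.inv_I]
  ring

lemma Y_mul_E : Y * E = I • e1 - E * Y := by
  have hEF : (E * F - F * E) * K = I • e1 := by
    rw [EF, inv_I_sub, e1, smul_mul_assoc, sub_mul, ← pow_succ, KK, ← pow_two]
    module
  rw [← hEF, Y, mul_assoc, KE, mul_neg, sub_mul, mul_assoc, mul_assoc]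
  abel

lemma F_eq : F = Y * K ^ 3 := by rw [Y, mul_assoc, K_mul_K3, mul_one]

lemma pow_three_mul_of_anticommute {B : Type} [Ring B] {k x : B} (h : k * x = -(x * k)) :
    k ^ 3 * x = -(x * k ^ 3) := by
  have h2 : k * k * x = x * (k * k) := by
    rw [mul_assoc, h, mul_neg, ← mul_assoc, h, neg_mul, neg_neg, mul_assoc]
  rw [pow_succ' k, pow_two, mul_assoc, h2, ← mul_assoc, h, neg_mul, mul_assoc]

section liftY

variable {B : Type} [Ring B] [Algebra ℂ B]

/-- A variant of `Q.lift` which takes the image of `Y` instead of that of `F`. -/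
def liftY (e y k : B) (hKE : k * e = -(e * k)) (hKY : k * y = -(y * k))
    (hEY : e * y + y * e = (I / 2) • (1 - k * k)) (hE : e * e = 0) (hY : y * y = 0)
    (hK : k ^ 4 = 1) : Q →ₐ[ℂ] B :=
  lift e (y * k ^ 3) k hKE (by rw [← mul_assoc, hKY, neg_mul, mul_assoc, mul_assoc, pow_mul_comm'])
    (by
      rw [mul_assoc y, pow_three_mul_of_anticommute hKE, mul_neg, sub_neg_eq_add, ← mul_assoc,
        ← mul_assoc, ← add_mul, hEY, smul_mul_assoc, sub_mul, one_mul, ← pow_two, ← pow_add,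
        pow_succ k 4, hK, one_mul, inv_I_sub]
      module)
    (by rw [pow_two, hE])
    (by rw [pow_two, mul_assoc, ← mul_assoc (k ^ 3), pow_three_mul_of_anticommute hKY, neg_mul,
      mul_neg, mul_assoc, ← mul_assoc y, hY, zero_mul, neg_zero])
    hK

variable {e y k : B} {hKE : k * e = -(e * k)} {hKY : k * y = -(y * k)}
  {hEY : e * y + y * e = (I / 2) • (1 - k * k)} {hE : e * e = 0} {hY : y * y = 0} {hK : k ^ 4 = 1}

lemma liftY_E : liftY e y k hKE hKY hEY hE hY hK E = e := by rw [liftY, lift_E]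

lemma liftY_K : liftY e y k hKE hKY hEY hE hY hK K = k := by rw [liftY, lift_K]

lemma liftY_Y : liftY e y k hKE hKY hEY hE hY hK Y = y := by
  rw [Y, map_mul, liftY, lift_F, lift_K, mul_assoc, ← pow_succ, hK, mul_one]

end liftY

lemma induction_Y {P : Q → Prop} (hE : P E) (hY : P Y) (hK : P K)
    (halg : ∀ c : ℂ, P (algebraMap ℂ Q c)) (hadd : ∀ a b, P a → P b → P (a + b))
    (hmul : ∀ a b, P a → P b → P (a * b)) (a : Q) : P a :=
  induction hE
    (by rw [F_eq, pow_succ, pow_two]; exact hmul _ _ hY (hmul _ _ (hmul _ _ hK hK) hK))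
    hK halg hadd hmul a

lemma map_mul_eq_mul_map {B : Type} [Ring B] [Algebra ℂ B] {f g : Q →ₐ[ℂ] B} {u : B}
    (hE : f E * u = u * g E) (hY : f Y * u = u * g Y) (hK : f K * u = u * g K) (a : Q) :
    f a * u = u * g a := by
  induction a using induction_Y with
  | hE => exact hE
  | hY => exact hY
  | hK => exact hK
  | halg c => rw [AlgHom.commutes, AlgHom.commutes, Algebra.commutes]
  | hadd a b ha hb => rw [map_add, map_add, add_mul, mul_add, ha, hb]
  | hmul a b ha hb => rw [map_mul, map_mul, mul_assoc, hb, ← mul_assoc, ha, mul_assoc]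

lemma commute_e1 (a : Q) : Commute e1 a := by
  have hE : K * K * E = E * (K * K) := by
    rw [mul_assoc, KE, mul_neg, ← mul_assoc, KE, neg_mul, neg_neg, mul_assoc]
  have hY : K * K * Y = Y * (K * K) := by
    rw [mul_assoc, K_mul_Y, mul_neg, ← mul_assoc, K_mul_Y, neg_mul, neg_neg, mul_assoc]
  have h : Commute (K * K) a := by
    induction a using induction_Y with
    | hE => exact hE
    | hY => exact hY
    | hK => exact mul_assoc K K K
    | halg c => exact (Algebra.commutes c _).symm
    | hadd a b ha hb => exact ha.add_right hb
    | hmul a b ha hb => exact ha.mul_right hb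
  rw [e1, pow_two]
  exact ((Commute.one_left a).sub_left h).smul_left _

lemma commute_e0 (a : Q) : Commute e0 a := by
  rw [e0_eq]
  exact (Commute.one_left a).sub_left (commute_e1 a)

lemma one_add_tmul_mul_one_add_tmul {A B : Type} [Ring A] [Algebra ℂ A] [Ring B] [Algebra ℂ B]
    (a b : A) {p : B} (hp : p * p = p) :
    (1 + (a - 1) ⊗ₜ[ℂ] p) * (1 + (b - 1) ⊗ₜ p) = 1 + (a * b - 1) ⊗ₜ p := by
  have h : a * b - 1 = (a - 1) * (b - 1) + (a - 1) + (b - 1) := by noncomm_ring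
  rw [mul_add, add_mul, add_mul, tmul_mul_tmul, hp, h, TensorProduct.add_tmul,
    TensorProduct.add_tmul]
  noncomm_ring

/-- `K (e0 + c e1)`: the action of `K`, rescaled by `c` on the twisted sector. -/
def omega (c : ℂ) : Q := K * (e0 + c • e1)

lemma omega_mul_K (c : ℂ) : omega c * K = K * omega c := by
  rw [omega, mul_assoc, (((commute_e0 K).add_left ((commute_e1 K).smul_left c)).eq)]

lemma omega_mul_e1 (c : ℂ) : omega c * e1 = c • (K * e1) := by
  rw [omega, mul_assoc, add_mul, e0_mul_e1, smul_mul_assoc, e1_mul_e1, zero_add, mul_smul_comm]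

lemma e1_mul_omega (c : ℂ) : e1 * omega c = c • (K * e1) := by
  rw [(commute_e1 _).eq, omega_mul_e1]

lemma omega_mul_of_anticommute {x : Q} (h : K * x = -(x * K)) (c : ℂ) :
    omega c * x = -(x * omega c) := by
  rw [omega, mul_assoc, ((commute_e0 x).add_left ((commute_e1 x).smul_left c)).eq, ← mul_assoc, h,
    neg_mul, mul_assoc]

lemma omega_mul_omega (c d : ℂ) : omega c * omega d = e0 - (c * d) • e1 := by
  have h := (((commute_e0 K).add_left ((commute_e1 K).smul_left c)).eq)
  rw [omega, omega, mul_assoc, ← mul_assoc _ K, h, mul_assoc, ← mul_assoc, K_mul_K]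
  simp only [mul_add, sub_mul, add_mul, smul_mul_assoc, mul_smul_comm, e0_mul_e0, e0_mul_e1,
    e1_mul_e0, e1_mul_e1, mul_zero, smul_zero]
  module

lemma omega_pow_four {c : ℂ} (hc : c * c = 1) : omega c ^ 4 = 1 := by
  rw [show 4 = 2 * 2 from rfl, pow_mul, pow_two (omega c), omega_mul_omega, hc, one_smul, ← K_mul_K,
    ← pow_two, ← pow_mul, KK]

/-- The comultiplication of the symplectic fermion quasi-Hopf algebra on `Q`. It differs from that
of the Hopf algebra `Q` in that the factors `K` accompanying `E` and `Y` are replaced by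
`omega I` and `omega (-I)`. -/
def sfComul : Q →ₐ[ℂ] Q ⊗[ℂ] Q :=
  liftY (1 ⊗ₜ E + E ⊗ₜ omega I) (1 ⊗ₜ Y + Y ⊗ₜ omega (-I)) (K ⊗ₜ K)
    (by simp only [mul_add, add_mul, tmul_mul_tmul, mul_one, one_mul, KE, ← omega_mul_K, neg_add,
          TensorProduct.tmul_neg, TensorProduct.neg_tmul])
    (by simp only [mul_add, add_mul, tmul_mul_tmul, mul_one, one_mul, K_mul_Y, ← omega_mul_K,
          neg_add, TensorProduct.tmul_neg, TensorProduct.neg_tmul])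
    (by
      simp only [mul_add, add_mul, tmul_mul_tmul, mul_one, one_mul, Y_mul_E, K_mul_K,
        omega_mul_of_anticommute KE, omega_mul_of_anticommute K_mul_Y, omega_mul_omega, e0_eq,
        one_def, TensorProduct.sub_tmul, TensorProduct.tmul_sub, ← TensorProduct.smul_tmul',
        TensorProduct.tmul_smul, TensorProduct.tmul_neg, mul_neg, neg_mul, Complex.I_mul_I]
      module)
    (by simp only [mul_add, add_mul, tmul_mul_tmul, mul_one, one_mul, E_mul_E,
          omega_mul_of_anticommute KE, TensorProduct.tmul_neg, TensorProduct.tmul_zero,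
          TensorProduct.zero_tmul]
        abel)
    (by simp only [mul_add, add_mul, tmul_mul_tmul, mul_one, one_mul, Y_mul_Y,
          omega_mul_of_anticommute K_mul_Y, TensorProduct.tmul_neg, TensorProduct.tmul_zero,
          TensorProduct.zero_tmul]
        abel)
    (by rw [Algebra.TensorProduct.tmul_pow, KK, one_def])

lemma sfComul_E : sfComul E = 1 ⊗ₜ E + E ⊗ₜ omega I := liftY_E

lemma sfComul_Y : sfComul Y = 1 ⊗ₜ Y + Y ⊗ₜ omega (-I) := liftY_Y

lemma sfComul_K : sfComul K = K ⊗ₜ K := liftY_K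

lemma sfComul_e1 : sfComul e1 = e0 ⊗ₜ e1 + e1 ⊗ₜ e0 := by
  conv_lhs => rw [e1, pow_two]
  rw [map_smul, map_sub, map_mul, map_one, sfComul_K, tmul_mul_tmul, K_mul_K, one_def,
    ← e0_add_e1]
  simp only [TensorProduct.add_tmul, TensorProduct.tmul_add, TensorProduct.sub_tmul,
    TensorProduct.tmul_sub]
  module

lemma sfComul_e0 : sfComul e0 = e0 ⊗ₜ e0 + e1 ⊗ₜ e1 := by
  rw [e0_eq, map_sub, map_one, sfComul_e1, one_def, e0_eq]
  simp only [TensorProduct.sub_tmul, TensorProduct.tmul_sub]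
  abel

lemma sfComul_omega (c : ℂ) : sfComul (omega c) = omega c ⊗ₜ omega c +
    (1 - c * c) • ((K * e1) ⊗ₜ (K * e1)) := by
  rw [omega, map_mul, map_add, map_smul, sfComul_K, sfComul_e0, sfComul_e1]
  simp only [mul_add, tmul_mul_tmul, TensorProduct.add_tmul, TensorProduct.tmul_add, mul_smul_comm,
    ← TensorProduct.smul_tmul', TensorProduct.tmul_smul, smul_add, smul_smul]
  module

/-- The coassociator of the symplectic fermion quasi-Hopf algebra on `Q`: it acts by `omega c` on
the first factor whenever the other two factors are both in the twisted sector. -/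
def sfCoassociator (c : ℂ) : Q ⊗[ℂ] (Q ⊗[ℂ] Q) := 1 + (omega c - 1) ⊗ₜ (e1 ⊗ₜ e1)

lemma sfCoassociator_pow_four {c : ℂ} (hc : c * c = 1) : sfCoassociator c ^ 4 = 1 := by
  have h : (e1 ⊗ₜ[ℂ] e1) * (e1 ⊗ₜ[ℂ] e1) = e1 ⊗ₜ[ℂ] e1 := by rw [tmul_mul_tmul, e1_mul_e1]
  rw [show 4 = 2 * 2 from rfl, pow_mul, pow_two, pow_two, sfCoassociator,
    one_add_tmul_mul_one_add_tmul _ _ h, one_add_tmul_mul_one_add_tmul _ _ h, ← mul_assoc,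
    ← pow_three', ← pow_succ, omega_pow_four hc, sub_self, TensorProduct.zero_tmul, add_zero]

lemma comulFst_sfComul_mul_of_anticommute {c d : ℂ} {x : Q} (hx : K * x = -(x * K))
    (hd : d * d = -1) (hΔ : sfComul x = 1 ⊗ₜ x + x ⊗ₜ omega d) :
    comulFst sfComul (sfComul x) * sfCoassociator c =
      sfCoassociator c * comulSnd sfComul (sfComul x) := by
  have he : e1 * (K * e1) = K * e1 := by rw [(commute_e1 _).eq, mul_assoc, e1_mul_e1]
  simp only [hΔ, map_add, comulFst_tmul, comulSnd_tmul, sfComul_omega, hd, leg12_tmul, map_one,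
    sfCoassociator, mul_add, add_mul, sub_mul, mul_sub, tmul_mul_tmul, TensorProduct.tmul_add,
    TensorProduct.sub_tmul, mul_one, one_mul, omega_mul_of_anticommute hx, omega_mul_e1,
    e1_mul_omega, (commute_e1 x).eq, TensorProduct.tmul_smul, TensorProduct.smul_tmul,
    mul_smul_comm, he, TensorProduct.neg_tmul, smul_smul]
  module

lemma comulFst_sfComul_mul {c : ℂ} (a : Q) :
    comulFst sfComul (sfComul a) * sfCoassociator c =
      sfCoassociator c * comulSnd sfComul (sfComul a) := by
  refine map_mul_eq_mul_map (f := (comulFst sfComul).comp sfComul)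
    (g := (comulSnd sfComul).comp sfComul) ?_ ?_ ?_ a
  · exact comulFst_sfComul_mul_of_anticommute KE Complex.I_mul_I sfComul_E
  · exact comulFst_sfComul_mul_of_anticommute K_mul_Y (by rw [neg_mul_neg, Complex.I_mul_I])
      sfComul_Y
  · simp only [AlgHom.comp_apply, sfComul_K, comulFst_tmul, comulSnd_tmul, leg12_tmul,
      tmul_mul_tmul, one_mul, mul_one, sfCoassociator, mul_add, add_mul, mul_sub, sub_mul,
      omega_mul_K, (commute_e1 K).eq]

lemma sfCoassociator_cocycle {c : ℂ} (hc : c * c = 1) :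
    comul1 sfComul (sfCoassociator c) * comul3 sfComul (sfCoassociator c) =
      leg123 (sfCoassociator c) * comul2 sfComul (sfCoassociator c) *
        leg234 (sfCoassociator c) := by
  obtain ⟨δ, hδ⟩ : ∃ δ, δ = omega c - 1 := ⟨_, rfl⟩
  have hω : sfComul δ = δ ⊗ₜ δ + δ ⊗ₜ 1 + 1 ⊗ₜ δ := by
    rw [hδ, map_sub, map_one, sfComul_omega, hc, one_def, TensorProduct.sub_tmul,
      TensorProduct.sub_tmul, TensorProduct.tmul_sub, TensorProduct.tmul_sub]
    module
  have he : e1 * δ = δ * e1 := (commute_e1 δ).eq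
  simp only [sfCoassociator, ← hδ, map_add, map_one, comul1_tmul, comul2_tmul, comul3_tmul,
    comulFst_tmul, comulSnd_tmul, leg12_tmul, leg123_tmul, leg234_apply, leg23_apply, hω,
    sfComul_e1, mul_add, add_mul, tmul_mul_tmul, TensorProduct.tmul_add, mul_one, one_mul,
    e1_mul_e1]
  simp only [e0_eq, mul_sub, sub_mul, TensorProduct.tmul_sub, TensorProduct.sub_tmul, e1_mul_e1, he,
    mul_one, one_mul]
  abel

lemma algHom_ext_Y {B : Type} [Ring B] [Algebra ℂ B] {f g : Q →ₐ[ℂ] B} (hE : f E = g E)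
    (hY : f Y = g Y) (hK : f K = g K) : f = g :=
  algHom_ext hE (by rw [F_eq, map_mul, map_mul, map_pow, map_pow, hY, hK]) hK

lemma counit_Y : counit Y = 0 := by simp [Y]

lemma counit_e1 : counit e1 = 0 := by simp [e1]

lemma counit_e0 : counit e0 = 1 := by simp [e0_eq, counit_e1]

lemma counit_omega (c : ℂ) : counit (omega c) = 1 := by simp [omega, counit_e0, counit_e1]

lemma counitFst_sfComul (a : Q) : counitFst counit (sfComul a) = a := by
  have h : (counitFst counit).comp sfComul = AlgHom.id ℂ Q := by
    apply algHom_ext_Y <;> simp [sfComul_E, sfComul_Y, sfComul_K, counitFst, counit_Y]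
  exact DFunLike.congr_fun h a

lemma counitSnd_sfComul (a : Q) : counitSnd counit (sfComul a) = a := by
  have h : (counitSnd counit).comp sfComul = AlgHom.id ℂ Q := by
    apply algHom_ext_Y <;>
      simp [sfComul_E, sfComul_Y, sfComul_K, counitSnd, counit_Y, counit_omega]
  exact DFunLike.congr_fun h a

/-- The symplectic fermion quasi-bialgebra: the algebra `Q` with the comultiplication `sfComul` and
the coassociator `sfCoassociator c`, one for each of the two choices of `c`. -/
def symplecticFermions (c : ℂ) (hc : c * c = 1) : QuasiBialgebra Q where
  counit := counit
  comul := sfComul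
  Φ := Units.ofPowEqOne (sfCoassociator c) 4 (sfCoassociator_pow_four hc) four_ne_zero
  counit_fst := counitFst_sfComul
  counit_snd := counitSnd_sfComul
  quasi_coassoc a := by
    rw [Units.eq_mul_inv_iff_mul_eq]
    exact comulFst_sfComul_mul a
  counital := by
    change counitMid counit (sfCoassociator c) = 1
    simp [sfCoassociator, counitMid, counitFst, counit_e1]
  cocycle := sfCoassociator_cocycle hc

/-! ### `Φ` as a twisted coassociator -/

/-- The two central idempotents `e0` and `e1`, indexed by the `ℤ/2`-grading. -/
def e : Fin 2 → Q := ![e0, e1]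

lemma e_zero : e 0 = e0 := rfl

lemma e_one : e 1 = e1 := rfl

lemma sum_e : ∑ i, e i = 1 := by rw [Fin.sum_univ_two, e_zero, e_one, e0_add_e1]

lemma commute_e (i : Fin 2) (a : Q) : Commute (e i) a := by
  fin_cases i
  exacts [commute_e0 a, commute_e1 a]

lemma e_mul_e (i j : Fin 2) : e i * e j = if i = j then e i else 0 := by
  fin_cases i <;> fin_cases j
  exacts [e0_mul_e0, e0_mul_e1, e1_mul_e0, e1_mul_e1]

lemma sfComul_e_mul (i j : Fin 2) : sfComul (e (i + j)) * (e i ⊗ₜ e j) = e i ⊗ₜ e j := by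
  fin_cases i <;> fin_cases j <;>
    simp [e, sfComul_e0, sfComul_e1, add_mul, e0_mul_e0, e0_mul_e1, e1_mul_e0, e1_mul_e1]

lemma commute_e_tmul (i j : Fin 2) (x : Q ⊗[ℂ] Q) : Commute (e i ⊗ₜ e j) x := by
  induction x with
  | zero => exact Commute.zero_right _
  | tmul a b =>
    rw [Commute, SemiconjBy, tmul_mul_tmul, tmul_mul_tmul, (commute_e i a).eq, (commute_e j b).eq]
  | add x y hx hy => exact hx.add_right hy

lemma commute_e_tmul_tmul (i j k : Fin 2) (x : Q ⊗[ℂ] (Q ⊗[ℂ] Q)) :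
    Commute (e i ⊗ₜ (e j ⊗ₜ e k)) x := by
  induction x with
  | zero => exact Commute.zero_right _
  | tmul a b =>
    rw [Commute, SemiconjBy, tmul_mul_tmul, tmul_mul_tmul, (commute_e i a).eq,
      (commute_e_tmul j k b).eq]
  | add x y hx hy => exact hx.add_right hy

lemma ext_sectors₂ {x y : Q ⊗[ℂ] Q} (h : ∀ i j, x * (e i ⊗ₜ e j) = y * (e i ⊗ₜ e j)) :
    x = y := by
  have h1 : (1 : Q ⊗[ℂ] Q) = ∑ i, ∑ j, e i ⊗ₜ e j := by
    simp only [← TensorProduct.tmul_sum, ← TensorProduct.sum_tmul, sum_e, one_def]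
  rw [← mul_one x, ← mul_one y, h1]
  simp only [Finset.mul_sum, h]

lemma ext_sectors₃ {x y : Q ⊗[ℂ] (Q ⊗[ℂ] Q)}
    (h : ∀ i j k, x * (e i ⊗ₜ (e j ⊗ₜ e k)) = y * (e i ⊗ₜ (e j ⊗ₜ e k))) : x = y := by
  have h1 : (1 : Q ⊗[ℂ] (Q ⊗[ℂ] Q)) = ∑ i, ∑ j, ∑ k, e i ⊗ₜ (e j ⊗ₜ e k) := by
    simp only [← TensorProduct.tmul_sum, ← TensorProduct.sum_tmul, sum_e, one_def]
  rw [← mul_one x, ← mul_one y, h1]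
  simp only [Finset.mul_sum, h]

lemma mul_mul_eq_of_commute {M : Type} [Monoid M] {a a' b b' z : M} (hz : ∀ x, Commute z x)
    (ha : a * z = a' * z) (hb : b * z = b' * z) : a * b * z = a' * b' * z := by
  rw [mul_assoc, hb, ← (hz b').eq, ← mul_assoc, ha, mul_assoc, (hz b').eq, ← mul_assoc]

/-- The restrictions of `twist` to the four sectors of `Q ⊗ Q`. -/
def twistComponent : Fin 2 → Fin 2 → Q ⊗[ℂ] Q :=
  ![![1, 1 + (1 - I) • (E * Y) ⊗ₜ 1 - (1 - I) • Y ⊗ₜ (E * K) + (1 + I) • E ⊗ₜ (Y * K) +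
      (2 : ℂ) • (E * Y) ⊗ₜ (E * Y)],
    ![1, (K + (1 + I) • (E * (Y * K))) ⊗ₜ 1]]

/-- The inverses of `twistComponent`. -/
def twistInvComponent : Fin 2 → Fin 2 → Q ⊗[ℂ] Q :=
  ![![1, 1 - (1 + I) • (E * Y) ⊗ₜ 1 + (1 - I) • Y ⊗ₜ (E * K) - (1 + I) • E ⊗ₜ (Y * K) +
      (2 : ℂ) • (E * Y) ⊗ₜ (E * Y)],
    ![1, -((K + (I - 1) • (E * (Y * K))) ⊗ₜ 1)]]

/-- The element of `Q ⊗ Q` with given restrictions to the sectors. -/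
def ofSectors (f : Fin 2 → Fin 2 → Q ⊗[ℂ] Q) : Q ⊗[ℂ] Q := ∑ i, ∑ j, f i j * (e i ⊗ₜ e j)

lemma ofSectors_mul (f : Fin 2 → Fin 2 → Q ⊗[ℂ] Q) (i j : Fin 2) :
    ofSectors f * (e i ⊗ₜ e j) = f i j * (e i ⊗ₜ e j) := by
  fin_cases i <;> fin_cases j <;>
    simp [ofSectors, Fin.sum_univ_two, add_mul, mul_assoc, e_mul_e]

/-- The element which twists the symplectic fermion quasi-bialgebra into `(Q, Φ)`. -/
def twist : Q ⊗[ℂ] Q := ofSectors twistComponent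

lemma E_mul_E_mul (x : Q) : E * (E * x) = 0 := by rw [← mul_assoc, E_mul_E, zero_mul]

lemma Y_mul_Y_mul (x : Q) : Y * (Y * x) = 0 := by rw [← mul_assoc, Y_mul_Y, zero_mul]

lemma K_mul_E_mul (x : Q) : K * (E * x) = -(E * (K * x)) := by
  rw [← mul_assoc, KE, neg_mul, mul_assoc]

lemma K_mul_Y_mul (x : Q) : K * (Y * x) = -(Y * (K * x)) := by
  rw [← mul_assoc, K_mul_Y, neg_mul, mul_assoc]

lemma Y_mul_E_mul (x : Q) : Y * (E * x) = I • (e1 * x) - E * (Y * x) := by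
  rw [← mul_assoc, Y_mul_E, sub_mul, smul_mul_assoc, mul_assoc]

lemma K_mul_K_mul_e0 : K * (K * e0) = e0 := by
  rw [← mul_assoc, K_mul_K, sub_mul, e0_mul_e0, e1_mul_e0, sub_zero]

lemma K_mul_K_mul_e1 : K * (K * e1) = -e1 := by
  rw [← mul_assoc, K_mul_K, sub_mul, e1_mul_e1, e0_mul_e1, zero_sub]

lemma isUnit_ofSectors {f g : Fin 2 → Fin 2 → Q ⊗[ℂ] Q}
    (h : ∀ i j, f i j * g i j * (e i ⊗ₜ e j) = e i ⊗ₜ e j ∧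
      g i j * f i j * (e i ⊗ₜ e j) = e i ⊗ₜ e j) : IsUnit (ofSectors f) := by
  have hmul (f g : Fin 2 → Fin 2 → Q ⊗[ℂ] Q) (i j : Fin 2) :
      ofSectors f * ofSectors g * (e i ⊗ₜ e j) = f i j * g i j * (e i ⊗ₜ e j) :=
    mul_mul_eq_of_commute (commute_e_tmul i j) (ofSectors_mul f i j) (ofSectors_mul g i j)
  exact ⟨⟨ofSectors f, ofSectors g,
    ext_sectors₂ fun i j => by rw [hmul, (h i j).1, one_mul],
    ext_sectors₂ fun i j => by rw [hmul, (h i j).2, one_mul]⟩, rfl⟩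

lemma isUnit_twist : IsUnit twist := by
  refine isUnit_ofSectors (g := twistInvComponent) ?_
  simp only [Fin.forall_fin_two, e_zero, e_one, twistComponent, twistInvComponent,
    Matrix.cons_val_zero, Matrix.cons_val_one, mul_one, one_mul, true_and, and_self]
  refine ⟨⟨?_, ?_⟩, ?_, ?_⟩
  all_goals
    simp only [one_mul, mul_add, add_mul, mul_sub, sub_mul, mul_neg, neg_mul, mul_assoc, mul_zero,
      zero_mul, tmul_mul_tmul, smul_mul_assoc, mul_smul_comm, TensorProduct.add_tmul,
      TensorProduct.neg_tmul, TensorProduct.tmul_neg, TensorProduct.zero_tmul,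
      TensorProduct.tmul_zero, smul_zero, TensorProduct.tmul_sub, TensorProduct.sub_tmul,
      ← TensorProduct.smul_tmul', TensorProduct.tmul_smul, E_mul_E_mul, Y_mul_Y_mul,
      K_mul_E_mul, K_mul_Y_mul, Y_mul_E_mul, (commute_e1 Y).left_comm, (commute_e1 K).left_comm,
      e1_mul_e0, e1_mul_e1, K_mul_K_mul_e1]
    match_scalars <;> grind [Complex.I_mul_I]

lemma comul_Y : comul Y = 1 ⊗ₜ Y + Y ⊗ₜ K := by
  rw [Y, map_mul, comul_F, comul_K, add_mul, tmul_mul_tmul, tmul_mul_tmul, ← pow_succ, KK, one_mul]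

lemma comul_mul_twist (a : Q) : comul a * twist = twist * sfComul a := by
  have h (x : Q) (hx : ∀ i j, comul x * twistComponent i j * (e i ⊗ₜ e j) =
      twistComponent i j * sfComul x * (e i ⊗ₜ e j)) : comul x * twist = twist * sfComul x :=
    ext_sectors₂ fun i j => by
      rw [mul_assoc, mul_assoc, twist, ofSectors_mul, ← (commute_e_tmul i j (sfComul x)).eq,
        ← mul_assoc, ← mul_assoc, ofSectors_mul, hx, mul_assoc, mul_assoc,
        (commute_e_tmul i j _).eq]
  refine map_mul_eq_mul_map (h E ?_) (h Y ?_) (h K ?_) a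
  all_goals
    simp only [Fin.forall_fin_two, e_zero, e_one, twistComponent, Matrix.cons_val_zero,
      Matrix.cons_val_one, comul_E, comul_Y, comul_K, sfComul_E, sfComul_Y, sfComul_K, omega]
    refine ⟨⟨?_, ?_⟩, ?_, ?_⟩
  all_goals
    simp only [one_mul, mul_one, mul_add, add_mul, sub_mul, mul_sub, mul_neg, neg_mul, mul_assoc,
      mul_zero, zero_mul, tmul_mul_tmul, smul_mul_assoc, mul_smul_comm, TensorProduct.add_tmul,
      TensorProduct.neg_tmul, TensorProduct.tmul_add, TensorProduct.tmul_neg,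
      TensorProduct.zero_tmul, TensorProduct.tmul_zero, smul_zero, TensorProduct.tmul_sub,
      TensorProduct.sub_tmul, ← TensorProduct.smul_tmul', TensorProduct.tmul_smul, E_mul_E_mul,
      Y_mul_Y_mul, K_mul_E_mul, K_mul_Y_mul, Y_mul_E_mul, (commute_e1 Y).left_comm,
      (commute_e1 K).left_comm, e1_mul_e0, e1_mul_e1, e0_mul_e0, e0_mul_e1, K_mul_K_mul_e1,
      K_mul_K_mul_e0]
  all_goals match_scalars <;> grind [Complex.I_mul_I]

/-- The restrictions of `Φ β` to the eight sectors of `Q ⊗ Q ⊗ Q`. -/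
def ΦComponent (β : ℂ) : Fin 2 → Fin 2 → Fin 2 → Q ⊗[ℂ] (Q ⊗[ℂ] Q) :=
  ![![![1, 1], ![Φ010, 1]], ![![1, Φ101], ![1, Φ111 β]]]

lemma Φ_mul_e (β : ℂ) (i j k : Fin 2) :
    Φ β * (e i ⊗ₜ (e j ⊗ₜ e k)) = ΦComponent β i j k * (e i ⊗ₜ (e j ⊗ₜ e k)) := by
  fin_cases i <;> fin_cases j <;> fin_cases k <;>
    simp [Φ, ΦComponent, e, add_mul, mul_assoc, e0_mul_e0, e0_mul_e1, e1_mul_e0, e1_mul_e1]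

lemma leg12_twist_mul_e (i j k : Fin 2) : leg12 twist * (e i ⊗ₜ (e j ⊗ₜ e k)) =
    leg12 (twistComponent i j) * (e i ⊗ₜ (e j ⊗ₜ e k)) := by
  have h : e i ⊗ₜ[ℂ] (e j ⊗ₜ e k) = leg12 (e i ⊗ₜ e j) * (1 ⊗ₜ (1 ⊗ₜ e k)) := by
    simp [leg12_tmul]
  rw [h, ← mul_assoc, ← mul_assoc, ← map_mul, ← map_mul, twist, ofSectors_mul]

lemma leg23_twist_mul_e (i j k : Fin 2) : leg23 twist * (e i ⊗ₜ (e j ⊗ₜ e k)) =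
    leg23 (twistComponent j k) * (e i ⊗ₜ (e j ⊗ₜ e k)) := by
  rw [leg23_apply, leg23_apply, tmul_mul_tmul, tmul_mul_tmul, twist, ofSectors_mul]

lemma comulFst_e_mul (i j k : Fin 2) : comulFst sfComul (e (i + j) ⊗ₜ e k) *
    (e i ⊗ₜ (e j ⊗ₜ e k)) = e i ⊗ₜ (e j ⊗ₜ e k) := by
  have h : e i ⊗ₜ[ℂ] (e j ⊗ₜ e k) = leg12 (e i ⊗ₜ e j) * (1 ⊗ₜ (1 ⊗ₜ e k)) := by
    simp [leg12_tmul]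
  rw [comulFst_tmul, h, mul_assoc, ← mul_assoc (1 ⊗ₜ _), ← (commute_leg12 _ _).eq, mul_assoc,
    ← mul_assoc, ← map_mul, sfComul_e_mul, tmul_mul_tmul, tmul_mul_tmul, e_mul_e, if_pos rfl,
    one_mul]

lemma comulSnd_e_mul (i j k : Fin 2) : comulSnd sfComul (e i ⊗ₜ e (j + k)) *
    (e i ⊗ₜ (e j ⊗ₜ e k)) = e i ⊗ₜ (e j ⊗ₜ e k) := by
  rw [comulSnd_tmul, tmul_mul_tmul, sfComul_e_mul, e_mul_e, if_pos rfl]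

lemma comulFst_twist_mul_e (i j k : Fin 2) :
    comulFst sfComul twist * (e i ⊗ₜ (e j ⊗ₜ e k)) =
      comulFst sfComul (twistComponent (i + j) k) * (e i ⊗ₜ (e j ⊗ₜ e k)) := by
  rw [← comulFst_e_mul, ← mul_assoc, ← mul_assoc, ← map_mul, ← map_mul, twist, ofSectors_mul]

lemma comulSnd_twist_mul_e (i j k : Fin 2) :
    comulSnd sfComul twist * (e i ⊗ₜ (e j ⊗ₜ e k)) =
      comulSnd sfComul (twistComponent i (j + k)) * (e i ⊗ₜ (e j ⊗ₜ e k)) := by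
  rw [← comulSnd_e_mul, ← mul_assoc, ← mul_assoc, ← map_mul, ← map_mul, twist, ofSectors_mul]

lemma F_eq_mul : F = Y * (K * (K * K)) := by rw [F_eq, pow_three]

set_option maxHeartbeats 1000000 in
-- In the sector `e1 ⊗ e1 ⊗ e1` both sides expand to dozens of monomials.
lemma ΦComponent_mul (β : ℂ) (i j k : Fin 2) :
    ΦComponent β i j k * (leg23 (twistComponent j k) *
      comulSnd sfComul (twistComponent i (j + k))) * (e i ⊗ₜ (e j ⊗ₜ e k)) =
    leg12 (twistComponent i j) * comulFst sfComul (twistComponent (i + j) k) *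
      sfCoassociator (-I * β ^ 2) * (e i ⊗ₜ (e j ⊗ₜ e k)) := by
  revert i j k
  have h11 : (1 : Fin 2) + 1 = 0 := rfl
  simp only [Fin.forall_fin_two, h11, add_zero, zero_add, e_zero, e_one, twistComponent, ΦComponent,
    Matrix.cons_val_zero, Matrix.cons_val_one, map_one, mul_one, one_mul, sfCoassociator, Φ010,
    Φ101, Φ111, F_eq_mul, map_add, map_sub, map_smul, leg23_apply, leg12_tmul, comulFst_tmul,
    comulSnd_tmul, map_mul, sfComul_E, sfComul_Y, sfComul_K, omega]
  refine ⟨⟨⟨?_, ?_⟩, ?_, ?_⟩, ⟨?_, ?_⟩, ?_, ?_⟩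
  all_goals
    simp only [one_mul, mul_one, mul_add, add_mul, sub_mul, mul_sub, mul_neg, neg_mul, mul_assoc,
      mul_zero, zero_mul, tmul_mul_tmul, smul_mul_assoc, mul_smul_comm, TensorProduct.add_tmul,
      TensorProduct.neg_tmul, TensorProduct.tmul_add, TensorProduct.tmul_neg,
      TensorProduct.zero_tmul, TensorProduct.tmul_zero, smul_zero, TensorProduct.tmul_sub,
      TensorProduct.sub_tmul, ← TensorProduct.smul_tmul', TensorProduct.tmul_smul, E_mul_E_mul,
      Y_mul_Y_mul, K_mul_E_mul, K_mul_Y_mul, Y_mul_E_mul, (commute_e1 Y).left_comm,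
      (commute_e1 K).left_comm, (commute_e0 Y).left_comm, (commute_e0 K).left_comm, e1_mul_e0,
      e1_mul_e1, e0_mul_e0, e0_mul_e1, K_mul_K_mul_e1, K_mul_K_mul_e0]
  all_goals match_scalars <;> grind [Complex.I_mul_I]

lemma Φ_mul_twist (β : ℂ) : Φ β * (leg23 twist * comulSnd sfComul twist) =
    leg12 twist * comulFst sfComul twist * sfCoassociator (-I * β ^ 2) :=
  ext_sectors₃ fun i j k => by
    rw [mul_mul_eq_of_commute (commute_e_tmul_tmul i j k) (Φ_mul_e β i j k)
        (mul_mul_eq_of_commute (commute_e_tmul_tmul i j k) (leg23_twist_mul_e i j k)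
          (comulSnd_twist_mul_e i j k)),
      mul_mul_eq_of_commute (commute_e_tmul_tmul i j k)
        (mul_mul_eq_of_commute (commute_e_tmul_tmul i j k) (leg12_twist_mul_e i j k)
          (comulFst_twist_mul_e i j k)) rfl,
      ΦComponent_mul]

lemma counit_e (i : Fin 2) : counit (e i) = if i = 0 then 1 else 0 := by
  fin_cases i
  exacts [counit_e0, counit_e1]

lemma counitFst_twist : counitFst counit twist = 1 := by
  simp [twist, ofSectors, twistComponent, counitFst, counit_e, counit_Y, ← sum_e]

lemma counitSnd_twist : counitSnd counit twist = 1 := by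
  simp [twist, ofSectors, twistComponent, counitSnd, counit_e, counit_Y, ← sum_e]

lemma twists_symplecticFermions {β : ℂ} (hβ : β ^ 4 = -1) :
    (symplecticFermions (-I * β ^ 2)
      (by linear_combination (-1 : ℂ) * hβ + β ^ 4 * Complex.I_sq)).Twists
        twist (Bialgebra.comulAlgHom ℂ Q) (Φ β) where
  isUnit := isUnit_twist
  counit_fst := counitFst_twist
  counit_snd := counitSnd_twist
  comul_mul := comul_mul_twist
  coassociator_mul := Φ_mul_twist β

theorem isCoassociator_Φ {β : ℂ} (hβ : β ^ 4 = -1) : IsCoassociator (Φ β) :=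
  (twists_symplecticFermions hβ).isCoassociator rfl

end Q

/-! ### Monoidal equivalences from twists -/

section Actions

variable {A B : Type} [Ring A] [Algebra ℂ A] [Ring B] [Algebra ℂ B]
variable {U V W : Type} [AddCommGroup U] [Module ℂ U] [AddCommGroup V] [Module ℂ V]
  [AddCommGroup W] [Module ℂ W]

lemma tensorAction_comp (ρ : B →ₐ[ℂ] Module.End ℂ U) (σ : B →ₐ[ℂ] Module.End ℂ V)
    (f : A →ₐ[ℂ] B) (x : A ⊗[ℂ] A) :
    tensorAction (ρ.comp f) (σ.comp f) x =
      tensorAction ρ σ (Algebra.TensorProduct.map f f x) := by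
  rw [tensorAction_comp_left, tensorAction_comp_right,
    ← AlgHom.comp_apply (Algebra.TensorProduct.map _ _), ← Algebra.TensorProduct.map_comp,
    AlgHom.id_comp, AlgHom.comp_id]

lemma assocBy_comp (ρ : B →ₐ[ℂ] Module.End ℂ U) (σ : B →ₐ[ℂ] Module.End ℂ V)
    (τ : B →ₐ[ℂ] Module.End ℂ W) (f : A →ₐ[ℂ] B) (x : A ⊗[ℂ] (A ⊗[ℂ] A)) :
    assocBy (ρ.comp f) (σ.comp f) (τ.comp f) x =
      assocBy ρ σ τ (Algebra.TensorProduct.map f (Algebra.TensorProduct.map f f) x) := by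
  have hcomp : tensorAction (σ.comp f) (τ.comp f) =
      (tensorAction σ τ).comp (Algebra.TensorProduct.map f f) :=
    AlgHom.ext (tensorAction_comp σ τ f)
  rw [assocBy, assocBy, hcomp, tensorAction_comp_left, tensorAction_comp_right,
    ← AlgHom.comp_apply (Algebra.TensorProduct.map _ _), ← Algebra.TensorProduct.map_comp,
    AlgHom.id_comp, AlgHom.comp_id]

/-- The action of an invertible element, as a linear equivalence. -/
def actionEquiv (ρ : A →ₐ[ℂ] Module.End ℂ U) (x : Aˣ) : U ≃ₗ[ℂ] U :=
  LinearMap.GeneralLinearGroup.generalLinearEquiv ℂ U (Units.map ρ x)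

variable (ρ : A →ₐ[ℂ] Module.End ℂ U) (σ : A →ₐ[ℂ] Module.End ℂ V)
  (τ : A →ₐ[ℂ] Module.End ℂ W)

lemma assoc_map_tensorAction (x : A ⊗[ℂ] A) (w : (U ⊗[ℂ] V) ⊗[ℂ] W) :
    TensorProduct.assoc ℂ U V W (TensorProduct.map (tensorAction ρ σ x) LinearMap.id w) =
      tensorAction ρ (tensorAction σ τ) (leg12 x) (TensorProduct.assoc ℂ U V W w) := by
  rw [← tensorAction_tmul_one (tensorAction ρ σ) τ, assoc_tensorAction, leg12_eq_assoc]
  rfl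

end Actions

namespace QuasiBialgebra

open MonoidalCategory

section IdFunctor

variable {A : Type} [Ring A] [Algebra ℂ A] {H H' : QuasiBialgebra A} {F : (A ⊗[ℂ] A)ˣ}

instance (H K : QuasiBialgebra A) : (idFunctor H K).IsEquivalence where
  faithful := ⟨fun {M N} _ _ h => Rep.hom_ext
    (congrArg (fun f : (idFunctor H K).obj M ⟶ (idFunctor H K).obj N => Rep.Hom.hom f) h)⟩
  full := ⟨fun f => ⟨⟨f.hom, f.comm⟩, rfl⟩⟩
  essSurj := ⟨fun M => ⟨⟨M.V, M.ρ⟩,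
    ⟨Rep.mkIso (LinearEquiv.refl ℂ M.V) fun _ _ => rfl⟩⟩⟩

namespace IsTwist

variable (h : H.IsTwist H' F)
include h

lemma comul_mul (a : A) : H'.comul a * F.val = F.val * H.comul a := by
  rw [h.comul_eq, Units.inv_mul_cancel_right]

lemma coassociator_mul : H'.Φ.val * (leg23 F.val * comulSnd H.comul F.val) =
    leg12 F.val * comulFst H.comul F.val * H.Φ.val := by
  have hcancel : comulSnd H.comul (F⁻¹).val * leg23 (F⁻¹).val *
      (leg23 F.val * comulSnd H.comul F.val) = 1 := by
    rw [mul_assoc, ← mul_assoc (leg23 _), ← map_mul leg23, F.inv_mul, map_one, one_mul,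
      ← map_mul, F.inv_mul, map_one]
  rw [h.coassociator_eq, mul_assoc _ _ (leg23 (F⁻¹).val), mul_assoc, hcancel, mul_one]

lemma inv_coassociator_mul :
    (H'.Φ⁻¹).val * (comulFst H'.comul F.val * leg12 F.val) =
      comulSnd H'.comul F.val * leg23 F.val * (H.Φ⁻¹).val := by
  rw [comulFst_mul_leg12 h.comul_mul, comulSnd_mul_leg23 h.comul_mul, Units.inv_mul_eq_iff_eq_mul,
    ← mul_assoc, h.coassociator_mul, Units.mul_inv_cancel_right]

section

variable {U V W : Type} [AddCommGroup U] [Module ℂ U] [AddCommGroup V] [Module ℂ V]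
  [AddCommGroup W] [Module ℂ W] (ρ : A →ₐ[ℂ] Module.End ℂ U) (σ : A →ₐ[ℂ] Module.End ℂ V)
  (τ : A →ₐ[ℂ] Module.End ℂ W)

lemma tensorAction_comulAction (a : A) (w : U ⊗[ℂ] V) :
    tensorAction ρ σ F.val (comulAction H.comul ρ σ a w) =
      comulAction H'.comul ρ σ a (tensorAction ρ σ F.val w) := by
  simp only [AlgHom.comp_apply, ← Module.End.mul_apply, ← map_mul, h.comul_mul]

lemma assocBy_tensorAction (w : (U ⊗[ℂ] V) ⊗[ℂ] W) :
    assocBy ρ σ τ (H'.Φ⁻¹).val (tensorAction (comulAction H'.comul ρ σ) τ F.val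
      (TensorProduct.map (tensorAction ρ σ F.val) LinearMap.id w)) =
    tensorAction ρ (comulAction H'.comul σ τ) F.val
      (TensorProduct.map LinearMap.id (tensorAction σ τ F.val)
        (assocBy ρ σ τ (H.Φ⁻¹).val w)) := by
  let T := tensorAction ρ (tensorAction σ τ)
  have hfst : TensorProduct.assoc ℂ U V W (tensorAction (comulAction H'.comul ρ σ) τ F.val
      (TensorProduct.map (tensorAction ρ σ F.val) LinearMap.id w)) =
      T (comulFst H'.comul F.val * leg12 F.val) (TensorProduct.assoc ℂ U V W w) := by
    rw [assoc_comulAction, assoc_map_tensorAction, map_mul]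
    rfl
  have hsnd : tensorAction ρ (comulAction H'.comul σ τ) F.val ∘ₗ
      TensorProduct.map LinearMap.id (tensorAction σ τ F.val) =
      T (comulSnd H'.comul F.val * leg23 F.val) := by
    rw [map_mul, tensorAction_comp_right, ← tensorAction_includeRight ρ (tensorAction σ τ)]
    rfl
  calc _ = T ((H'.Φ⁻¹).val * (comulFst H'.comul F.val * leg12 F.val))
        (TensorProduct.assoc ℂ U V W w) := by
        rw [map_mul, Module.End.mul_apply, ← hfst]; rfl
    _ = _ := by
        rw [h.inv_coassociator_mul, map_mul, Module.End.mul_apply, ← hsnd]; rfl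

end

/-- A twist makes the identity functor monoidal, the tensorator being the action of the twist. -/
def idFunctorMonoidal : (idFunctor H' H).CoreMonoidal where
  εIso := Rep.mkIso (M := Rep.unit H) (N := (idFunctor H' H).obj (Rep.unit H'))
    (LinearEquiv.refl ℂ ℂ) fun a v => by
      change counitAction H.counit a v = counitAction H'.counit a v
      rw [h.counit_eq]
  μIso M N := Rep.mkIso (M := Rep.tensor ((idFunctor H' H).obj M) ((idFunctor H' H).obj N))
    (N := (idFunctor H' H).obj (Rep.tensor M N)) (actionEquiv (tensorAction M.ρ N.ρ) F)
    (h.tensorAction_comulAction M.ρ N.ρ)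
  μIso_hom_natural_left {M N} f P := Rep.hom_ext <| LinearMap.ext fun w =>
    (map_tensorAction M.ρ P.ρ N.ρ P.ρ f.hom LinearMap.id f.comm (fun _ _ => rfl) F.val w).symm
  μIso_hom_natural_right {M N} P f := Rep.hom_ext <| LinearMap.ext fun w =>
    (map_tensorAction P.ρ M.ρ P.ρ N.ρ LinearMap.id f.hom (fun _ _ => rfl) f.comm F.val w).symm
  associativity M N P := Rep.hom_ext <| LinearMap.ext <| h.assocBy_tensorAction M.ρ N.ρ P.ρ
  left_unitality M := Rep.hom_ext <| LinearMap.ext fun w => by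
    change TensorProduct.lid ℂ M.V w = TensorProduct.lid ℂ M.V
      (tensorAction (counitAction H'.counit) M.ρ F.val
        (TensorProduct.map LinearMap.id LinearMap.id w))
    rw [h.counit_eq, lid_counitAction, h.counit_fst, map_one, TensorProduct.map_id]
    rfl
  right_unitality M := Rep.hom_ext <| LinearMap.ext fun w => by
    change TensorProduct.rid ℂ M.V w = TensorProduct.rid ℂ M.V
      (tensorAction M.ρ (counitAction H'.counit) F.val
        (TensorProduct.map LinearMap.id LinearMap.id w))
    rw [h.counit_eq, rid_counitAction, h.counit_snd, map_one, TensorProduct.map_id]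
    rfl

end IsTwist

end IdFunctor

namespace Iso

variable {A B : Type} [Ring A] [Algebra ℂ A] [Ring B] [Algebra ℂ B] {H : QuasiBialgebra A}
  {K : QuasiBialgebra B} (e : Iso H K)

lemma inv_coassociator_eq : (K.Φ⁻¹).val = Algebra.TensorProduct.map e.toAlgEquiv.toAlgHom
    (Algebra.TensorProduct.map e.toAlgEquiv.toAlgHom e.toAlgEquiv.toAlgHom) (H.Φ⁻¹).val :=
  Units.inv_eq_of_mul_eq_one_right (by
    rw [e.coassociator_eq, ← map_mul, Units.mul_inv, map_one])

/-- Restriction of representations along an isomorphism of quasi-bialgebras. -/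
def restrict : K.Rep ⥤ H.Rep where
  obj M := ⟨M.V, M.ρ.comp e.toAlgEquiv.toAlgHom⟩
  map f := ⟨f.hom, fun a v => f.comm (e.toAlgEquiv a) v⟩

instance : e.restrict.IsEquivalence where
  faithful := ⟨fun {M N} _ _ h => Rep.hom_ext
    (congrArg (fun f : e.restrict.obj M ⟶ e.restrict.obj N => Rep.Hom.hom f) h)⟩
  full := ⟨fun {M N} f => ⟨⟨f.hom, fun b v => by
    have h := f.comm (e.toAlgEquiv.symm b) v
    change f.hom (M.ρ (e.toAlgEquiv (e.toAlgEquiv.symm b)) v) =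
      N.ρ (e.toAlgEquiv (e.toAlgEquiv.symm b)) (f.hom v) at h
    rwa [AlgEquiv.apply_symm_apply] at h⟩, rfl⟩⟩
  essSurj := ⟨fun M => ⟨⟨M.V, M.ρ.comp e.toAlgEquiv.symm.toAlgHom⟩,
    ⟨Rep.mkIso (LinearEquiv.refl ℂ M.V) fun a v => by
      change M.ρ (e.toAlgEquiv.symm (e.toAlgEquiv a)) v = M.ρ a v
      rw [AlgEquiv.symm_apply_apply]⟩⟩⟩

lemma comulAction_comp {U V : Type} [AddCommGroup U] [Module ℂ U] [AddCommGroup V] [Module ℂ V]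
    (ρ : B →ₐ[ℂ] Module.End ℂ U) (σ : B →ₐ[ℂ] Module.End ℂ V) :
    (comulAction K.comul ρ σ).comp e.toAlgEquiv.toAlgHom =
      comulAction H.comul (ρ.comp e.toAlgEquiv.toAlgHom) (σ.comp e.toAlgEquiv.toAlgHom) :=
  AlgHom.ext fun a => (congrArg (tensorAction ρ σ) (e.comul_eq a)).trans
    (tensorAction_comp ρ σ _ (H.comul a)).symm

/-- Restriction along an isomorphism is monoidal, with identities as structure maps. -/
def restrictMonoidal : e.restrict.CoreMonoidal where
  εIso := Rep.mkIso (M := Rep.unit H) (N := e.restrict.obj (Rep.unit K))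
    (LinearEquiv.refl ℂ ℂ) fun a v => by
      change counitAction H.counit a v = counitAction K.counit (e.toAlgEquiv a) v
      simp only [AlgHom.comp_apply, e.counit_eq]
  μIso M N := Rep.mkIso (M := Rep.tensor (e.restrict.obj M) (e.restrict.obj N))
    (N := e.restrict.obj (Rep.tensor M N)) (LinearEquiv.refl ℂ (M.V ⊗[ℂ] N.V))
    fun a v => (LinearMap.congr_fun (AlgHom.congr_fun (e.comulAction_comp M.ρ N.ρ) a) v).symm
  μIso_hom_natural_left _ _ := rfl
  μIso_hom_natural_right _ _ := rfl
  associativity M N P := Rep.hom_ext <| LinearMap.ext fun w => by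
    change assocBy M.ρ N.ρ P.ρ (K.Φ⁻¹).val (TensorProduct.map LinearMap.id LinearMap.id w) =
      TensorProduct.map LinearMap.id LinearMap.id (assocBy _ _ _ (H.Φ⁻¹).val w)
    rw [TensorProduct.map_id, TensorProduct.map_id, e.inv_coassociator_eq, ← assocBy_comp]
    rfl
  left_unitality M := Rep.hom_ext <| LinearMap.ext fun w => by
    change TensorProduct.lid ℂ M.V w =
      TensorProduct.lid ℂ M.V (TensorProduct.map LinearMap.id LinearMap.id w)
    rw [TensorProduct.map_id]
    rfl
  right_unitality M := Rep.hom_ext <| LinearMap.ext fun w => by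
    change TensorProduct.rid ℂ M.V w =
      TensorProduct.rid ℂ M.V (TensorProduct.map LinearMap.id LinearMap.id w)
    rw [TensorProduct.map_id]
    rfl

end Iso

lemma IsTwistEquivalent.monoidallyEquivalent {A B : Type} [Ring A] [Algebra ℂ A] [Ring B]
    [Algebra ℂ B] {H : QuasiBialgebra A} {K : QuasiBialgebra B} (h : IsTwistEquivalent H K) :
    MonoidallyEquivalent K H := by
  obtain ⟨H', F, hF, ⟨e⟩⟩ := h
  let _ : e.restrict.Monoidal := e.restrictMonoidal.toMonoidal
  let _ : (idFunctor H' H).Monoidal := hF.idFunctorMonoidal.toMonoidal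
  exact ⟨e.restrict ⋙ idFunctor H' H, inferInstance, ⟨inferInstance⟩⟩

section Cohomology

variable {A : Type} [Ring A] [Bialgebra ℂ A] {Φ Ψ : A ⊗[ℂ] (A ⊗[ℂ] A)}

lemma isTwistEquivalent_of_cohomologous (hΦ : IsCoassociator Φ) (hΨ : IsCoassociator Ψ)
    (h : Cohomologous Φ Ψ) :
    IsTwistEquivalent (ofCoassociator A Φ hΦ) (ofCoassociator A Ψ hΨ) := by
  obtain ⟨F, hF, hΨF⟩ := h
  refine ⟨ofCoassociator A Ψ hΨ, F, ⟨hF.counit_fst, hF.counit_snd, rfl, fun a => ?_, hΨF⟩,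
    ⟨⟨AlgEquiv.refl, fun _ => rfl, fun a => ?_, ?_⟩⟩⟩
  · rw [Units.eq_mul_inv_iff_mul_eq]
    exact (hF.invariant a).symm
  · exact (AlgHom.congr_fun Algebra.TensorProduct.map_id _).symm
  · change _ = Algebra.TensorProduct.map (AlgHom.id ℂ A)
      (Algebra.TensorProduct.map (AlgHom.id ℂ A) (AlgHom.id ℂ A)) _
    rw [Algebra.TensorProduct.map_id, Algebra.TensorProduct.map_id, AlgHom.id_apply]

lemma isTwistEquivalent_of_H3_eq (hΦ : IsCoassociator Φ) (hΨ : IsCoassociator Ψ)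
    (h : H3.mk Φ hΦ = H3.mk Ψ hΨ) :
    IsTwistEquivalent (ofCoassociator A Φ hΦ) (ofCoassociator A Ψ hΨ) :=
  isTwistEquivalent_of_cohomologous hΦ hΨ (Quotient.exact h)

end Cohomology

end QuasiBialgebra

/-! ### Crossings in monoidal categories -/

section Crossings

open MonoidalCategory Functor.LaxMonoidal Functor.OplaxMonoidal Functor.Monoidal

universe v₁ v₂ u₁ u₂

lemma exists_eq_comp_of_preimage {C : Type u₁} [Category.{v₁} C] {D : Type u₂} [Category.{v₂} D]
    (F : C ⥤ D) [F.Full] [F.Faithful] {X M : C} {Y : D} (e : F.obj X ≅ Y)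
    {f g : Y ⟶ F.obj M} (h : ∃ s : X ⟶ X, F.preimage (e.hom ≫ g) = s ≫ F.preimage (e.hom ≫ f)) :
    ∃ s : Y ⟶ Y, g = s ≫ f := by
  obtain ⟨s, hs⟩ := h
  have hs : e.hom ≫ g = F.map s ≫ e.hom ≫ f := by
    simpa only [F.map_comp, F.map_preimage] using congrArg F.map hs
  exact ⟨e.inv ≫ F.map s ≫ e.hom, by
    rw [Category.assoc, Category.assoc, ← hs, e.inv_hom_id_assoc]⟩

variable {C : Type u₁} [Category.{v₁} C] [MonoidalCategory C] {D : Type u₂} [Category.{v₂} D]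
  [MonoidalCategory D]

/-- The object `X` is its own tensor inverse. -/
def SelfInverse (X : C) : Prop := Nonempty (X ⊗ X ≅ 𝟙_ C)

/-- Objects `M` and `T` with an augmentation `p : M ⟶ 𝟙` such that each of the induced morphisms
`M ⊗ T ⟶ T` and `T ⊗ M ⟶ T` has a unique section, where `T` receives no nonzero morphisms from
self-inverse objects and any two morphisms from a self-inverse object to `M` are comparable. All of
this is preserved by monoidal equivalences. -/
structure Crossing (C : Type u₁) [Category.{v₁} C] [MonoidalCategory C] where
  M : C
  T : C
  p : M ⟶ 𝟙_ C
  left : T ⟶ M ⊗ T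
  right : T ⟶ T ⊗ M
  left_p : left ≫ p ▷ T ≫ (λ_ T).hom = 𝟙 T
  right_p : right ≫ T ◁ p ≫ (ρ_ T).hom = 𝟙 T
  left_unique : ∀ s : T ⟶ M ⊗ T, s ≫ p ▷ T ≫ (λ_ T).hom = 𝟙 T → s = left
  right_unique : ∀ s : T ⟶ T ⊗ M, s ≫ T ◁ p ≫ (ρ_ T).hom = 𝟙 T → s = right
  comparable : ∀ X : C, SelfInverse X → ∀ f g : X ⟶ M,
    (∃ s : X ⟶ X, g = s ≫ f) ∨ (∃ s : X ⟶ X, f = s ≫ g)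
  subsingleton : ∀ X : C, SelfInverse X → Subsingleton (X ⟶ T)

/-- The two ways of adding a copy of `M` on both sides of `T` agree. -/
def Crossing.Commutes (c : Crossing C) : Prop :=
  c.left ≫ c.M ◁ c.right = c.right ≫ c.left ▷ c.M ≫ (α_ c.M c.T c.M).hom

variable (F : C ⥤ D) [F.Monoidal]

lemma SelfInverse.of_iso {X Y : C} (e : X ≅ Y) (h : SelfInverse X) : SelfInverse Y :=
  h.map fun f => (e.symm ⊗ᵢ e.symm) ≪≫ f

lemma SelfInverse.of_map [F.Full] [F.Faithful] {X : C} (h : SelfInverse (F.obj X)) :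
    SelfInverse X :=
  h.map fun f => F.preimageIso ((μIso F X X).symm ≪≫ f ≪≫ εIso F)

lemma SelfInverse.objPreimage [F.IsEquivalence] {X : D} (h : SelfInverse X) :
    SelfInverse (F.objPreimage X) :=
  (h.of_iso (F.objObjPreimageIso X).symm).of_map F

lemma map_left_section {M T : C} (p : M ⟶ 𝟙_ C) (s : T ⟶ M ⊗ T) :
    (F.map s ≫ δ F M T) ≫ (F.map p ≫ η F) ▷ F.obj T ≫ (λ_ (F.obj T)).hom =
      F.map (s ≫ p ▷ T ≫ (λ_ T).hom) := by
  simp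

lemma map_right_section {M T : C} (p : M ⟶ 𝟙_ C) (s : T ⟶ T ⊗ M) :
    (F.map s ≫ δ F T M) ≫ F.obj T ◁ (F.map p ≫ η F) ≫ (ρ_ (F.obj T)).hom =
      F.map (s ≫ T ◁ p ≫ (ρ_ T).hom) := by
  simp

lemma map_preimage_comp_δ [F.Full] {X Y Z : C} (s : F.obj X ⟶ F.obj Y ⊗ F.obj Z) :
    F.map (F.preimage (s ≫ μ F Y Z)) ≫ δ F Y Z = s := by
  rw [F.map_preimage, Category.assoc, μ_δ, Category.comp_id]

/-- The image of a crossing under a monoidal equivalence. -/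
def Crossing.map [F.IsEquivalence] (c : Crossing C) : Crossing D where
  M := F.obj c.M
  T := F.obj c.T
  p := F.map c.p ≫ η F
  left := F.map c.left ≫ δ F c.M c.T
  right := F.map c.right ≫ δ F c.T c.M
  left_p := by rw [map_left_section, c.left_p, F.map_id]
  right_p := by rw [map_right_section, c.right_p, F.map_id]
  left_unique s hs := by
    rw [← map_preimage_comp_δ F s, map_left_section, ← F.map_id] at hs
    rw [← map_preimage_comp_δ F s, c.left_unique _ (F.map_injective hs)]
  right_unique s hs := by
    rw [← map_preimage_comp_δ F s, map_right_section, ← F.map_id] at hs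
    rw [← map_preimage_comp_δ F s, c.right_unique _ (F.map_injective hs)]
  comparable X hX _ _ := (c.comparable _ (hX.objPreimage F) _ _).imp
    (exists_eq_comp_of_preimage F (F.objObjPreimageIso X))
    (exists_eq_comp_of_preimage F (F.objObjPreimageIso X))
  subsingleton X hX := by
    have := c.subsingleton _ (hX.objPreimage F)
    exact ((F.objObjPreimageIso X).homFromEquiv.symm.trans
      (.ofFullyFaithful F : F.FullyFaithful).homEquiv.symm).subsingleton

lemma Crossing.Commutes.of_map [F.IsEquivalence] {c : Crossing C} (h : (c.map F).Commutes) :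
    c.Commutes := by
  have h : (F.map c.left ≫ δ F c.M c.T) ≫ F.obj c.M ◁ (F.map c.right ≫ δ F c.T c.M) =
    (F.map c.right ≫ δ F c.T c.M) ≫ (F.map c.left ≫ δ F c.M c.T) ▷ F.obj c.M ≫
      (α_ (F.obj c.M) (F.obj c.T) (F.obj c.M)).hom := h
  refine F.map_injective ?_
  rw [← cancel_mono (δ F c.M (c.T ⊗ c.M) ≫ F.obj c.M ◁ δ F c.T c.M)]
  simpa using h

end Crossings

/-! ### Crossings of representations of `Q` -/

namespace Q

open Complex (I)
open QuasiBialgebra TensorProduct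

section Actions

variable {U V : Type} [AddCommGroup U] [Module ℂ U] [AddCommGroup V] [Module ℂ V]
  (ρ : Q →ₐ[ℂ] Module.End ℂ U) (σ : Q →ₐ[ℂ] Module.End ℂ V)

lemma act_act (a b : Q) (u : U) : ρ a (ρ b u) = ρ (a * b) u := by
  rw [map_mul, Module.End.mul_apply]

lemma act_E_E (u : U) : ρ E (ρ E u) = 0 := by
  rw [act_act, E_mul_E, map_zero, LinearMap.zero_apply]

lemma act_Y_Y (u : U) : ρ Y (ρ Y u) = 0 := by
  rw [act_act, Y_mul_Y, map_zero, LinearMap.zero_apply]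

lemma act_K_E (u : U) : ρ K (ρ E u) = -ρ E (ρ K u) := by
  rw [act_act, KE, map_neg, LinearMap.neg_apply, act_act]

lemma act_K_Y (u : U) : ρ K (ρ Y u) = -ρ Y (ρ K u) := by
  rw [act_act, K_mul_Y, map_neg, LinearMap.neg_apply, act_act]

lemma act_Y_E (u : U) : ρ Y (ρ E u) = I • ρ e1 u - ρ E (ρ Y u) := by
  rw [act_act, Y_mul_E, map_sub, map_smul, LinearMap.sub_apply, LinearMap.smul_apply, act_act]

lemma act_e0 (u : U) : ρ e0 u = (1 / 2 : ℂ) • (u + ρ K (ρ K u)) := by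
  simp [e0, pow_two]

lemma act_e1 (u : U) : ρ e1 u = (1 / 2 : ℂ) • (u - ρ K (ρ K u)) := by
  simp [e1, pow_two]

lemma act_F (u : U) : ρ F u = ρ Y (ρ K (ρ K (ρ K u))) := by
  rw [F_eq, act_act, act_act, act_act, pow_three, mul_assoc, mul_assoc]

lemma act_K_K_of_act_e0 {u : U} (hu : ρ e0 u = u) : ρ K (ρ K u) = u := by
  rw [act_e0] at hu
  linear_combination (norm := module) (2 : ℂ) • hu

lemma act_K_K_of_act_e1 {u : U} (hu : ρ e1 u = u) : ρ K (ρ K u) = -u := by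
  rw [act_e1] at hu
  linear_combination (norm := module) (-2 : ℂ) • hu

lemma act_e0_of_act_K {u : U} (hu : ρ K u = u) : ρ e0 u = u := by
  rw [act_e0, hu, hu]
  module

lemma act_e1_of_act_e0 {u : U} (hu : ρ e0 u = u) : ρ e1 u = 0 := by
  rw [← hu, act_act, e1_mul_e0, map_zero, LinearMap.zero_apply]

lemma act_e0_of_act_e1 {u : U} (hu : ρ e1 u = u) : ρ e0 u = 0 := by
  rw [← hu, act_act, e0_mul_e1, map_zero, LinearMap.zero_apply]

lemma act_e0_act {u : U} (hu : ρ e0 u = u) (a : Q) : ρ e0 (ρ a u) = ρ a u := by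
  rw [act_act, (commute_e0 a).eq, ← act_act, hu]

lemma act_Y_E_of_act_e0 {u : U} (hu : ρ e0 u = u) : ρ Y (ρ E u) = -ρ E (ρ Y u) := by
  rw [act_Y_E, act_e1_of_act_e0 ρ hu, smul_zero, zero_sub]

variable {ρ σ} in
lemma intertwines_of_generators (f : U →ₗ[ℂ] V) (hE : ∀ u, f (ρ E u) = σ E (f u))
    (hY : ∀ u, f (ρ Y u) = σ Y (f u)) (hK : ∀ u, f (ρ K u) = σ K (f u)) (a : Q) (u : U) :
    f (ρ a u) = σ a (f u) := by
  induction a using induction_Y generalizing u with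
  | hE => exact hE u
  | hY => exact hY u
  | hK => exact hK u
  | halg c => simp [Algebra.algebraMap_eq_smul_one]
  | hadd a b ha hb => simp [ha, hb]
  | hmul a b ha hb => simp [ha, hb]

lemma comulAction_E (u : U) (v : V) : comulAction comul ρ σ E (u ⊗ₜ v) =
    u ⊗ₜ σ E v + ρ E u ⊗ₜ σ K v := by
  rw [AlgHom.comp_apply, comul_E]
  simp

lemma comulAction_Y (u : U) (v : V) : comulAction comul ρ σ Y (u ⊗ₜ v) =
    u ⊗ₜ σ Y v + ρ Y u ⊗ₜ σ K v := by
  rw [AlgHom.comp_apply, comul_Y]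
  simp

lemma comulAction_K (u : U) (v : V) : comulAction comul ρ σ K (u ⊗ₜ v) = ρ K u ⊗ₜ σ K v := by
  rw [AlgHom.comp_apply, comul_K]
  simp

variable {ρ σ} in
lemma intertwines_tensor_of_generators {W : Type} [AddCommGroup W] [Module ℂ W]
    {τ : Q →ₐ[ℂ] Module.End ℂ W} (f : U ⊗[ℂ] V →ₗ[ℂ] W)
    (hE : ∀ u v, f (u ⊗ₜ σ E v + ρ E u ⊗ₜ σ K v) = τ E (f (u ⊗ₜ v)))
    (hY : ∀ u v, f (u ⊗ₜ σ Y v + ρ Y u ⊗ₜ σ K v) = τ Y (f (u ⊗ₜ v)))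
    (hK : ∀ u v, f (ρ K u ⊗ₜ σ K v) = τ K (f (u ⊗ₜ v))) (a : Q) (w : U ⊗[ℂ] V) :
    f (comulAction comul ρ σ a w) = τ a (f w) := by
  refine intertwines_of_generators f (fun w => ?_) (fun w => ?_) (fun w => ?_) a w <;>
  induction w with
  | zero => simp only [map_zero]
  | add p q hp hq => simp only [map_add, hp, hq]
  | tmul u v => simp only [comulAction_E, comulAction_Y, comulAction_K, hE, hY, hK]

end Actions

section Characters

/-- The character of `Q` with `E, F ↦ 0` and `K ↦ ε`. -/
def signCharacter (ε : ℂ) (hε : ε * ε = 1) : Q →ₐ[ℂ] ℂ :=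
  liftY 0 0 ε (by simp) (by simp) (by simp [hε]) (by simp) (by simp)
    (by linear_combination (ε * ε + 1) * hε)

variable {Ψ : Q ⊗[ℂ] (Q ⊗[ℂ] Q)} {h : IsCoassociator Ψ} {ε : ℂ} (hε : ε * ε = 1)

lemma signCharacter_E : signCharacter ε hε E = 0 := liftY_E

lemma signCharacter_Y : signCharacter ε hε Y = 0 := liftY_Y

lemma signCharacter_K : signCharacter ε hε K = ε := liftY_K

variable (h) in
/-- The one-dimensional representation with `E, F ↦ 0` and `K ↦ ε`. -/
abbrev signRep : (ofCoassociator Q Ψ h).Rep := ⟨ℂ, counitAction (signCharacter ε hε)⟩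

lemma selfInverse_signRep : SelfInverse (signRep h hε) :=
  ⟨QuasiBialgebra.Rep.mkIso (M := Rep.tensor (signRep h hε) (signRep h hε)) (N := Rep.unit _)
    (TensorProduct.lid ℂ ℂ) fun a v =>
    intertwines_tensor_of_generators (ρ := counitAction (signCharacter ε hε))
      (σ := counitAction (signCharacter ε hε)) (τ := counitAction counit)
      (TensorProduct.lid ℂ ℂ).toLinearMap (by simp [Algebra.ofId_apply, signCharacter_E])
      (by simp [Algebra.ofId_apply, counit_Y, signCharacter_Y]) (fun u v => by
        simp only [AlgHom.comp_apply, signCharacter_K, counit_K, Algebra.ofId_apply,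
          Module.algebraMap_end_apply, LinearEquiv.coe_coe, TensorProduct.lid_tmul, smul_eq_mul]
        linear_combination u * v * hε) a v⟩

/-- A joint eigenvector of the generators as a morphism from a one-dimensional representation. -/
def eigenvectorHom {M : (ofCoassociator Q Ψ h).Rep} (v : M.V) (hE : M.ρ E v = 0) (hY : M.ρ Y v = 0)
    (hK : M.ρ K v = ε • v) : signRep h hε ⟶ M :=
  ⟨LinearMap.toSpanSingleton ℂ M.V v, intertwines_of_generators _
    (fun u => by simp [hE, Algebra.ofId_apply, signCharacter_E])
    (fun u => by simp [hY, Algebra.ofId_apply, signCharacter_Y])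
    (fun u => by simp [hK, Algebra.ofId_apply, signCharacter_K, mul_smul, smul_comm ε])⟩

lemma eigenvectorHom_one {M : (ofCoassociator Q Ψ h).Rep} (v : M.V) (hE : M.ρ E v = 0)
    (hY : M.ρ Y v = 0) (hK : M.ρ K v = ε • v) :
    (eigenvectorHom hε v hE hY hK).hom (1 : ℂ) = v :=
  one_smul ℂ v

lemma exists_smul_of_eq_comp {M : (ofCoassociator Q Ψ h).Rep} {f g : signRep h hε ⟶ M}
    (hfg : ∃ s : signRep h hε ⟶ signRep h hε, g = s ≫ f) :
    ∃ a : ℂ, g.hom (1 : ℂ) = a • f.hom (1 : ℂ) := by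
  obtain ⟨s, rfl⟩ := hfg
  refine ⟨s.hom (1 : ℂ), ?_⟩
  calc f.hom (s.hom (1 : ℂ)) = f.hom (s.hom (1 : ℂ) • (1 : ℂ)) := by rw [smul_eq_mul, mul_one]
    _ = s.hom (1 : ℂ) • f.hom (1 : ℂ) := map_smul _ _ _

end Characters

end Q

namespace Q

open Complex (I)
open QuasiBialgebra
open TensorProduct (tmul_neg neg_tmul zero_tmul tmul_zero tmul_sub sub_tmul tmul_add add_tmul
  tmul_smul smul_tmul' map_tmul)

variable {M T : Type} [AddCommGroup M] [Module ℂ M] [AddCommGroup T] [Module ℂ T]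

section Sections

variable (ρ : Q →ₐ[ℂ] Module.End ℂ M) (σ : Q →ₐ[ℂ] Module.End ℂ T) (m : M)

/-- The section `t ↦ m ⊗ t - i (Y m ⊗ K E t + E m ⊗ K Y t)` of `M ⊗ T → T` determined by a
`K`-invariant vector `m` of an augmented representation `M`. -/
def leftSection : T →ₗ[ℂ] M ⊗[ℂ] T :=
  TensorProduct.mk ℂ M T m - I • (TensorProduct.mk ℂ M T (ρ Y m) ∘ₗ σ K ∘ₗ σ E +
    TensorProduct.mk ℂ M T (ρ E m) ∘ₗ σ K ∘ₗ σ Y)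

/-- The section `t ↦ t ⊗ m - i (E t ⊗ Y m + Y t ⊗ E m)` of `T ⊗ M → T` determined by a
`K`-invariant vector `m` of an augmented representation `M`. -/
def rightSection : T →ₗ[ℂ] T ⊗[ℂ] M :=
  (TensorProduct.mk ℂ T M).flip m - I • ((TensorProduct.mk ℂ T M).flip (ρ Y m) ∘ₗ σ E +
    (TensorProduct.mk ℂ T M).flip (ρ E m) ∘ₗ σ Y)

lemma leftSection_apply (t : T) : leftSection ρ σ m t =
    m ⊗ₜ t - I • (ρ Y m ⊗ₜ σ K (σ E t) + ρ E m ⊗ₜ σ K (σ Y t)) := rfl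

lemma rightSection_apply (t : T) : rightSection ρ σ m t =
    t ⊗ₜ m - I • (σ E t ⊗ₜ ρ Y m + σ Y t ⊗ₜ ρ E m) := rfl

end Sections

variable {ρ : Q →ₐ[ℂ] Module.End ℂ M} {σ : Q →ₐ[ℂ] Module.End ℂ T} {m : M}

lemma act_Y_E_eq_zero (hK : ρ K m = m) (hEY : ρ E (ρ Y m) = 0) : ρ Y (ρ E m) = 0 := by
  rw [act_Y_E_of_act_e0 ρ (act_e0_of_act_K ρ hK), hEY, neg_zero]

lemma leftSection_intertwines (hK : ρ K m = m) (hEY : ρ E (ρ Y m) = 0) (hσ : ∀ t, σ e1 t = t)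
    (a : Q) (t : T) :
    leftSection ρ σ m (σ a t) = comulAction comul ρ σ a (leftSection ρ σ m t) := by
  have hYE := act_Y_E_eq_zero hK hEY
  have hKK := fun t => act_K_K_of_act_e1 σ (hσ t)
  refine intertwines_of_generators _ (fun t => ?_) (fun t => ?_) (fun t => ?_) a t
  · simp only [leftSection_apply, map_sub, map_smul, map_add, comulAction_E, act_K_E, act_E_E,
      hEY, act_K_Y, act_Y_E, hσ, tmul_neg, zero_tmul, map_neg, map_zero, tmul_zero, tmul_sub,
      tmul_smul]
    match_scalars <;> simp
  · simp only [leftSection_apply, map_sub, map_smul, map_add, comulAction_Y, act_K_E, act_Y_Y,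
      hYE, act_K_Y, act_Y_E, hσ, tmul_neg, zero_tmul, map_neg, map_zero, tmul_zero, tmul_sub,
      tmul_smul]
    match_scalars <;> simp
  · simp only [leftSection_apply, map_sub, map_smul, map_add, comulAction_K, act_K_E, hK, act_K_Y,
      hKK, tmul_neg, neg_tmul, map_neg, neg_neg]

lemma rightSection_intertwines (hK : ρ K m = m) (hEY : ρ E (ρ Y m) = 0) (hσ : ∀ t, σ e1 t = t)
    (a : Q) (t : T) :
    rightSection ρ σ m (σ a t) = comulAction comul σ ρ a (rightSection ρ σ m t) := by
  have hYE := act_Y_E_eq_zero hK hEY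
  refine intertwines_of_generators _ (fun t => ?_) (fun t => ?_) (fun t => ?_) a t
  · simp only [rightSection_apply, map_sub, map_smul, map_add, comulAction_E, act_K_E, act_E_E,
      hEY, hK, act_K_Y, act_Y_E, hσ, tmul_neg, zero_tmul, tmul_zero, sub_tmul, ← smul_tmul']
    match_scalars <;> simp
  · simp only [rightSection_apply, map_sub, map_smul, map_add, comulAction_Y, act_K_E, act_Y_Y,
      hYE, hK, act_K_Y, act_Y_E, hσ, tmul_neg, zero_tmul, tmul_zero, sub_tmul, ← smul_tmul']
    match_scalars <;> simp
  · simp only [rightSection_apply, map_sub, map_smul, map_add, comulAction_K, act_K_E, hK, act_K_Y,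
      tmul_neg, neg_tmul, neg_neg]

lemma assoc_map_leftSection_rightSection (hσ : ∀ t, σ e1 t = t) (t : T) :
    TensorProduct.assoc ℂ M T M (TensorProduct.map (leftSection ρ σ m) LinearMap.id
      (rightSection ρ σ m t)) =
    TensorProduct.map LinearMap.id (rightSection ρ σ m) (leftSection ρ σ m t) -
      I • (ρ E m ⊗ₜ (σ K t ⊗ₜ ρ Y m) + ρ Y m ⊗ₜ (σ K t ⊗ₜ ρ E m)) := by
  simp only [leftSection_apply, rightSection_apply, map_sub, map_smul, map_add, act_K_E, act_Y_E,
    act_K_Y, hσ, act_E_E, act_Y_Y, map_tmul, LinearMap.id_coe, id_eq, TensorProduct.assoc_tmul,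
    tmul_sub, tmul_add, sub_tmul, add_tmul, tmul_smul, map_neg, tmul_neg, neg_tmul, map_zero,
    tmul_zero, zero_tmul, ← smul_tmul']
  match_scalars <;> simp

lemma tensorAction_Φ (β : ℂ) {u v : M} {t : T} (hu : ρ e0 u = u) (ht : σ e1 t = t)
    (hv : ρ e0 v = v) : tensorAction ρ (tensorAction σ ρ) (Φ β) (u ⊗ₜ (t ⊗ₜ v)) =
      u ⊗ₜ (t ⊗ₜ v) - (1 + I) • ρ E u ⊗ₜ (σ K t ⊗ₜ ρ F v) +
        (1 - I) • ρ F (ρ K u) ⊗ₜ (σ K t ⊗ₜ ρ E (ρ K v)) +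
        (2 : ℂ) • ρ E (ρ F (ρ K u)) ⊗ₜ (t ⊗ₜ ρ E (ρ F (ρ K v))) := by
  simp [Φ, Φ010, hu, hv, ht, act_e1_of_act_e0 ρ hu, act_e1_of_act_e0 ρ hv, act_e0_of_act_e1 σ ht]

lemma tensorAction_Φ_sections (β : ℂ) (hK : ρ K m = m) (hEY : ρ E (ρ Y m) = 0)
    (hσ : ∀ t, σ e1 t = t) (t : T) :
    tensorAction ρ (tensorAction σ ρ) (Φ β)
      (TensorProduct.map LinearMap.id (rightSection ρ σ m) (leftSection ρ σ m t)) =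
    TensorProduct.map LinearMap.id (rightSection ρ σ m) (leftSection ρ σ m t) -
      (1 + I) • ρ E m ⊗ₜ (σ K t ⊗ₜ ρ Y m) + (1 - I) • ρ Y m ⊗ₜ (σ K t ⊗ₜ ρ E m) := by
  have hYE := act_Y_E_eq_zero hK hEY
  have h0 : ρ e0 m = m := act_e0_of_act_K ρ hK
  have hE := act_e0_act ρ h0 E
  have hY := act_e0_act ρ h0 Y
  simp only [leftSection_apply, rightSection_apply, map_sub, map_smul, map_add, map_tmul,
    LinearMap.id_coe, id_eq, tmul_sub, tmul_add, tmul_smul, tensorAction_Φ, hσ, h0, hE, hY]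
  simp only [act_F, act_K_E, act_K_Y, hK, map_neg, neg_neg, hEY, hYE, act_E_E, act_Y_Y,
    zero_tmul, tmul_zero, smul_zero, sub_zero, add_zero, neg_zero, map_zero]
  module

/-- The two composites of sections differ by multiples of `E m ⊗ K t ⊗ Y m` and
`Y m ⊗ K t ⊗ E m`, which are interchangeable when `E m` and `Y m` are proportional. -/
lemma sections_commute (β : ℂ) (hK : ρ K m = m) (hEY : ρ E (ρ Y m) = 0)
    (hσ : ∀ t, σ e1 t = t) {n : M} {a b : ℂ} (ha : ρ E m = a • n) (hb : ρ Y m = b • n) (t : T) :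
    TensorProduct.assoc ℂ M T M (TensorProduct.map (leftSection ρ σ m) LinearMap.id
      (rightSection ρ σ m t)) = tensorAction ρ (tensorAction σ ρ) (Φ β)
        (TensorProduct.map LinearMap.id (rightSection ρ σ m) (leftSection ρ σ m t)) := by
  rw [assoc_map_leftSection_rightSection hσ, tensorAction_Φ_sections β hK hEY hσ, ha, hb]
  simp only [tmul_smul, ← smul_tmul']
  module

lemma eq_zero_of_act_K_K (h : ∀ ε : ℂ, ε * ε = 1 → ∀ t, σ E t = 0 → σ Y t = 0 →
    σ K t = ε • t → t = 0) {t : T} (hE : σ E t = 0) (hY : σ Y t = 0) (hK : σ K (σ K t) = t) :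
    t = 0 := by
  have hEK : σ E (σ K t) = 0 := by rw [← neg_eq_iff_eq_neg.2 (act_K_E σ t), hE, map_zero, neg_zero]
  have hYK : σ Y (σ K t) = 0 := by rw [← neg_eq_iff_eq_neg.2 (act_K_Y σ t), hY, map_zero, neg_zero]
  have hadd : t + σ K t = 0 := h 1 (by norm_num) _ (by rw [map_add, hE, hEK, add_zero])
    (by rw [map_add, hY, hYK, add_zero]) (by rw [map_add, hK]; module)
  have hsub : t - σ K t = 0 := h (-1) (by norm_num) _ (by rw [map_sub, hE, hEK, sub_zero])
    (by rw [map_sub, hY, hYK, sub_zero]) (by rw [map_sub, hK]; module)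
  linear_combination (norm := module) (1 / 2 : ℂ) • hadd + (1 / 2 : ℂ) • hsub

/-- On the image of `e₀` the elements `E` and `Y` anticommute, so a nonzero vector `u` there yields
a nonzero vector killed by both: the last nonzero one among `u`, `E u` or `Y u`, and `E Y u`. -/
lemma act_e0_eq_zero (h : ∀ ε : ℂ, ε * ε = 1 → ∀ t, σ E t = 0 → σ Y t = 0 → σ K t = ε • t → t = 0)
    (t : T) : σ e0 t = 0 := by
  set u := σ e0 t
  have hu : σ e0 u = u := by rw [act_act, e0_mul_e0]
  have hE := act_e0_act σ hu E
  have hY := act_e0_act σ hu Y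
  have hEYu : σ E (σ Y u) = 0 := eq_zero_of_act_K_K h (act_E_E _ _)
    (by rw [act_Y_E_of_act_e0 σ hY, act_Y_Y, map_zero, neg_zero])
    (act_K_K_of_act_e0 σ (act_e0_act σ hY E))
  have hYu : σ Y u = 0 := eq_zero_of_act_K_K h hEYu (act_Y_Y _ _) (act_K_K_of_act_e0 σ hY)
  have hEu : σ E u = 0 := eq_zero_of_act_K_K h (act_E_E _ _)
    (by rw [act_Y_E_of_act_e0 σ hu, hEYu, neg_zero]) (act_K_K_of_act_e0 σ hE)
  exact eq_zero_of_act_K_K h hEu hYu (act_K_K_of_act_e0 σ hu)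

end Q

open Complex (I)
open Q

lemma QuasiBialgebra.Rep.congr_hom {A : Type} [Ring A] [Algebra ℂ A] {H : QuasiBialgebra A}
    {M N : H.Rep} {f g : M ⟶ N} (h : f = g) (v : M.V) : f.hom v = g.hom v := by
  rw [h]

lemma eq_zero_of_tmul_eq_zero {V W : Type} [AddCommGroup V] [Module ℂ V] [AddCommGroup W]
    [Module ℂ W] {v : V} {w : W} (h : v ⊗ₜ[ℂ] w = 0) (hw : w ≠ 0) : v = 0 := by
  rw [← Module.forall_dual_apply_eq_zero_iff ℂ v]
  intro φ
  have hφ : φ v • w = 0 := by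
    simpa using congrArg (TensorProduct.lid ℂ W ∘ TensorProduct.map φ LinearMap.id) h
  exact (smul_eq_zero.1 hφ).resolve_right hw

namespace Crossing

section

variable {Ψ : Q ⊗[ℂ] (Q ⊗[ℂ] Q)} {h : IsCoassociator Ψ}
  (c : Crossing (QuasiBialgebra.ofCoassociator Q Ψ h).Rep)

lemma lid_left (t : c.T.V) :
    TensorProduct.lid ℂ c.T.V (TensorProduct.map c.p.hom LinearMap.id (c.left.hom t)) = t :=
  QuasiBialgebra.Rep.congr_hom c.left_p t

lemma left_eq (s : c.T.V →ₗ[ℂ] c.M.V ⊗[ℂ] c.T.V)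
    (hs : ∀ a t, s (c.T.ρ a t) = comulAction comul c.M.ρ c.T.ρ a (s t))
    (hp : ∀ t, TensorProduct.lid ℂ c.T.V (TensorProduct.map c.p.hom LinearMap.id (s t)) = t) :
    c.left.hom = s :=
  LinearMap.ext fun t => (QuasiBialgebra.Rep.congr_hom
    (c.left_unique ⟨s, hs⟩ (QuasiBialgebra.Rep.hom_ext (LinearMap.ext hp))) t).symm

lemma right_eq (s : c.T.V →ₗ[ℂ] c.T.V ⊗[ℂ] c.M.V)
    (hs : ∀ a t, s (c.T.ρ a t) = comulAction comul c.T.ρ c.M.ρ a (s t))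
    (hp : ∀ t, TensorProduct.rid ℂ c.T.V (TensorProduct.map LinearMap.id c.p.hom (s t)) = t) :
    c.right.hom = s :=
  LinearMap.ext fun t => (QuasiBialgebra.Rep.congr_hom
    (c.right_unique ⟨s, hs⟩ (QuasiBialgebra.Rep.hom_ext (LinearMap.ext hp))) t).symm

lemma eq_zero_of_eigenvector {ε : ℂ} (hε : ε * ε = 1) (t : c.T.V) (hE : c.T.ρ E t = 0)
    (hY : c.T.ρ Y t = 0) (hK : c.T.ρ K t = ε • t) : t = 0 := by
  have := c.subsingleton _ (selfInverse_signRep (h := h) hε)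
  have hom_eq : eigenvectorHom hε t hE hY hK =
      eigenvectorHom hε 0 (map_zero _) (map_zero _) (by rw [map_zero, smul_zero]) :=
    Subsingleton.elim _ _
  rw [← eigenvectorHom_one hε t hE hY hK, hom_eq, eigenvectorHom_one]

lemma act_e1 (t : c.T.V) : c.T.ρ e1 t = t := by
  have he0 := act_e0_eq_zero (σ := c.T.ρ) (fun _ hε t => c.eq_zero_of_eigenvector hε t) t
  calc c.T.ρ e1 t = c.T.ρ (e0 + e1) t := by rw [map_add, LinearMap.add_apply, he0, zero_add]
    _ = t := by rw [e0_add_e1, map_one, Module.End.one_apply]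

lemma exists_smul {ε : ℂ} (hε : ε * ε = 1) {u v : c.M.V} (hEu : c.M.ρ E u = 0)
    (hYu : c.M.ρ Y u = 0) (hKu : c.M.ρ K u = ε • u) (hEv : c.M.ρ E v = 0)
    (hYv : c.M.ρ Y v = 0) (hKv : c.M.ρ K v = ε • v) :
    ∃ (n : c.M.V) (a b : ℂ), u = a • n ∧ v = b • n := by
  have hu := eigenvectorHom_one hε u hEu hYu hKu
  have hv := eigenvectorHom_one hε v hEv hYv hKv
  rcases c.comparable _ (selfInverse_signRep (h := h) hε) (eigenvectorHom hε u hEu hYu hKu)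
    (eigenvectorHom hε v hEv hYv hKv) with hs | hs
  · obtain ⟨b, hb⟩ := exists_smul_of_eq_comp hε hs
    exact ⟨u, 1, b, (one_smul _ _).symm, by rw [← hv, hb, hu]⟩
  · obtain ⟨a, ha⟩ := exists_smul_of_eq_comp hε hs
    exact ⟨v, a, 1, by rw [← hu, ha, hv], (one_smul _ _).symm⟩

lemma p_act (a : Q) (m : c.M.V) : c.p.hom (c.M.ρ a m) = counit a * c.p.hom m :=
  c.p.comm a m

lemma exists_p_ne_zero {t : c.T.V} (ht : t ≠ 0) : ∃ m : c.M.V, c.p.hom m ≠ (0 : ℂ) := by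
  by_contra! hp
  have hp : c.p.hom = 0 := LinearMap.ext hp
  refine ht ?_
  rw [← c.lid_left t, hp, TensorProduct.map_zero_left, LinearMap.zero_apply, map_zero]

lemma exists_act_K_eq_self {t : c.T.V} (ht : t ≠ 0) :
    ∃ m : c.M.V, c.M.ρ K m = m ∧ c.p.hom m = (1 : ℂ) := by
  obtain ⟨m, hm⟩ := c.exists_p_ne_zero ht
  let average : Q := 1 + K + K ^ 2 + K ^ 3
  have K_mul_average : K * average = average := by
    simp only [average, mul_add, mul_one, ← pow_two, ← pow_succ', Nat.reduceAdd, KK]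
    abel
  have counit_average : counit average = 4 := by
    simp only [average, map_add, map_one, map_pow, counit_K]
    norm_num
  let z : ℂ := c.p.hom m
  refine ⟨(z⁻¹ / 4) • c.M.ρ average m, by rw [map_smul, act_act, K_mul_average], ?_⟩
  rw [map_smul, c.p_act, counit_average]
  change z⁻¹ / 4 * (4 * z) = 1
  have hz : z ≠ 0 := hm
  field_simp

lemma eq_zero_of_invariant {t₀ : c.T.V} (ht₀ : t₀ ≠ 0) {w : c.M.V} (hE : c.M.ρ E w = 0)
    (hY : c.M.ρ Y w = 0) (hK : c.M.ρ K w = w) (hp : c.p.hom w = (0 : ℂ)) : w = 0 := by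
  have mk_intertwines : ∀ a t, w ⊗ₜ[ℂ] c.T.ρ a t = comulAction comul c.M.ρ c.T.ρ a (w ⊗ₜ t) :=
    intertwines_of_generators (TensorProduct.mk ℂ c.M.V c.T.V w)
      (fun t => by simp [comulAction_E, hE, -AlgHom.coe_comp])
      (fun t => by simp [comulAction_Y, hY, -AlgHom.coe_comp])
      (fun t => by simp [comulAction_K, hK, -AlgHom.coe_comp])
  have left_eq_add : c.left.hom = c.left.hom + TensorProduct.mk ℂ c.M.V c.T.V w :=
    c.left_eq _
      (fun a t => by
        rw [LinearMap.add_apply, LinearMap.add_apply, map_add]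
        exact congrArg₂ (· + ·) (c.left.comm a t) (mk_intertwines a t))
      (fun t => by
        rw [LinearMap.add_apply, map_add, map_add, c.lid_left, TensorProduct.mk_apply,
          TensorProduct.map_tmul, hp, TensorProduct.zero_tmul, map_zero, add_zero])
  exact eq_zero_of_tmul_eq_zero (add_eq_left.1 (LinearMap.congr_fun left_eq_add t₀).symm) ht₀

/-- The vector `E Y m` is invariant and in the kernel of `p`, so uniqueness of the left section
kills it. -/
lemma exists_seed {t₀ : c.T.V} (ht₀ : t₀ ≠ 0) :
    ∃ m : c.M.V, c.M.ρ K m = m ∧ c.M.ρ E (c.M.ρ Y m) = 0 ∧ c.p.hom m = (1 : ℂ) := by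
  obtain ⟨m, hK, hp⟩ := c.exists_act_K_eq_self ht₀
  have he0 := act_e0_act c.M.ρ (act_e0_of_act_K _ hK) Y
  refine ⟨m, hK, c.eq_zero_of_invariant ht₀ (act_E_E _ _) ?_ ?_ ?_, hp⟩
  · rw [act_Y_E_of_act_e0 _ he0, act_Y_Y, map_zero, neg_zero]
  · rw [act_K_E, act_K_Y, map_neg, neg_neg, hK]
  · rw [c.p_act, counit_E, zero_mul]

end

theorem commutes {β : ℂ} {h : IsCoassociator (Φ β)}
    (c : Crossing (QuasiBialgebra.ofCoassociator Q (Φ β) h).Rep) : c.Commutes := by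
  refine QuasiBialgebra.Rep.hom_ext (LinearMap.ext fun t => ?_)
  change TensorProduct.map LinearMap.id c.right.hom (c.left.hom t) =
    assocBy c.M.ρ c.T.ρ c.M.ρ (h.isUnit.unit⁻¹).val
      (TensorProduct.map c.left.hom LinearMap.id (c.right.hom t))
  by_cases ht : t = 0
  · simp only [ht, map_zero]
  obtain ⟨m, hK, hEY, hp⟩ := c.exists_seed ht
  have hYE := act_Y_E_eq_zero hK hEY
  obtain ⟨n, a, b, ha, hb⟩ := c.exists_smul (ε := -1) (by norm_num)
    (act_E_E _ m) hYE (by rw [act_K_E, hK, neg_one_smul])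
    hEY (act_Y_Y _ m) (by rw [act_K_Y, hK, neg_one_smul])
  have hpE : c.p.hom (c.M.ρ E m) = (0 : ℂ) := by rw [c.p_act, counit_E, zero_mul]
  have hpY : c.p.hom (c.M.ρ Y m) = (0 : ℂ) := by rw [c.p_act, counit_Y, zero_mul]
  have hleft := c.left_eq (leftSection c.M.ρ c.T.ρ m) (leftSection_intertwines hK hEY c.act_e1)
    (fun t => by simp [leftSection_apply, hp, hpE, hpY])
  have hright := c.right_eq (rightSection c.M.ρ c.T.ρ m)
    (rightSection_intertwines hK hEY c.act_e1)
    (fun t => by simp [rightSection_apply, hp, hpE, hpY])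
  rw [hleft, hright, assocBy, LinearMap.comp_apply, LinearEquiv.coe_coe,
    sections_commute β hK hEY c.act_e1 ha hb t, ← Module.End.mul_apply, ← map_mul,
    IsUnit.val_inv_mul, map_one, Module.End.one_apply]

end Crossing

/-! ### The standard crossing -/

section SelfInverse

variable {Ψ : Q ⊗[ℂ] (Q ⊗[ℂ] Q)} {h : IsCoassociator Ψ}
  {X M : (QuasiBialgebra.ofCoassociator Q Ψ h).Rep}

lemma SelfInverse.finrank_eq_one (hX : SelfInverse X) : Module.finrank ℂ X.V = 1 := by
  obtain ⟨e⟩ := hX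
  let square : X.V ⊗[ℂ] X.V ≃ₗ[ℂ] ℂ := LinearEquiv.ofLinearMap e.hom.hom e.inv.hom
    (LinearMap.ext (QuasiBialgebra.Rep.congr_hom e.inv_hom_id))
    (LinearMap.ext (QuasiBialgebra.Rep.congr_hom e.hom_inv_id))
  have hsquare := square.finrank_eq
  rw [Module.finrank_tensorProduct, Module.finrank_self] at hsquare
  exact Nat.eq_one_of_mul_eq_one_right hsquare

lemma SelfInverse.exists_generator (hX : SelfInverse X) :
    ∃ v : X.V, (∀ w, ∃ c : ℂ, c • v = w) ∧ X.ρ E v = 0 ∧ X.ρ Y v = 0 := by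
  obtain ⟨v, hv, hspan⟩ := finrank_eq_one_iff'.1 hX.finrank_eq_one
  have eq_zero_of_sq : ∀ f : Module.End ℂ X.V, f (f v) = 0 → f v = 0 := by
    intro f hf
    obtain ⟨c, hc⟩ := hspan (f v)
    rw [← hc, map_smul, ← hc, smul_smul, smul_eq_zero, or_iff_left hv, mul_self_eq_zero] at hf
    rw [← hc, hf, zero_smul]
  exact ⟨v, hspan, eq_zero_of_sq _ (act_E_E _ _), eq_zero_of_sq _ (act_Y_Y _ _)⟩

lemma hom_ext_of_generator {v : X.V} (hspan : ∀ w, ∃ c : ℂ, c • v = w) {f g : X ⟶ M}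
    (hfg : f.hom v = g.hom v) : f = g := by
  refine QuasiBialgebra.Rep.hom_ext (LinearMap.ext fun w => ?_)
  obtain ⟨c, rfl⟩ := hspan w
  rw [map_smul, map_smul, hfg]

lemma exists_eq_comp_of_generator {v : X.V} (hspan : ∀ w, ∃ c : ℂ, c • v = w) {f g : X ⟶ M} {c : ℂ}
    (hfg : g.hom v = c • f.hom v) : ∃ s : X ⟶ X, g = s ≫ f :=
  ⟨⟨c • LinearMap.id, fun a w => by simp⟩,
    hom_ext_of_generator hspan (hfg.trans (map_smul f.hom c v).symm)⟩

end SelfInverse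

namespace Q

/-- The two-dimensional representation with basis `m, n` such that `E m = Y m = n`, `E n = Y n = 0`,
`K m = m` and `K n = -n`. -/
def augmented : Q →ₐ[ℂ] Module.End ℂ (Fin 2 → ℂ) :=
  (Matrix.toLinAlgEquiv' (R := ℂ) (n := Fin 2)).toAlgHom.comp
    (liftY !![0, 0; 1, 0] !![0, 0; 1, 0] !![1, 0; 0, -1] (by simp) (by simp)
      (by ext i j; fin_cases i <;> fin_cases j <;> simp)
      (by ext i j; fin_cases i <;> fin_cases j <;> simp)
      (by ext i j; fin_cases i <;> fin_cases j <;> simp) (by simp [pow_succ, Matrix.one_fin_two]))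

lemma augmented_E (v : Fin 2 → ℂ) : augmented E v = ![0, v 0] := by
  ext i
  fin_cases i <;> simp [augmented, liftY_E, Matrix.mulVec, Matrix.vecHead, Matrix.vecTail]

lemma augmented_Y (v : Fin 2 → ℂ) : augmented Y v = ![0, v 0] := by
  ext i
  fin_cases i <;> simp [augmented, liftY_Y, Matrix.mulVec, Matrix.vecHead, Matrix.vecTail]

lemma augmented_K (v : Fin 2 → ℂ) : augmented K v = ![v 0, -v 1] := by
  ext i
  fin_cases i <;> simp [augmented, liftY_K, Matrix.mulVec, Matrix.vecHead, Matrix.vecTail]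

/-- The two-dimensional simple representation with `K = diag(i, -i)`. -/
def simpleTwo : Q →ₐ[ℂ] Module.End ℂ (Fin 2 → ℂ) :=
  (Matrix.toLinAlgEquiv' (R := ℂ) (n := Fin 2)).toAlgHom.comp
    (liftY !![0, 1; 0, 0] !![0, 0; I, 0] !![I, 0; 0, -I] (by simp) (by simp)
      (by ext i j; fin_cases i <;> fin_cases j <;> norm_num)
      (by ext i j; fin_cases i <;> fin_cases j <;> simp)
      (by ext i j; fin_cases i <;> fin_cases j <;> simp) (by simp [pow_succ, Matrix.one_fin_two]))

lemma simpleTwo_E (v : Fin 2 → ℂ) : simpleTwo E v = ![v 1, 0] := by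
  ext i
  fin_cases i <;> simp [simpleTwo, liftY_E, Matrix.mulVec, Matrix.vecHead, Matrix.vecTail]

lemma simpleTwo_Y (v : Fin 2 → ℂ) : simpleTwo Y v = ![0, I * v 0] := by
  ext i
  fin_cases i <;> simp [simpleTwo, liftY_Y, Matrix.mulVec, Matrix.vecHead, Matrix.vecTail]

lemma simpleTwo_K (v : Fin 2 → ℂ) : simpleTwo K v = ![I * v 0, -(I * v 1)] := by
  ext i
  fin_cases i <;> simp [simpleTwo, liftY_K, Matrix.mulVec, Matrix.vecHead, Matrix.vecTail]

lemma simpleTwo_K_K (t : Fin 2 → ℂ) : simpleTwo K (simpleTwo K t) = -t := by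
  ext i
  fin_cases i <;> simp [simpleTwo_K, ← mul_assoc]

lemma simpleTwo_e1 (t : Fin 2 → ℂ) : simpleTwo e1 t = t := by
  rw [act_e1, simpleTwo_K_K]
  module

lemma simpleTwo_commutator (t : Fin 2 → ℂ) :
    simpleTwo E (simpleTwo Y t) - simpleTwo Y (simpleTwo E t) = simpleTwo K t := by
  ext i
  fin_cases i <;> simp [simpleTwo_K, simpleTwo_E, simpleTwo_Y]

/-- The vector `m` of `augmented`. -/
def seed : Fin 2 → ℂ := ![1, 0]

/-- The vector `n = E m` of `augmented`. -/
def odd : Fin 2 → ℂ := ![0, 1]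

/-- The coordinates with respect to the basis `seed`, `odd`. -/
abbrev coord (i : Fin 2) : (Fin 2 → ℂ) →ₗ[ℂ] ℂ := LinearMap.proj (R := ℂ) (φ := fun _ => ℂ) i

lemma augmented_K_seed : augmented K seed = seed := by simp [augmented_K, seed]

lemma augmented_E_seed : augmented E seed = odd := by simp [augmented_E, seed, odd]

lemma augmented_Y_seed : augmented Y seed = odd := by simp [augmented_Y, seed, odd]

lemma augmented_E_odd : augmented E odd = 0 := by simp [augmented_E, odd]

lemma augmented_Y_odd : augmented Y odd = 0 := by simp [augmented_Y, odd]

lemma augmented_K_odd : augmented K odd = -odd := by simp [augmented_K, odd]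

lemma augmented_E_Y_seed : augmented E (augmented Y seed) = 0 := by
  rw [augmented_Y_seed, augmented_E_odd]

lemma coord_one_odd : coord 1 odd = 1 := rfl

lemma eq_seed_add_odd (v : Fin 2 → ℂ) : v = coord 0 v • seed + coord 1 v • odd := by
  ext i
  fin_cases i <;> simp [seed, odd]

lemma eq_smul_odd_of_augmented_E {v : Fin 2 → ℂ} (hv : augmented E v = 0) :
    v = coord 1 v • odd := by
  have hv0 : coord 0 v = 0 := by simpa [augmented_E] using congrFun hv 1
  rw [eq_seed_add_odd v, hv0, zero_smul, zero_add, map_smul, coord_one_odd, smul_eq_mul, mul_one]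

lemma eq_zero_of_simpleTwo {t : Fin 2 → ℂ} (hE : simpleTwo E t = 0) (hY : simpleTwo Y t = 0) :
    t = 0 := by
  rw [← neg_neg t, ← simpleTwo_K_K t, ← simpleTwo_commutator t, hE, hY]
  simp only [map_zero, sub_zero, neg_zero]

section Decomposition

variable {M T : Type} [AddCommGroup M] [Module ℂ M] [AddCommGroup T] [Module ℂ T] {m n : M}
  {p q : M →ₗ[ℂ] ℂ}

lemma eq_tmul_lid_add_tmul_lid (hpq : ∀ v, v = p v • m + q v • n) (z : M ⊗[ℂ] T) :
    z = m ⊗ₜ TensorProduct.lid ℂ T (TensorProduct.map p LinearMap.id z) +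
      n ⊗ₜ TensorProduct.lid ℂ T (TensorProduct.map q LinearMap.id z) := by
  induction z with
  | zero => simp
  | add x y hx hy =>
    nth_rewrite 1 [hx, hy]
    simp only [map_add, TensorProduct.tmul_add]
    abel
  | tmul v t =>
    nth_rewrite 1 [hpq v]
    simp [TensorProduct.add_tmul, TensorProduct.smul_tmul]

lemma eq_rid_tmul_add_rid_tmul (hpq : ∀ v, v = p v • m + q v • n) (z : T ⊗[ℂ] M) :
    z = TensorProduct.rid ℂ T (TensorProduct.map LinearMap.id p z) ⊗ₜ m +
      TensorProduct.rid ℂ T (TensorProduct.map LinearMap.id q z) ⊗ₜ n := by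
  induction z with
  | zero => simp
  | add x y hx hy =>
    nth_rewrite 1 [hx, hy]
    simp only [map_add, TensorProduct.add_tmul]
    abel
  | tmul t v =>
    nth_rewrite 1 [hpq v]
    simp [TensorProduct.tmul_add, TensorProduct.smul_tmul]

end Decomposition

section Uniqueness

/-- On `simpleTwo` one has `K = E Y - Y E`, so a map commuting with `E` and `Y` up to a common sign
commutes with `K`. -/
lemma eq_zero_of_anticommutes_K {A : Module.End ℂ (Fin 2 → ℂ)} {ε : ℂ} (hε : ε * ε = 1)
    (hE : ∀ t, A (simpleTwo E t) = ε • simpleTwo E (A t))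
    (hY : ∀ t, A (simpleTwo Y t) = ε • simpleTwo Y (A t))
    (hK : ∀ t, A (simpleTwo K t) = -simpleTwo K (A t)) (t : Fin 2 → ℂ) : A t = 0 := by
  have hK' : A (simpleTwo K t) = simpleTwo K (A t) := by
    rw [← simpleTwo_commutator, map_sub, hE, hY, hY, hE]
    simp only [map_smul, smul_smul, hε, one_smul, simpleTwo_commutator]
  have hKA : simpleTwo K (A t) = 0 := self_eq_neg.1 (hK'.symm.trans (hK t))
  rw [← neg_neg (A t), ← simpleTwo_K_K (A t), hKA, map_zero, neg_zero]

lemma eq_zero_of_lid_eq_zero {d : (Fin 2 → ℂ) →ₗ[ℂ] (Fin 2 → ℂ) ⊗[ℂ] (Fin 2 → ℂ)}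
    (hd : ∀ a t, d (simpleTwo a t) = comulAction comul augmented simpleTwo a (d t))
    (hp : ∀ t, TensorProduct.lid ℂ (Fin 2 → ℂ)
      (TensorProduct.map (coord 0) LinearMap.id (d t)) = 0) (t : Fin 2 → ℂ) : d t = 0 := by
  let A : Module.End ℂ (Fin 2 → ℂ) :=
    (TensorProduct.lid ℂ _).toLinearMap ∘ₗ TensorProduct.map (coord 1) LinearMap.id ∘ₗ d
  have hA (t) : A t = TensorProduct.lid ℂ _ (TensorProduct.map (coord 1) LinearMap.id (d t)) := rfl
  have d_eq (t) : d t = odd ⊗ₜ A t := by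
    rw [eq_tmul_lid_add_tmul_lid eq_seed_add_odd (d t), hp, TensorProduct.tmul_zero, zero_add, hA]
  have hE (t) : A (simpleTwo E t) = (1 : ℂ) • simpleTwo E (A t) := by
    rw [hA, hd, d_eq, comulAction_E, augmented_E_odd]
    simp [odd]
  have hY (t) : A (simpleTwo Y t) = (1 : ℂ) • simpleTwo Y (A t) := by
    rw [hA, hd, d_eq, comulAction_Y, augmented_Y_odd]
    simp [odd]
  have hK (t) : A (simpleTwo K t) = -simpleTwo K (A t) := by
    rw [hA, hd, d_eq, comulAction_K, augmented_K_odd]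
    simp [odd]
  rw [d_eq, eq_zero_of_anticommutes_K (one_mul 1) hE hY hK, TensorProduct.tmul_zero]

lemma eq_zero_of_rid_eq_zero {d : (Fin 2 → ℂ) →ₗ[ℂ] (Fin 2 → ℂ) ⊗[ℂ] (Fin 2 → ℂ)}
    (hd : ∀ a t, d (simpleTwo a t) = comulAction comul simpleTwo augmented a (d t))
    (hp : ∀ t, TensorProduct.rid ℂ (Fin 2 → ℂ)
      (TensorProduct.map LinearMap.id (coord 0) (d t)) = 0) (t : Fin 2 → ℂ) : d t = 0 := by
  let A : Module.End ℂ (Fin 2 → ℂ) :=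
    (TensorProduct.rid ℂ _).toLinearMap ∘ₗ TensorProduct.map LinearMap.id (coord 1) ∘ₗ d
  have hA (t) : A t = TensorProduct.rid ℂ _ (TensorProduct.map LinearMap.id (coord 1) (d t)) := rfl
  have d_eq (t) : d t = A t ⊗ₜ odd := by
    rw [eq_rid_tmul_add_rid_tmul eq_seed_add_odd (d t), hp, TensorProduct.zero_tmul, zero_add, hA]
  have hE (t) : A (simpleTwo E t) = (-1 : ℂ) • simpleTwo E (A t) := by
    rw [hA, hd, d_eq, comulAction_E, augmented_E_odd, augmented_K_odd]
    simp [odd]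
  have hY (t) : A (simpleTwo Y t) = (-1 : ℂ) • simpleTwo Y (A t) := by
    rw [hA, hd, d_eq, comulAction_Y, augmented_Y_odd, augmented_K_odd]
    simp [odd]
  have hK (t) : A (simpleTwo K t) = -simpleTwo K (A t) := by
    rw [hA, hd, d_eq, comulAction_K, augmented_K_odd]
    simp [odd]
  rw [d_eq, eq_zero_of_anticommutes_K (by norm_num) hE hY hK, TensorProduct.zero_tmul]

lemma lid_leftSection (t : Fin 2 → ℂ) : TensorProduct.lid ℂ (Fin 2 → ℂ) (TensorProduct.map
    (coord 0) LinearMap.id (leftSection augmented simpleTwo seed t)) = t := by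
  rw [leftSection_apply, augmented_E_seed, augmented_Y_seed]
  simp [seed, odd]

lemma rid_rightSection (t : Fin 2 → ℂ) : TensorProduct.rid ℂ (Fin 2 → ℂ) (TensorProduct.map
    LinearMap.id (coord 0) (rightSection augmented simpleTwo seed t)) = t := by
  rw [rightSection_apply, augmented_E_seed, augmented_Y_seed]
  simp [seed, odd]

variable {s : (Fin 2 → ℂ) →ₗ[ℂ] (Fin 2 → ℂ) ⊗[ℂ] (Fin 2 → ℂ)}

lemma eq_leftSection (hs : ∀ a t, s (simpleTwo a t) = comulAction comul augmented simpleTwo a (s t))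
    (hp : ∀ t, TensorProduct.lid ℂ (Fin 2 → ℂ)
      (TensorProduct.map (coord 0) LinearMap.id (s t)) = t) :
    s = leftSection augmented simpleTwo seed := by
  refine sub_eq_zero.1 (LinearMap.ext (eq_zero_of_lid_eq_zero (fun a t => ?_) (fun t => ?_)))
  · rw [LinearMap.sub_apply, LinearMap.sub_apply, map_sub, hs,
      leftSection_intertwines augmented_K_seed augmented_E_Y_seed simpleTwo_e1]
  · rw [LinearMap.sub_apply, map_sub, map_sub, hp, lid_leftSection, sub_self]

lemma eq_rightSection
    (hs : ∀ a t, s (simpleTwo a t) = comulAction comul simpleTwo augmented a (s t))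
    (hp : ∀ t, TensorProduct.rid ℂ (Fin 2 → ℂ)
      (TensorProduct.map LinearMap.id (coord 0) (s t)) = t) :
    s = rightSection augmented simpleTwo seed := by
  refine sub_eq_zero.1 (LinearMap.ext (eq_zero_of_rid_eq_zero (fun a t => ?_) (fun t => ?_)))
  · rw [LinearMap.sub_apply, LinearMap.sub_apply, map_sub, hs,
      rightSection_intertwines augmented_K_seed augmented_E_Y_seed simpleTwo_e1]
  · rw [LinearMap.sub_apply, map_sub, map_sub, hp, rid_rightSection, sub_self]

end Uniqueness

/-- The two sides differ by a multiple of `n ⊗ K t ⊗ n`, which the coassociator `1` does not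
cancel. -/
lemma map_leftSection_ne_assoc_map_rightSection :
    TensorProduct.map LinearMap.id (rightSection augmented simpleTwo seed)
      (leftSection augmented simpleTwo seed seed) ≠
    TensorProduct.assoc ℂ _ _ _ (TensorProduct.map (leftSection augmented simpleTwo seed)
      LinearMap.id (rightSection augmented simpleTwo seed seed)) := by
  rw [assoc_map_leftSection_rightSection simpleTwo_e1, augmented_E_seed, augmented_Y_seed, ne_comm,
    Ne, sub_eq_self]
  intro difference_eq_zero
  have coordinate_eq_zero := congrArg (coord 0 ∘ TensorProduct.lid ℂ (Fin 2 → ℂ) ∘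
    TensorProduct.map (coord 1) ((TensorProduct.rid ℂ (Fin 2 → ℂ)).toLinearMap ∘ₗ
      TensorProduct.map LinearMap.id (coord 1))) difference_eq_zero
  norm_num [odd, seed, simpleTwo_K] at coordinate_eq_zero

end Q

section StandardCrossing

variable {Ψ : Q ⊗[ℂ] (Q ⊗[ℂ] Q)} (h : IsCoassociator Ψ)

/-- `augmented` as an object of the category of representations. -/
abbrev augmentedRep : (QuasiBialgebra.ofCoassociator Q Ψ h).Rep := ⟨Fin 2 → ℂ, augmented⟩

/-- `simpleTwo` as an object of the category of representations. -/
abbrev simpleTwoRep : (QuasiBialgebra.ofCoassociator Q Ψ h).Rep := ⟨Fin 2 → ℂ, simpleTwo⟩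

/-- The projection of `augmented` to the trivial representation. -/
def augmentation : augmentedRep h ⟶ QuasiBialgebra.Rep.unit _ :=
  ⟨coord 0, intertwines_of_generators (ρ := augmented) (σ := counitAction counit) (coord 0)
    (fun v => by simp [augmented_E, Algebra.ofId_apply])
    (fun v => by simp [augmented_Y, Algebra.ofId_apply, counit_Y])
    (fun v => by simp [augmented_K, Algebra.ofId_apply])⟩

variable {h}

lemma SelfInverse.comparable_augmentedRep {X : (QuasiBialgebra.ofCoassociator Q Ψ h).Rep}
    (hX : SelfInverse X) (f g : X ⟶ augmentedRep h) :
    (∃ s : X ⟶ X, g = s ≫ f) ∨ (∃ s : X ⟶ X, f = s ≫ g) := by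
  obtain ⟨v, hspan, hE, -⟩ := hX.exists_generator
  have exists_smul_odd (f : X ⟶ augmentedRep h) : ∃ a : ℂ, f.hom v = a • odd :=
    ⟨_, eq_smul_odd_of_augmented_E ((f.comm E v).symm.trans (by rw [hE, map_zero]))⟩
  obtain ⟨a, ha⟩ := exists_smul_odd f
  obtain ⟨b, hb⟩ := exists_smul_odd g
  by_cases ha0 : a = 0
  · refine Or.inr (exists_eq_comp_of_generator hspan (c := 0) ?_)
    rw [ha, ha0, zero_smul, zero_smul]
  · refine Or.inl (exists_eq_comp_of_generator hspan (c := b / a) ?_)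
    rw [ha, hb, smul_smul, div_mul_cancel₀ b ha0]

lemma SelfInverse.subsingleton_hom_simpleTwoRep
    {X : (QuasiBialgebra.ofCoassociator Q Ψ h).Rep} (hX : SelfInverse X) :
    Subsingleton (X ⟶ simpleTwoRep h) := by
  obtain ⟨v, hspan, hE, hY⟩ := hX.exists_generator
  have hom_eq_zero (f : X ⟶ simpleTwoRep h) : f.hom v = 0 := eq_zero_of_simpleTwo
    ((f.comm E v).symm.trans (by rw [hE, map_zero]))
    ((f.comm Y v).symm.trans (by rw [hY, map_zero]))
  exact ⟨fun f g => hom_ext_of_generator hspan ((hom_eq_zero f).trans (hom_eq_zero g).symm)⟩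

variable (h)

/-- The crossing formed by `augmented` and `simpleTwo`, which exists for every coassociator. -/
def standardCrossing : Crossing (QuasiBialgebra.ofCoassociator Q Ψ h).Rep where
  M := augmentedRep h
  T := simpleTwoRep h
  p := augmentation h
  left := ⟨leftSection augmented simpleTwo seed,
    leftSection_intertwines augmented_K_seed augmented_E_Y_seed simpleTwo_e1⟩
  right := ⟨rightSection augmented simpleTwo seed,
    rightSection_intertwines augmented_K_seed augmented_E_Y_seed simpleTwo_e1⟩
  left_p := QuasiBialgebra.Rep.hom_ext (LinearMap.ext lid_leftSection)
  right_p := QuasiBialgebra.Rep.hom_ext (LinearMap.ext rid_rightSection)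
  left_unique s hs := QuasiBialgebra.Rep.hom_ext
    (eq_leftSection s.comm (QuasiBialgebra.Rep.congr_hom hs))
  right_unique s hs := QuasiBialgebra.Rep.hom_ext
    (eq_rightSection s.comm (QuasiBialgebra.Rep.congr_hom hs))
  comparable _ hX := hX.comparable_augmentedRep
  subsingleton _ hX := hX.subsingleton_hom_simpleTwoRep

end StandardCrossing

lemma not_commutes_standardCrossing :
    ¬ (standardCrossing (isCoassociator_one (A := Q))).Commutes := by
  intro hc
  have sections_eq : TensorProduct.map LinearMap.id (rightSection augmented simpleTwo seed)
      (leftSection augmented simpleTwo seed seed) = assocBy augmented simpleTwo augmented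
      ((isCoassociator_one (A := Q)).isUnit.unit⁻¹).val (TensorProduct.map
        (leftSection augmented simpleTwo seed) LinearMap.id
        (rightSection augmented simpleTwo seed seed)) :=
    QuasiBialgebra.Rep.congr_hom hc seed
  have unit_inv_eq_one : ((isCoassociator_one (A := Q)).isUnit.unit⁻¹).val = 1 := by
    rw [show (isCoassociator_one (A := Q)).isUnit.unit = 1 from Units.ext rfl, inv_one,
      Units.val_one]
  rw [unit_inv_eq_one, assocBy, map_one] at sections_eq
  exact map_leftSection_ne_assoc_map_rightSection sections_eq

theorem not_monoidallyEquivalent {β : ℂ} (h : IsCoassociator (Φ β)) :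
    ¬ QuasiBialgebra.MonoidallyEquivalent (QuasiBialgebra.ofCoassociator Q (Φ β) h)
      (QuasiBialgebra.ofBialgebra Q) := by
  rintro ⟨F, _, ⟨_⟩⟩
  let e := F.asEquivalence
  have : e.functor.Monoidal := ‹F.Monoidal›
  have : e.inverse.Monoidal := e.inverseMonoidal
  exact not_commutes_standardCrossing (Crossing.Commutes.of_map
    (C := (QuasiBialgebra.ofBialgebra Q).Rep) e.inverse (Crossing.commutes _))

end QHopf

end

theorem mainTheorem5 (β : ℂ) (hβ : β ^ 4 = -1) :
    ∃ h : QHopf.IsCoassociator (QHopf.Q.Φ β),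
      QHopf.H3.mk (QHopf.Q.Φ β) h ≠ QHopf.H3.trivial ∧
      ¬ QHopf.QuasiBialgebra.IsTwistEquivalent (QHopf.QuasiBialgebra.ofBialgebra QHopf.Q)
        (QHopf.QuasiBialgebra.ofCoassociator QHopf.Q (QHopf.Q.Φ β) h) ∧
      IsEmpty (QHopf.QuasiBialgebra.idFunctor
        (QHopf.QuasiBialgebra.ofCoassociator QHopf.Q (QHopf.Q.Φ β) h)
        (QHopf.QuasiBialgebra.ofBialgebra QHopf.Q)).Monoidal ∧
      ¬ QHopf.QuasiBialgebra.MonoidallyEquivalent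
        (QHopf.QuasiBialgebra.ofCoassociator QHopf.Q (QHopf.Q.Φ β) h)
        (QHopf.QuasiBialgebra.ofBialgebra QHopf.Q) := by
  have h := QHopf.Q.isCoassociator_Φ hβ
  have hequiv := QHopf.not_monoidallyEquivalent h
  have htwist := mt QHopf.QuasiBialgebra.IsTwistEquivalent.monoidallyEquivalent hequiv
  have hclass : QHopf.H3.mk (QHopf.Q.Φ β) h ≠ QHopf.H3.trivial := fun heq =>
    htwist (QHopf.QuasiBialgebra.isTwistEquivalent_of_H3_eq QHopf.isCoassociator_one h heq.symm)
  exact ⟨h, hclass, htwist, ⟨fun hid => hequiv ⟨_, inferInstance, ⟨hid⟩⟩⟩, hequiv⟩
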